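/- **Theorem 3.1.** Let $d\ge 1$, let $r\in(d,\infty]$ with $r\ge 2$, let $q\in(2,\infty]$, and assume $$\delta_1:=\tfrac12-\tfrac{d}{2r}-\tfrac1q>0 \qquad (\text{with } 1/\infty=0).$$ For $\nu>0$ let $p(x,s)=(4\pi\nu s)^{-d/2}\exp\!\big(-|x|^2/(4\nu s)\big)$, $x\in\mathbb R^d$, $s>0$, and call a function *of type $j$* if it is a partial derivative of $p$ of order $j$ in the space variables (with respect to any choice of $j$ coordinates). For $T\ge 0$ and measurable $f:\mathbb R^d\times[0,T]\to\mathbb R$ put $$\|f\|_{r,q}=\Big[\int_0^T\|f(\cdot,t)\|_{L^r(\mathbb R^d)}^q\,dt\Big]^{1/q}$$ (with the essential supremum if $q=\infty$), and let $L^{r,q}$ be the set of those $f$ for which this is finite. For $0\le t_0\le t\le T$ let $\Delta^k=\{(t_1,\dots,t_k): t_0\le t_1\le\dots\le t_k\le t\}$. For $k\ge1$, $\alpha\ge0$ and $f_1,\dots,f_k\in L^{r,q}$, a *block integral* is $$I_k(f_1,\dots,f_k)=\int_{\Delta^k}\left[\int_{\mathbb R^{kd}}\prod_{i=1}^k f_i(z_i,t_i)\,h_i(z_i-z_{i-1},t_i-t_{i-1})\;dz_1\cdots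 dz_k\right](t-t_k)^\alpha\,dt_1\cdots dt_k,\qquad z_0=0,$$ where $h_1$ is of type $1$ if $k=1$; and, if $k\ge2$, $h_1=p$, $h_i$ is of type $1$ for $1<i<k$, and $h_k$ is of type $2$. Then there is a constant $C_7>0$ depending only on $d,r,q$ such that, for all $\nu>0$, $0\le t_0\le t\le T$, $\alpha\ge0$, $k\ge1$, all kernels $h_1,\dots,h_k$ of the types above and all $f_1,\dots,f_k\in L^{r,q}$, the inner integral converges absolutely for almost every $(t_1,\dots,t_k)\in\Delta^k$, the outer integrand is absolutely integrable on $\Delta^k$, and $$|I_k(f_1,\dots,f_k)|\le C_7^k\,\nu^{-k\left(\frac d{2r}+\frac12\right)}\,\gamma_k(\alpha)\,(t-t_0)^{\alpha+k\delta_1}\prod_{i=1}^k\|f_i\|_{r,q},\qquad \gamma_k(\alpha)=\frac{\alpha^\alpha}{(\alpha+k\delta_1)^{\alpha+k\delta_1}}\quad(0^0=1).$$ -/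

import Mathlib

open MeasureTheory Set
open scoped ENNReal

noncomputable section

namespace BlockIntegral

/-- Euclidean space `ℝᵈ`. -/
abbrev Space (d : ℕ) : Type := EuclideanSpace ℝ (Fin d)

/-- The profile `p(z) = (4π)^{-d/2} exp(-|z|²/4)`. -/
def gaussProfile {d : ℕ} (z : Space d) : ℝ :=
  (4 * Real.pi) ^ (-(d : ℝ) / 2) * Real.exp (-(‖z‖ ^ 2) / 4)

/-- The heat kernel `p(x,s) = (sν)^{-d/2} p(x / √(sν))` of viscosity `ν`; only times `s > 0` are
meaningful. -/
def heatKernel {d : ℕ} (ν : ℝ) (x : Space d) (s : ℝ) : ℝ :=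
  (s * ν) ^ (-(d : ℝ) / 2) * gaussProfile ((Real.sqrt (s * ν))⁻¹ • x)

/-- The partial derivative of `g` in the `i`-th coordinate direction. -/
def partialDeriv {d : ℕ} (i : Fin d) (g : Space d → ℝ) (x : Space d) : ℝ :=
  lineDeriv ℝ g x (EuclideanSpace.single i 1)

/-- `h` is of type `j`: it is a spatial partial derivative of order `j` of the heat kernel,
that is `h = ∂_{i₁} ⋯ ∂_{iⱼ} p` for some coordinate indices `i₁, …, iⱼ`. -/
def IsOfType {d : ℕ} (ν : ℝ) : ℕ → (Space d → ℝ → ℝ) → Prop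
  | 0, h => h = heatKernel ν
  | j + 1, h => ∃ (g : Space d → ℝ → ℝ) (i : Fin d), IsOfType ν j g ∧
      h = fun x s => partialDeriv i (fun y => g y s) x

/-- The type of the `i`-th kernel (counted from `0`) in a block of length `k`: the sequence of
types is `(1)` for `k = 1`, `(0, 2)` for `k = 2` and `(0, 1, …, 1, 2)` for `k > 2`. -/
def blockType (k : ℕ) (i : Fin k) : ℕ :=
  if k = 1 then 1
  else if (i : ℕ) = 0 then 0
  else if (i : ℕ) = k - 1 then 2
  else 1

/-- The mixed norm `‖f‖_{r,q} = [∫₀ᵀ ‖f(·,t)‖_{L^r(ℝᵈ)}^q dt]^{1/q}` with the usual essential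
suprema for infinite exponents, as an element of `[0,∞]`. -/
def mixedNorm {d : ℕ} (r q : ℝ≥0∞) (T : ℝ) (f : Space d → ℝ → ℝ) : ℝ≥0∞ :=
  eLpNorm (fun t : ℝ => eLpNorm (fun x : Space d => f x t) r volume) q
    (volume.restrict (Icc 0 T))

/-- `f` belongs to `L^{r,q}`: it is (Lebesgue) measurable on `ℝᵈ × [0,T]` and its mixed norm is
finite. -/
def MemMixed {d : ℕ} (r q : ℝ≥0∞) (T : ℝ) (f : Space d → ℝ → ℝ) : Prop :=
  AEMeasurable (Function.uncurry f) (volume.restrict (univ ×ˢ Icc (0 : ℝ) T)) ∧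
    mixedNorm r q T f < ∞

/-- `δ₁ = 1/2 - d/(2r) - 1/q`, where `1/∞ = 0`. -/
def deltaOne (d : ℕ) (r q : ℝ≥0∞) : ℝ :=
  1 / 2 - (d : ℝ) / 2 * (r⁻¹).toReal - (q⁻¹).toReal

/-- The simplex `Δᵏ(t₀,t) = {t₀ ≤ t₁ ≤ ⋯ ≤ t_k ≤ t}`. -/
def timeSimplex (k : ℕ) (t₀ t : ℝ) : Set (Fin k → ℝ) :=
  {s | (∀ i, t₀ ≤ s i) ∧ Monotone s ∧ ∀ i, s i ≤ t}

/-- For a finite sequence `(s₁, …, s_k)` put `s₀ = a`; this is the extended sequence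
`(s₀, s₁, …, s_k)`. -/
def withStart {X : Type*} {k : ℕ} (a : X) (s : Fin k → X) : Fin (k + 1) → X := Fin.cons a s

/-- The integrand
`(∏ᵢ fᵢ(zᵢ,sᵢ) hᵢ(zᵢ - zᵢ₋₁, sᵢ - sᵢ₋₁)) (t - s_k)^α`, with `z₀ = 0` and `s₀ = t₀`. -/
def blockIntegrand {d k : ℕ} (f h : Fin k → Space d → ℝ → ℝ) (α t₀ t : ℝ)
    (s : Fin k → ℝ) (z : Fin k → Space d) : ℝ :=
  (∏ i : Fin k, f i (z i) (s i) *
      h i (z i - withStart 0 z i.castSucc) (s i - withStart t₀ s i.castSucc)) *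
    (t - withStart t₀ s (Fin.last k)) ^ α

/-- The block integral `∫_{Δᵏ(t₀,t)} ∫_{ℝᵏᵈ} … dz ds`: first the space integral at fixed times,
then the time integral. -/
def blockIntegral {d k : ℕ} (f h : Fin k → Space d → ℝ → ℝ) (α t₀ t : ℝ) : ℝ :=
  ∫ s in timeSimplex k t₀ t, ∫ z : Fin k → Space d, blockIntegrand f h α t₀ t s z

/-- `γ_k(α) = α^α / (α + kδ)^{α + kδ}`; real powers satisfy `0^0 = 1`. -/
def gammaFactor (k : ℕ) (δ α : ℝ) : ℝ :=
  α ^ α / (α + k * δ) ^ (α + k * δ)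

end BlockIntegral

end

/-! Put `κ = 1/2 + d/(2r)`, so that `δ₁ = 1 - 1/q - κ > 0`. If every kernel had order 1, absolute
values would suffice. Hölder's inequality against Gaussians in space leaves the singularity
`gap^(-κ)` for each time gap (`lintegral_spaceChain_le`). Hölder's inequality in time then turns
each time integration into a beta integral, which raises the exponent `A` of the remaining time by
`δ₁` at the cost of a factor `C (A+2)^(-δ₁)` (`lintegral_step_le`, `lintegral_timeChain_le`). Since
`γ_k` telescopes into one-step factors of that size, the product is at most `C^k γ_k(α)`
(`prod_step_le`).

For `k ≥ 2` the orders are `0, 1, …, 1, 2`. The total is the same, but the last gap carries a power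
that is not integrable. Let `τ, θ` be the last two times, `S = ν(τ - t₀)` and `σ = ν(θ - τ)`. The
derivative missing from the first kernel yields a factor `S^(1/2)` (`prod_order_le`). If `σ > S`,
then `S^(1/2) σ^(-1) ≤ σ^(-1/2)` and the bound above applies again.

If `σ ≤ S`, cancellation in the second derivative must be used. Let `A(z)` be the chain integrated
over all points before the one at time `τ`, and `g` the last function. `A` is dominated by a
Gaussian of variance of order `S` times the function at time `τ`. With the Gaussian weight `w_S`,
the last two points contribute `A K g = (A/w_S) K (w_S - w_{S+σ}) g + (A/w_S) K (w_{S+σ} g)`, where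
`K` is a second derivative of the heat kernel at time `σ`. The difference of weights gains
`(σ/S)^(1/2)` (`enorm_heatK2_mul_weight_sub_le`), so the first term is again of order-1 type. In the
second term `K` is a composition of two first derivatives at time `σ/2`
(`integral_heatK1_mul_heatK1`). By Cauchy–Schwarz the form is at most the product of the square
roots of two dissipations. The energy estimate `setLIntegral_dissip_le` makes each of these square
integrable in the gap, with norm bounded by the `L²` norm of the weighted function, which is
controlled because `r ≥ 2`.

A joint Cauchy–Schwarz inequality in `(τ, θ)` (`lintegral_bilinear_pw_le`) then integrates the last
two times. It involves squares of functions in `L^q`, hence the need for `q > 2`. The earlier times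
are handled by Minkowski's inequality and the chain estimate, and `exists_main_const` shows that the
resulting constants still combine to `γ_k(α)`. -/

noncomputable section

namespace BlockIntegral

/-! ### Truncated powers and Hölder's inequality -/

/-- The function `v ↦ v ^ A` on `(0,∞)`, extended by zero. -/
def pw (A v : ℝ) : ℝ≥0∞ := if 0 < v then ENNReal.ofReal (v ^ A) else 0

lemma pw_of_pos {A v : ℝ} (hv : 0 < v) : pw A v = ENNReal.ofReal (v ^ A) := if_pos hv

lemma pw_of_nonpos {A v : ℝ} (hv : v ≤ 0) : pw A v = 0 := if_neg (not_lt.2 hv)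

lemma measurable_pw (A : ℝ) : Measurable (pw A) :=
  Measurable.ite measurableSet_Ioi (by fun_prop) measurable_const

@[fun_prop]
lemma Measurable.pw {α : Type*} [MeasurableSpace α] (A : ℝ) {g : α → ℝ} (hg : Measurable g) :
    Measurable fun x => pw A (g x) := (measurable_pw A).comp hg

lemma pw_ne_top (A v : ℝ) : pw A v ≠ ∞ := by
  unfold pw; split_ifs <;> simp

lemma pw_mul_pw (A B v : ℝ) : pw A v * pw B v = pw (A + B) v := by
  unfold pw; split_ifs with h
  · rw [← ENNReal.ofReal_mul (by positivity), Real.rpow_add h]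
  · simp

lemma pw_rpow {p : ℝ} (hp : 0 < p) (A v : ℝ) : pw A v ^ p = pw (A * p) v := by
  unfold pw; split_ifs with h
  · rw [ENNReal.ofReal_rpow_of_pos (by positivity), Real.rpow_mul h.le]
  · simp [hp]

lemma pw_const_mul {ν : ℝ} (hν : 0 < ν) (A v : ℝ) :
    pw A (ν * v) = ENNReal.ofReal (ν ^ A) * pw A v := by
  unfold pw
  by_cases h : 0 < v
  · rw [if_pos h, if_pos (by positivity), ← ENNReal.ofReal_mul (by positivity),
      Real.mul_rpow hν.le h.le]
  · rw [if_neg h, if_neg (by intro h'; exact h (pos_of_mul_pos_right h' hν.le)), mul_zero]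

/-- Hölder's inequality for `f ^ θ * g`, where the norm of `f` may be an essential supremum. -/
lemma lintegral_rpow_mul_le {α : Type*} [MeasurableSpace α] {μ : Measure α} {f g : α → ℝ≥0∞}
    (hf : Measurable f) (hg : Measurable g) {p : ℝ≥0∞} {θ : ℝ} (hθ : 0 < θ)
    (hp : θ * (p⁻¹).toReal < 1) (hp0 : p ≠ 0) :
    ∫⁻ x, f x ^ θ * g x ∂μ ≤ eLpNorm f p μ ^ θ *
      (∫⁻ x, g x ^ (1 - θ * (p⁻¹).toReal)⁻¹ ∂μ) ^ (1 - θ * (p⁻¹).toReal) := by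
  rcases eq_or_ne p ∞ with rfl | hpt
  · simp only [ENNReal.inv_top, ENNReal.toReal_zero, mul_zero, sub_zero, inv_one,
      ENNReal.rpow_one]
    rw [← lintegral_const_mul _ hg]
    refine lintegral_mono_ae ?_
    filter_upwards [enorm_ae_le_eLpNormEssSup f μ] with x hx
    rw [eLpNorm_exponent_top]
    gcongr
    simpa using hx
  · have hpr : 0 < p.toReal := ENNReal.toReal_pos hp0 hpt
    rw [ENNReal.toReal_inv] at hp ⊢
    have h1 : θ < p.toReal := by
      rw [← div_eq_mul_inv, div_lt_one hpr] at hp; exact hp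
    have hconj : (p.toReal / θ).HolderConjugate ((1 - θ * p.toReal⁻¹)⁻¹) := by
      rw [Real.holderConjugate_iff]
      refine ⟨by rwa [lt_div_iff₀ hθ, one_mul], ?_⟩
      rw [inv_inv, inv_div]; field_simp; ring
    refine (ENNReal.lintegral_mul_le_Lp_mul_Lq μ hconj (hf.pow_const θ).aemeasurable
      hg.aemeasurable).trans_eq ?_
    rw [eLpNorm_eq_lintegral_rpow_enorm_toReal hp0 hpt]
    simp only [enorm_eq_self, ← ENNReal.rpow_mul, one_div, inv_inv, inv_div]
    congr 3
    · ext x; rw [mul_div_cancel₀ _ hθ.ne']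
    · field_simp

lemma lintegral_mul_le {α : Type*} [MeasurableSpace α] {μ : Measure α} {f g : α → ℝ≥0∞}
    (hf : Measurable f) (hg : Measurable g) {p : ℝ≥0∞} (hp : 1 < p) :
    ∫⁻ x, f x * g x ∂μ ≤ eLpNorm f p μ *
      (∫⁻ x, g x ^ (1 - (p⁻¹).toReal)⁻¹ ∂μ) ^ (1 - (p⁻¹).toReal) := by
  have h1 : (p⁻¹).toReal < 1 := by
    have : p⁻¹ < 1 := ENNReal.inv_lt_one.2 hp
    simpa using (ENNReal.toReal_lt_toReal (ne_top_of_lt this) ENNReal.one_ne_top).2 this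
  simpa using lintegral_rpow_mul_le (μ := μ) hf hg one_pos (by simpa using h1)
    (zero_lt_one.trans hp).ne'

/-! ### Beta integrals -/

lemma setLIntegral_Iio_pw {x : ℝ} (hx : 0 < x) {b : ℝ} (hb : 0 ≤ b) :
    ∫⁻ v in Iio b, pw (x - 1) v = ENNReal.ofReal (b ^ x / x) := by
  have h1 : ∫⁻ v in Iio b, pw (x - 1) v = ∫⁻ v in Ioc 0 b, ENNReal.ofReal (v ^ (x - 1)) := by
    rw [setLIntegral_congr Iio_ae_eq_Iic, ← lintegral_indicator measurableSet_Iic,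
      ← lintegral_indicator measurableSet_Ioc]
    congr 1; ext v
    unfold pw
    by_cases h : 0 < v <;> by_cases h' : v ≤ b <;> simp [indicator, h, h']
  rw [h1, ← ofReal_integral_eq_lintegral_ofReal, ← intervalIntegral.integral_of_le hb,
    integral_rpow (Or.inl (by linarith))]
  · simp [Real.zero_rpow hx.ne']
  · exact (intervalIntegral.intervalIntegrable_rpow' (by linarith)).1
  · refine (ae_restrict_iff' measurableSet_Ioc).2 (ae_of_all _ fun v hv => ?_)
    exact Real.rpow_nonneg hv.1.le _

lemma setLIntegral_Ioi_exp {c : ℝ} (hc : 0 < c) :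
    ∫⁻ v in Ioi (0 : ℝ), ENNReal.ofReal (Real.exp (-(c * v))) = ENNReal.ofReal c⁻¹ := by
  rw [← ofReal_integral_eq_lintegral_ofReal]
  · congr 1
    have := integral_exp_mul_Ioi (a := -c) (by linarith) 0
    simp only [neg_mul] at this
    rw [this]; simp [div_neg, neg_div]
  · have := exp_neg_integrableOn_Ioi 0 hc
    simp only [neg_mul] at this
    exact this
  · exact ae_of_all _ fun v => (Real.exp_pos _).le

/-- A bound for `Γ(x) l^(-x)` with explicit dependence on `x`. Below `x/l` the exponential is
dropped. Above it, `v^(x-1) ≤ (l/x) v^x`, and half of the exponential reduces `v^x` to `(x/l)^x`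
while the other half is integrated. -/
lemma lintegral_pw_mul_exp_le {x l : ℝ} (hx : 0 < x) (hl : 0 < l) :
    ∫⁻ v, pw (x - 1) v * ENNReal.ofReal (Real.exp (-(l * v))) ≤
      ENNReal.ofReal (3 / x * (x / l) ^ x) := by
  have hb : 0 < x / l := by positivity
  rw [← lintegral_add_compl _ (measurableSet_Iio (a := x / l))]
  have hA : ∫⁻ v in Iio (x / l), pw (x - 1) v * ENNReal.ofReal (Real.exp (-(l * v))) ≤
      ENNReal.ofReal ((x / l) ^ x / x) := by
    rw [← setLIntegral_Iio_pw hx hb.le]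
    refine lintegral_mono fun v => ?_
    unfold pw; split_ifs with h
    · refine mul_le_of_le_one_right' ?_
      rw [ENNReal.ofReal_le_one, Real.exp_le_one_iff]
      nlinarith [mul_pos hl h]
    · simp
  have hB : ∫⁻ v in (Iio (x / l))ᶜ, pw (x - 1) v * ENNReal.ofReal (Real.exp (-(l * v))) ≤
      ENNReal.ofReal (2 / x * (x / l) ^ x) := by
    calc _ ≤ ∫⁻ v in (Iio (x / l))ᶜ, ENNReal.ofReal (l / x * (x / l) ^ x) *
            ENNReal.ofReal (Real.exp (-(l / 2 * v))) := by
          refine setLIntegral_mono (by fun_prop) fun v hv => ?_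
          have hv' : x / l ≤ v := by simpa using hv
          have hv0 : 0 < v := hb.trans_le hv'
          rw [pw_of_pos hv0, ← ENNReal.ofReal_mul (by positivity),
            ← ENNReal.ofReal_mul (by positivity)]
          refine ENNReal.ofReal_le_ofReal ?_
          have e1 : v ^ (x - 1) ≤ v ^ x * (l / x) := by
            rw [Real.rpow_sub_one hv0.ne', div_eq_mul_inv]
            gcongr
            rw [inv_le_comm₀ hv0 (by positivity), inv_div]; exact hv'
          have e2 : v ^ x * Real.exp (-(l / 2 * v)) ≤ (x / l) ^ x := by
            have hy : 0 < l * v / x := by positivity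
            -- `log y ≤ y/2` follows from `log (y/2) ≤ y/2 - 1` and `log 2 < 1`.
            have hlog : Real.log (l * v / x) ≤ l * v / x / 2 := by
              have h3 := Real.log_le_sub_one_of_pos (x := l * v / x / 2) (by positivity)
              rw [Real.log_div hy.ne' (by norm_num)] at h3
              have := Real.log_two_lt_d9
              linarith
            have : v ^ x = (x / l) ^ x * Real.exp (x * Real.log (l * v / x)) := by
              rw [mul_comm x, ← Real.rpow_def_of_pos hy, ← Real.mul_rpow hb.le hy.le]
              congr 1; field_simp
            rw [this, mul_assoc, ← Real.exp_add]
            refine mul_le_of_le_one_right (by positivity) ?_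
            rw [Real.exp_le_one_iff]
            have : x * Real.log (l * v / x) ≤ x * (l * v / x / 2) := by gcongr
            have e : x * (l * v / x / 2) = l / 2 * v := by field_simp
            linarith
          have e3 : Real.exp (-(l * v)) =
              Real.exp (-(l / 2 * v)) * Real.exp (-(l / 2 * v)) := by
            rw [← Real.exp_add]; ring_nf
          calc _ ≤ v ^ x * (l / x) * (Real.exp (-(l / 2 * v)) * Real.exp (-(l / 2 * v))) := by
                rw [e3]; gcongr
            _ = l / x * (v ^ x * Real.exp (-(l / 2 * v))) * Real.exp (-(l / 2 * v)) := by ring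
            _ ≤ _ := by gcongr
      _ ≤ ∫⁻ v in Ioi 0, ENNReal.ofReal (l / x * (x / l) ^ x) *
            ENNReal.ofReal (Real.exp (-(l / 2 * v))) := by
          refine lintegral_mono_set fun v hv => ?_
          exact hb.trans_le (by simpa using hv)
      _ = _ := by
          rw [lintegral_const_mul _ (by fun_prop), setLIntegral_Ioi_exp (by positivity),
            ← ENNReal.ofReal_mul (by positivity)]
          congr 1; field_simp
  refine (add_le_add hA hB).trans_eq ?_
  rw [← ENNReal.ofReal_add (by positivity) (by positivity)]
  congr 1; ring

/-- The decay `(x/(x+D))^x` in `D` is the source of the factor `γ_k(α)`. For `D ≤ x` that factor is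
at least `2^(-x)`, so `(l-v)^D ≤ l^D` is enough. For `D > x`, the inequality `(l-v)^D ≤ l^D
exp(-Dv/l)` reduces the claim to a Gamma integral. -/
lemma lintegral_beta_le {x D : ℝ} (hx : 0 < x) (hD : 0 ≤ D) (l : ℝ) :
    ∫⁻ v, pw (x - 1) v * pw D (l - v) ≤
      ENNReal.ofReal (3 / x * 2 ^ x * (x / (x + D)) ^ x) * pw (x + D) l := by
  rcases le_or_gt l 0 with hl | hl
  · rw [pw_of_nonpos hl, mul_zero, nonpos_iff_eq_zero]
    refine lintegral_eq_zero_of_ae_eq_zero (ae_of_all _ fun v => ?_)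
    rcases le_or_gt v 0 with hv | hv
    · simp [pw_of_nonpos hv]
    · simp [pw_of_nonpos (show l - v ≤ 0 by linarith)]
  rw [pw_of_pos hl, ← ENNReal.ofReal_mul (by positivity)]
  rcases le_or_gt D x with hDx | hDx
  · calc _ ≤ ∫⁻ v in Iio l, ENNReal.ofReal (l ^ D) * pw (x - 1) v := by
          rw [← lintegral_indicator measurableSet_Iio]
          refine lintegral_mono fun v => ?_
          by_cases hv : v < l
          · rw [indicator_of_mem (by exact hv), pw_of_pos (by linarith : 0 < l - v), mul_comm]
            rcases le_or_gt v 0 with h0 | h0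
            · simp [pw_of_nonpos h0]
            · gcongr
              all_goals linarith
          · simp [pw_of_nonpos (show l - v ≤ 0 by linarith)]
      _ = ENNReal.ofReal (l ^ D * (l ^ x / x)) := by
          rw [lintegral_const_mul _ (measurable_pw _), setLIntegral_Iio_pw hx hl.le,
            ← ENNReal.ofReal_mul (by positivity)]
      _ ≤ _ := by
          refine ENNReal.ofReal_le_ofReal ?_
          have : (1 : ℝ) ≤ 2 ^ x * (x / (x + D)) ^ x := by
            rw [← Real.mul_rpow (by norm_num) (by positivity)]
            refine Real.one_le_rpow ?_ hx.le
            rw [mul_div_assoc', le_div_iff₀ (by positivity)]; linarith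
          calc l ^ D * (l ^ x / x) = 1 / x * 1 * l ^ (x + D) := by
                rw [Real.rpow_add hl]; ring
            _ ≤ 3 / x * (2 ^ x * (x / (x + D)) ^ x) * l ^ (x + D) := by
                gcongr; norm_num
            _ = _ := by ring
  · have hD0 : 0 < D := hx.trans hDx
    calc _ ≤ ∫⁻ v, ENNReal.ofReal (l ^ D) *
            (pw (x - 1) v * ENNReal.ofReal (Real.exp (-(D / l * v)))) := by
          refine lintegral_mono fun v => ?_
          by_cases hv : v < l
          · rw [pw_of_pos (by linarith : 0 < l - v), mul_left_comm]
            gcongr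
            rw [← ENNReal.ofReal_mul (by positivity)]
            refine ENNReal.ofReal_le_ofReal ?_
            have e1 : l - v ≤ l * Real.exp (-(v / l)) := by
              have := Real.add_one_le_exp (-(v / l))
              calc l - v = l * (-(v / l) + 1) := by field_simp; ring
                _ ≤ _ := by gcongr
            calc (l - v) ^ D ≤ (l * Real.exp (-(v / l))) ^ D :=
                  Real.rpow_le_rpow (by linarith) e1 hD0.le
              _ = _ := by
                rw [Real.mul_rpow hl.le (Real.exp_pos _).le, ← Real.exp_mul]
                congr 2; field_simp
          · simp [pw_of_nonpos (show l - v ≤ 0 by linarith)]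
      _ ≤ ENNReal.ofReal (l ^ D * (3 / x * (x / (D / l)) ^ x)) := by
          rw [lintegral_const_mul _ (by fun_prop), ENNReal.ofReal_mul (by positivity)]
          gcongr
          exact lintegral_pw_mul_exp_le hx (by positivity)
      _ ≤ _ := by
          refine ENNReal.ofReal_le_ofReal ?_
          have : (x / (D / l)) ^ x ≤ (2 * (x / (x + D)) * l) ^ x := by
            refine Real.rpow_le_rpow (by positivity) ?_ hx.le
            rw [div_div_eq_mul_div, mul_div_assoc', div_mul_eq_mul_div,
              div_le_div_iff₀ hD0 (by positivity)]
            nlinarith [mul_pos hx hl]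
          rw [Real.mul_rpow (by positivity) hl.le, Real.mul_rpow (by positivity) (by positivity)]
            at this
          calc _ ≤ l ^ D * (3 / x * (2 ^ x * (x / (x + D)) ^ x * l ^ x)) := by gcongr
            _ = _ := by rw [Real.rpow_add hl]; ring

/-- Both endpoints may be singular. On each half of `(0, l)` the factor that is regular there is
frozen at `l/2`. Since `D + 1 ≥ x`, the constant depends on `x` alone. -/
lemma lintegral_beta_le_of_neg {x D : ℝ} (hx : 0 < x) (hx1 : x ≤ 1) (hD : D ≤ 0)
    (hxD : x - 1 ≤ D) (l : ℝ) :
    ∫⁻ v, pw (x - 1) v * pw D (l - v) ≤ ENNReal.ofReal (4 / x) * pw (x + D) l := by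
  rcases le_or_gt l 0 with hl | hl
  · rw [pw_of_nonpos hl, mul_zero, nonpos_iff_eq_zero]
    refine lintegral_eq_zero_of_ae_eq_zero (ae_of_all _ fun v => ?_)
    rcases le_or_gt v 0 with hv | hv
    · simp [pw_of_nonpos hv]
    · simp [pw_of_nonpos (show l - v ≤ 0 by linarith)]
  have hD1 : 0 < D + 1 := by linarith
  -- The value `∞` on the null set `{l/2}` avoids treating the midpoint.
  have key : ∀ v, pw (x - 1) v * pw D (l - v) ≤
      (Iio (l / 2)).indicator (fun v => ENNReal.ofReal ((l / 2) ^ D) * pw (x - 1) v) v +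
      (Iio (l / 2)).indicator (fun v => ENNReal.ofReal ((l / 2) ^ (x - 1)) * pw D v) (l - v) +
      ({l / 2} : Set ℝ).indicator (fun v => ∞) v := by
    intro v
    rcases lt_trichotomy v (l / 2) with hv | hv | hv
    · refine le_add_of_le_of_nonneg (le_add_of_le_of_nonneg ?_ zero_le) zero_le
      rw [indicator_of_mem (by exact hv), pw_of_pos (by linarith : 0 < l - v), mul_comm]
      gcongr ENNReal.ofReal ?_ * _
      exact Real.rpow_le_rpow_of_nonpos (by positivity) (by linarith) hD
    · simp [hv]
    · refine le_add_of_le_of_nonneg (le_add_of_nonneg_of_le zero_le ?_) zero_le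
      rw [indicator_of_mem (by simp; linarith), pw_of_pos (by linarith : 0 < v)]
      gcongr ENNReal.ofReal ?_ * _
      exact Real.rpow_le_rpow_of_nonpos (by positivity) hv.le (by linarith)
  refine (lintegral_mono key).trans ?_
  rw [lintegral_add_right _ (by fun_prop (disch := measurability)), lintegral_add_left
    ((((measurable_pw _).const_mul _).indicator measurableSet_Iio))]
  rw [lintegral_indicator measurableSet_Iio, lintegral_const_mul _ (measurable_pw _),
    setLIntegral_Iio_pw hx (by positivity), lintegral_sub_left_eq_self
      (fun v => (Iio (l / 2)).indicator (fun v => ENNReal.ofReal ((l / 2) ^ (x - 1)) * pw D v) v),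
    lintegral_indicator measurableSet_Iio, lintegral_const_mul _ (measurable_pw _)]
  have := setLIntegral_Iio_pw (x := D + 1) hD1 (b := l / 2) (by positivity)
  rw [add_sub_cancel_right] at this
  rw [this, lintegral_indicator (measurableSet_singleton _), lintegral_const, pw_of_pos hl]
  simp only [Measure.restrict_apply MeasurableSet.univ, univ_inter, Real.volume_singleton,
    mul_zero, add_zero]
  rw [← ENNReal.ofReal_mul (by positivity), ← ENNReal.ofReal_mul (by positivity),
    ← ENNReal.ofReal_mul (by positivity), ← ENNReal.ofReal_add (by positivity) (by positivity)]
  refine ENNReal.ofReal_le_ofReal ?_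
  have hl2 : 0 < l / 2 := by positivity
  have e1 : (l / 2) ^ D * ((l / 2) ^ x / x) = (l / 2) ^ (x + D) / x := by
    rw [Real.rpow_add hl2]; ring
  have e2 : (l / 2) ^ (x - 1) * ((l / 2) ^ (D + 1) / (D + 1)) ≤ (l / 2) ^ (x + D) / x := by
    rw [← mul_div_assoc, ← Real.rpow_add hl2, show x - 1 + (D + 1) = x + D by ring]
    gcongr; linarith
  have e3 : (l / 2) ^ (x + D) ≤ 2 * l ^ (x + D) := by
    rw [Real.div_rpow hl.le (by norm_num), div_le_iff₀ (by positivity)]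
    have : (1 : ℝ) ≤ 2 * 2 ^ (x + D) := by
      rw [mul_comm, ← Real.rpow_add_one (by norm_num)]
      exact Real.one_le_rpow (by norm_num) (by linarith)
    have h4 : 0 < l ^ (x + D) := by positivity
    nlinarith
  calc _ ≤ (l / 2) ^ (x + D) / x + (l / 2) ^ (x + D) / x := by rw [e1]; gcongr
    _ ≤ 2 * l ^ (x + D) / x + 2 * l ^ (x + D) / x := by gcongr
    _ = _ := by ring

/-! ### Peeling coordinates off a product -/

section Fin

variable {X : Type*} [MeasureSpace X] [SigmaFinite (volume : Measure X)] {n : ℕ}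

/-- Splitting off the first coordinate. -/
def consEquiv (X : Type*) [MeasurableSpace X] (n : ℕ) :
    X × (Fin n → X) ≃ᵐ (Fin (n + 1) → X) :=
  (MeasurableEquiv.piFinSuccAbove (fun _ => X) 0).symm

lemma consEquiv_apply {X : Type*} [MeasurableSpace X] (p : X × (Fin n → X)) :
    consEquiv X n p = Fin.cons p.1 p.2 := by
  simp [consEquiv, MeasurableEquiv.piFinSuccAbove_symm_apply, Fin.insertNthEquiv]

lemma measurePreserving_consEquiv : MeasurePreserving (consEquiv X n) volume volume :=
  (volume_preserving_piFinSuccAbove (fun _ : Fin (n + 1) => X) 0).symm _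

lemma lintegral_cons {G : (Fin (n + 1) → X) → ℝ≥0∞} (hG : Measurable G) :
    ∫⁻ s, G s = ∫⁻ x, ∫⁻ y : Fin n → X, G (Fin.cons x y) := by
  rw [← (measurePreserving_consEquiv (X := X) (n := n)).lintegral_comp hG,
    Measure.volume_eq_prod, lintegral_prod _ (by fun_prop)]
  simp only [consEquiv_apply]

/-- Splitting off the last coordinate. -/
def snocEquiv (X : Type*) [MeasurableSpace X] (n : ℕ) :
    (Fin n → X) × X ≃ᵐ (Fin (n + 1) → X) :=
  MeasurableEquiv.prodComm.trans
    (MeasurableEquiv.piFinSuccAbove (fun _ => X) (Fin.last n)).symm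

lemma snocEquiv_apply {X : Type*} [MeasurableSpace X] (p : (Fin n → X) × X) :
    snocEquiv X n p = Fin.snoc (α := fun _ => X) p.1 p.2 := by
  simp only [snocEquiv, MeasurableEquiv.trans_apply, MeasurableEquiv.piFinSuccAbove_symm_apply,
    Fin.insertNthEquiv]
  exact Fin.insertNth_last' _ _

lemma measurePreserving_snocEquiv : MeasurePreserving (snocEquiv X n) volume volume :=
  ((volume_preserving_piFinSuccAbove (fun _ : Fin (n + 1) => X) (Fin.last n)).symm _).comp
    Measure.measurePreserving_swap

lemma measurable_snoc {X : Type*} [MeasurableSpace X] : Measurable fun p : (Fin n → X) × X =>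
    (Fin.snoc (α := fun _ => X) p.1 p.2 : Fin (n + 1) → X) := by
  have := (snocEquiv X n).measurable
  simpa only [funext snocEquiv_apply] using this

@[fun_prop]
lemma measurable_withStart {Ω Y : Type*} [MeasurableSpace Ω] [MeasurableSpace Y]
    {a : Ω → Y} {s : Ω → Fin n → Y}
    (ha : Measurable a) (hs : Measurable s) (i : Fin (n + 1)) :
    Measurable fun ω => withStart (a ω) (s ω) i := by
  unfold withStart
  refine Fin.cases ?_ (fun j => ?_) i
  · simpa using ha
  · simpa using (measurable_pi_iff.1 hs j)

end Fin

/-! ### Time integrals over the simplex -/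

/-- One integration of a time variable: Hölder's inequality with exponent `q`, then a beta integral
for powers multiplied by `1/(1 - 1/q)`. The shift by 2 keeps the base positive down to `A = -κ`, an
exponent that occurs at the end of the inner chain of the main term. -/
lemma lintegral_step_le {q : ℝ≥0∞} (hq : 1 < q) {κ δ : ℝ} (hδ : 0 < δ) (hδ2 : δ ≤ 2)
    (hκ : 0 ≤ κ) (hκδ : κ + δ = 1 - (q⁻¹).toReal) :
    ∃ C : ℝ, 0 < C ∧ ∀ F : ℝ → ℝ≥0∞, Measurable F → ∀ A, -κ ≤ A → ∀ a b,
      ∫⁻ s, F s * (pw (-κ) (s - a) * pw A (b - s)) ≤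
        ENNReal.ofReal (C * (A + 2) ^ (-δ)) * pw (A + δ) (b - a) * eLpNorm F q volume := by
  set ι := 1 - (q⁻¹).toReal with hι
  have hι0 : 0 < ι := by linarith
  have hι1 : ι ≤ 1 := by linarith [ENNReal.toReal_nonneg (a := q⁻¹)]
  set x := δ / ι with hx
  have hx0 : 0 < x := by positivity
  have hx1 : x ≤ 1 := by rw [hx, div_le_one hι0]; linarith
  -- The two summands serve `A ≥ 0` and `A < 0`; the factor `2^δ` compensates for replacing
  -- `δ/(δ+A)` by `2/(A+2)`, which uses `δ ≤ 2`.
  refine ⟨((3 / x * 2 ^ x) ^ ι + (4 / x) ^ ι) * 2 ^ δ, by positivity, ?_⟩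
  intro F hF A hA a b
  have hA2 : 0 < A + 2 := by linarith
  have hxκ : x - 1 = -κ * ι⁻¹ := by rw [hx]; field_simp; linarith
  have hxι : x * ι = δ := by rw [hx]; field_simp
  have hxA : (x + A * ι⁻¹) * ι = A + δ := by rw [add_mul, hxι]; field_simp; ring
  refine (lintegral_mul_le hF (by fun_prop) hq).trans ?_
  rw [← hι, mul_comm (eLpNorm F q volume)]
  gcongr
  have hpow : ∀ s, (pw (-κ) (s - a) * pw A (b - s)) ^ ι⁻¹ =
      pw (x - 1) (s - a) * pw (A * ι⁻¹) (b - s) := fun s => by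
    rw [ENNReal.mul_rpow_of_nonneg _ _ (inv_nonneg.2 hι0.le), pw_rpow (inv_pos.2 hι0),
      pw_rpow (inv_pos.2 hι0), ← hxκ]
  rw [lintegral_congr hpow]
  have htr : ∫⁻ s, pw (x - 1) (s - a) * pw (A * ι⁻¹) (b - s) =
      ∫⁻ v, pw (x - 1) v * pw (A * ι⁻¹) (b - a - v) := by
    rw [← lintegral_sub_right_eq_self (fun v => pw (x - 1) v * pw (A * ι⁻¹) (b - a - v)) a]
    simp only [sub_sub_sub_cancel_right]
  rw [htr]
  suffices h : ∃ K : ℝ, 0 ≤ K ∧ K ^ ι ≤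
      ((3 / x * 2 ^ x) ^ ι + (4 / x) ^ ι) * 2 ^ δ * (A + 2) ^ (-δ) ∧
      ∫⁻ v, pw (x - 1) v * pw (A * ι⁻¹) (b - a - v) ≤
        ENNReal.ofReal K * pw (x + A * ι⁻¹) (b - a) by
    obtain ⟨K, hK0, hK1, hK2⟩ := h
    calc _ ≤ (ENNReal.ofReal K * pw (x + A * ι⁻¹) (b - a)) ^ ι := by gcongr
      _ = ENNReal.ofReal (K ^ ι) * pw (A + δ) (b - a) := by
        rw [ENNReal.mul_rpow_of_nonneg _ _ hι0.le, pw_rpow hι0, hxA,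
          ENNReal.ofReal_rpow_of_nonneg hK0 hι0.le]
      _ ≤ _ := by gcongr
  rcases le_or_gt 0 A with hA0 | hA0
  · refine ⟨_, by positivity, ?_, lintegral_beta_le hx0 (by positivity) _⟩
    have e1 : x / (x + A * ι⁻¹) = δ / (δ + A) := by rw [hx]; field_simp
    rw [Real.mul_rpow (by positivity) (by positivity), ← Real.rpow_mul (by positivity), hxι, e1]
    have e2 : (δ / (δ + A)) ^ δ ≤ 2 ^ δ * (A + 2) ^ (-δ) := by
      rw [Real.rpow_neg hA2.le, ← div_eq_mul_inv, ← Real.div_rpow (by norm_num) hA2.le]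
      refine Real.rpow_le_rpow (by positivity) ?_ hδ.le
      rw [div_le_div_iff₀ (by positivity) hA2]; nlinarith
    calc _ ≤ (3 / x * 2 ^ x) ^ ι * (2 ^ δ * (A + 2) ^ (-δ)) := by gcongr
      _ ≤ ((3 / x * 2 ^ x) ^ ι + (4 / x) ^ ι) * (2 ^ δ * (A + 2) ^ (-δ)) := by
        gcongr; exact le_add_of_nonneg_right (by positivity)
      _ = _ := by ring
  · refine ⟨_, by positivity, ?_, lintegral_beta_le_of_neg hx0 hx1 ?_ ?_ _⟩
    · have e2 : 1 ≤ 2 ^ δ * (A + 2) ^ (-δ) := by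
        rw [Real.rpow_neg hA2.le, ← div_eq_mul_inv, ← Real.div_rpow (by norm_num) hA2.le]
        refine Real.one_le_rpow ?_ hδ.le
        rw [le_div_iff₀ hA2]; linarith
      calc _ ≤ (4 / x) ^ ι * (2 ^ δ * (A + 2) ^ (-δ)) :=
            le_mul_of_one_le_right (by positivity) e2
        _ ≤ ((3 / x * 2 ^ x) ^ ι + (4 / x) ^ ι) * (2 ^ δ * (A + 2) ^ (-δ)) := by
          gcongr; exact le_add_of_nonneg_left (by positivity)
        _ = _ := by ring
    · exact mul_nonpos_of_nonpos_of_nonneg hA0.le (by positivity)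
    · rw [hxκ]; gcongr

/-- The density `∏ᵢ Fᵢ(sᵢ) (sᵢ - sᵢ₋₁)^(-κ)` on the time simplex. -/
def timeChain {n : ℕ} (κ : ℝ) (F : Fin n → ℝ → ℝ≥0∞) (a : ℝ) (s : Fin n → ℝ) : ℝ≥0∞ :=
  ∏ i, F i (s i) * pw (-κ) (s i - withStart a s i.castSucc)

@[fun_prop]
lemma measurable_timeChain {Ω : Type*} [MeasurableSpace Ω] {n : ℕ} {κ : ℝ}
    {F : Fin n → ℝ → ℝ≥0∞} (hF : ∀ i, Measurable (F i)) {a : Ω → ℝ} {s : Ω → Fin n → ℝ}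
    (ha : Measurable a) (hs : Measurable s) :
    Measurable fun ω => timeChain κ F (a ω) (s ω) := by
  unfold timeChain
  refine Finset.measurable_prod _ fun i _ => ?_
  have := (hF i).comp (measurable_pi_iff.1 hs i)
  have h2 := measurable_pi_iff.1 hs i
  refine this.mul (Measurable.pw _ (h2.sub (measurable_withStart ha hs _)))

lemma timeChain_cons {n : ℕ} (κ : ℝ) (F : Fin (n + 1) → ℝ → ℝ≥0∞) (a x : ℝ) (s : Fin n → ℝ) :
    timeChain κ F a (Fin.cons x s : Fin (n + 1) → ℝ) =
      F 0 x * pw (-κ) (x - a) * timeChain κ (fun i => F i.succ) x s := by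
  simp [timeChain, Fin.prod_univ_succ, withStart]

/-- The truncation in `pw` confines the integral to ordered times. With the earliest time `x` held
fixed, the later times form a chain started at `x`, whose integral is a power of `b - x`; the
one-step bound then integrates `x`. This is why the starting time is generalized in the induction.
-/
lemma lintegral_timeChain_le {q : ℝ≥0∞} {κ δ C : ℝ} (hδ : 0 < δ) (hκ1 : κ ≤ 1) (hC : 0 < C)
    (step : ∀ F : ℝ → ℝ≥0∞, Measurable F → ∀ A, -κ ≤ A → ∀ a b,
      ∫⁻ s, F s * (pw (-κ) (s - a) * pw A (b - s)) ≤
        ENNReal.ofReal (C * (A + 2) ^ (-δ)) * pw (A + δ) (b - a) * eLpNorm F q volume)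
    (n : ℕ) (F : Fin n → ℝ → ℝ≥0∞) (hF : ∀ i, Measurable (F i)) {A : ℝ} (hA : -κ ≤ A) (a b : ℝ) :
    ∫⁻ s, timeChain κ F a s * pw A (b - withStart a s (Fin.last n)) ≤
      ENNReal.ofReal (∏ j ∈ Finset.range n, C * (A + j * δ + 2) ^ (-δ)) *
        pw (A + n * δ) (b - a) * ∏ i, eLpNorm (F i) q volume := by
  induction n generalizing a with
  | zero =>
    rw [volume_pi, Measure.pi_of_empty]
    simp [timeChain, withStart]
  | succ n ih =>
    have hA2 : ∀ j : ℕ, 0 ≤ A + j * δ + 2 := fun j => by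
      have : 0 ≤ j * δ := by positivity
      linarith
    rw [lintegral_cons (by fun_prop (disch := assumption))]
    calc _ = ∫⁻ x, F 0 x * pw (-κ) (x - a) * ∫⁻ s, timeChain κ (fun i => F i.succ) x s *
            pw A (b - withStart x s (Fin.last n)) := by
          refine lintegral_congr fun x => ?_
          rw [← lintegral_const_mul _ (by
            have := fun i : Fin n => hF i.succ
            fun_prop (disch := assumption))]
          refine lintegral_congr fun s => ?_
          rw [timeChain_cons, mul_assoc]
          rfl
      _ ≤ ∫⁻ x, F 0 x * pw (-κ) (x - a) * (ENNReal.ofReal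
            (∏ j ∈ Finset.range n, C * (A + j * δ + 2) ^ (-δ)) *
            pw (A + n * δ) (b - x) * ∏ i : Fin n, eLpNorm (F i.succ) q volume) := by
          gcongr with x
          exact ih _ (fun i => hF i.succ) x
      _ = (ENNReal.ofReal (∏ j ∈ Finset.range n, C * (A + j * δ + 2) ^ (-δ)) *
            ∏ i : Fin n, eLpNorm (F i.succ) q volume) *
            ∫⁻ x, F 0 x * (pw (-κ) (x - a) * pw (A + n * δ) (b - x)) := by
          rw [← lintegral_const_mul _ (by have := hF 0; fun_prop)]
          refine lintegral_congr fun x => ?_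
          ring
      _ ≤ (ENNReal.ofReal (∏ j ∈ Finset.range n, C * (A + j * δ + 2) ^ (-δ)) *
            ∏ i : Fin n, eLpNorm (F i.succ) q volume) *
            (ENNReal.ofReal (C * (A + n * δ + 2) ^ (-δ)) * pw (A + n * δ + δ) (b - a) *
              eLpNorm (F 0) q volume) := by
          gcongr
          refine step _ (hF 0) _ ?_ a b
          have : 0 ≤ n * δ := by positivity
          linarith
      _ = _ := by
          rw [Finset.prod_range_succ, ENNReal.ofReal_mul (Finset.prod_nonneg fun j _ =>
            mul_nonneg hC.le (Real.rpow_nonneg (hA2 j) _)), Fin.prod_univ_succ]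
          push_cast
          rw [show A + (n + 1) * δ = A + n * δ + δ by ring]
          ring

/-! ### Gaussian bounds in space -/

lemma lintegral_exp_neg_mul_sq {d : ℕ} {c : ℝ} (hc : 0 < c) (m : Space d) :
    ∫⁻ y : Space d, ENNReal.ofReal (Real.exp (-(c * ‖y - m‖ ^ 2))) =
      ENNReal.ofReal ((Real.pi / c) ^ ((d : ℝ) / 2)) := by
  rw [lintegral_sub_right_eq_self (fun y : Space d => ENNReal.ofReal (Real.exp (-(c * ‖y‖ ^ 2)))) m]
  have h := GaussianFourier.integral_rexp_neg_mul_sq_norm (V := Space d) hc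
  simp only [neg_mul, finrank_euclideanSpace, Fintype.card_fin] at h
  rw [← h, ofReal_integral_eq_lintegral_ofReal]
  · by_contra hni
    rw [integral_undef hni] at h
    have : 0 < (Real.pi / c) ^ ((d : ℝ) / 2) := by positivity
    linarith
  · exact ae_of_all _ fun v => (Real.exp_pos _).le

/-- The constant in `lintegral_rpow_mul_exp_le`. -/
def gaussConst (d : ℕ) (μ : ℝ) : ℝ := (Real.pi * μ) ^ ((d : ℝ) / 2 * μ)

/-- Hölder's inequality with exponent `r/θ`. The case `θ = 1` integrates the points of a chain; `θ =
2` gives the weighted `L²` norms and is the reason for `r ≥ 2`. -/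
lemma lintegral_rpow_mul_exp_le {d : ℕ} {r : ℝ≥0∞} {θ : ℝ} (hθ : 0 < θ) (hr0 : r ≠ 0)
    (hr : θ * (r⁻¹).toReal ≤ 1) {φ : Space d → ℝ≥0∞} (hφ : Measurable φ) {c : ℝ} (hc : 0 < c)
    (m : Space d) :
    ∫⁻ y, φ y ^ θ * ENNReal.ofReal (Real.exp (-(c * ‖y - m‖ ^ 2))) ≤
      eLpNorm φ r volume ^ θ * ENNReal.ofReal (gaussConst d (1 - θ * (r⁻¹).toReal) *
        c ^ (-((d : ℝ) / 2 * (1 - θ * (r⁻¹).toReal)))) := by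
  rcases hr.lt_or_eq with hr | hr
  · refine (lintegral_rpow_mul_le hφ (by fun_prop) hθ hr hr0).trans ?_
    gcongr
    set μ := 1 - θ * (r⁻¹).toReal
    have hμ : 0 < μ := by simp only [μ]; linarith
    have : ∀ y : Space d, ENNReal.ofReal (Real.exp (-(c * ‖y - m‖ ^ 2))) ^ μ⁻¹ =
        ENNReal.ofReal (Real.exp (-(c * μ⁻¹ * ‖y - m‖ ^ 2))) := fun y => by
      rw [ENNReal.ofReal_rpow_of_pos (Real.exp_pos _), ← Real.exp_mul]
      ring_nf
    rw [lintegral_congr this, lintegral_exp_neg_mul_sq (by positivity),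
      ENNReal.ofReal_rpow_of_pos (by positivity), gaussConst, ← Real.rpow_mul (by positivity),
      Real.rpow_neg hc.le, ← Real.inv_rpow hc.le, ← Real.mul_rpow (by positivity) (by positivity)]
    refine le_of_eq ?_
    congr 2
    field_simp
  -- Borderline case `r = θ`: the dual exponent is infinite and the Gaussian is bounded by 1, in
  -- agreement with `gaussConst d 0 = 0^0 = 1`.
  · have hrt : r ≠ ∞ := by rintro rfl; simp at hr
    have hrθ : r.toReal = θ := by
      rw [ENNReal.toReal_inv] at hr
      have : r.toReal ≠ 0 := (ENNReal.toReal_pos hr0 hrt).ne'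
      field_simp at hr
      exact hr.symm
    rw [hr, sub_self, gaussConst]
    simp only [mul_zero, Real.rpow_zero, neg_zero, mul_one, ENNReal.ofReal_one]
    rw [eLpNorm_eq_lintegral_rpow_enorm_toReal hr0 hrt, hrθ, ← ENNReal.rpow_mul, one_div,
      inv_mul_cancel₀ hθ.ne', ENNReal.rpow_one]
    refine lintegral_mono fun y => ?_
    simp only [enorm_eq_self]
    refine mul_le_of_le_one_right' ?_
    rw [ENNReal.ofReal_le_one, Real.exp_le_one_iff, neg_nonpos]
    positivity

/-- A Gaussian bump `σ^(-d/2) exp (-‖x‖²/(8σ))`, equal to zero if `σ ≤ 0`. -/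
def gauss {d : ℕ} (σ : ℝ) (x : Space d) : ℝ≥0∞ :=
  if 0 < σ then ENNReal.ofReal (σ ^ (-((d : ℝ) / 2)) * Real.exp (-(‖x‖ ^ 2 / (8 * σ)))) else 0

lemma gauss_of_pos {d : ℕ} {σ : ℝ} (hσ : 0 < σ) (x : Space d) :
    gauss σ x = ENNReal.ofReal (σ ^ (-((d : ℝ) / 2)) * Real.exp (-(‖x‖ ^ 2 / (8 * σ)))) :=
  if_pos hσ

lemma gauss_of_nonpos {d : ℕ} {σ : ℝ} (hσ : σ ≤ 0) (x : Space d) : gauss σ x = 0 :=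
  if_neg (not_lt.2 hσ)

@[fun_prop]
lemma measurable_gauss {d : ℕ} {Ω : Type*} [MeasurableSpace Ω] {σ : Ω → ℝ} {x : Ω → Space d}
    (hσ : Measurable σ) (hx : Measurable x) : Measurable fun ω => gauss (σ ω) (x ω) := by
  unfold gauss
  refine Measurable.ite (measurableSet_lt measurable_const hσ) ?_ measurable_const
  fun_prop

/-- Hölder's inequality against a Gaussian bump. -/
lemma lintegral_mul_gauss_le {d : ℕ} {r : ℝ≥0∞} (hr : 1 ≤ r) {φ : Space d → ℝ≥0∞}
    (hφ : Measurable φ) (σ : ℝ) (m : Space d) :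
    ∫⁻ y, φ y * gauss σ (y - m) ≤
      ENNReal.ofReal (gaussConst d (1 - (r⁻¹).toReal) *
          8 ^ ((d : ℝ) / 2 * (1 - (r⁻¹).toReal))) *
        pw (-((d : ℝ) / 2 * (r⁻¹).toReal)) σ * eLpNorm φ r volume := by
  rcases le_or_gt σ 0 with hσ | hσ
  · simp [gauss_of_nonpos hσ]
  have hr0 : r ≠ 0 := (zero_lt_one.trans_le hr).ne'
  have h1 : 1 * (r⁻¹).toReal ≤ 1 := by
    rw [one_mul]
    exact ENNReal.toReal_le_of_le_ofReal zero_le_one (by simpa using hr)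
  have hc : 0 < 1 / (8 * σ) := by positivity
  calc _ = ENNReal.ofReal (σ ^ (-((d : ℝ) / 2))) *
        ∫⁻ y, φ y ^ (1 : ℝ) * ENNReal.ofReal (Real.exp (-(1 / (8 * σ) * ‖y - m‖ ^ 2))) := by
        rw [← lintegral_const_mul _ (by fun_prop)]
        refine lintegral_congr fun y => ?_
        rw [gauss_of_pos hσ, ENNReal.ofReal_mul (by positivity), ENNReal.rpow_one,
          mul_left_comm]
        congr 5; ring
    _ ≤ ENNReal.ofReal (σ ^ (-((d : ℝ) / 2))) * (eLpNorm φ r volume ^ (1 : ℝ) *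
        ENNReal.ofReal (gaussConst d (1 - 1 * (r⁻¹).toReal) *
          (1 / (8 * σ)) ^ (-((d : ℝ) / 2 * (1 - 1 * (r⁻¹).toReal))))) := by
        gcongr
        exact lintegral_rpow_mul_exp_le one_pos hr0 h1 hφ hc m
    _ = _ := by
        rw [one_mul, ENNReal.rpow_one, pw_of_pos hσ]
        rw [mul_comm (eLpNorm φ r volume), ← mul_assoc, ← ENNReal.ofReal_mul (by positivity),
          ← ENNReal.ofReal_mul' (by positivity)]
        congr 2
        set ρ := (r⁻¹).toReal
        rw [one_div, Real.inv_rpow (by positivity), ← Real.rpow_neg (by positivity), neg_neg,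
          Real.mul_rpow (by norm_num) hσ.le]
        have : σ ^ (-((d : ℝ) / 2 * ρ)) =
            σ ^ (-((d : ℝ) / 2)) * σ ^ ((d : ℝ) / 2 * (1 - ρ)) := by
          rw [← Real.rpow_add hσ]; ring_nf
        rw [this]; ring

/-- Completing the square in `y`. The centre is the mean of the Brownian bridge from `x` to `z`. -/
lemma norm_sq_div_add_norm_sq_div {d : ℕ} {s t : ℝ} (hs : 0 < s) (ht : 0 < t) (x y z : Space d) :
    ‖y - x‖ ^ 2 / s + ‖z - y‖ ^ 2 / t = ‖z - x‖ ^ 2 / (s + t) +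
      (s + t) / (s * t) * ‖y - ((t / (s + t)) • x + (s / (s + t)) • z)‖ ^ 2 := by
  set m := (t / (s + t)) • x + (s / (s + t)) • z with hm
  have h1 : y - x = (y - m) + (s / (s + t)) • (z - x) := by
    have : (1 : ℝ) = t / (s + t) + s / (s + t) := by field_simp; ring
    rw [hm, smul_sub]
    nth_rewrite 1 [← one_smul ℝ x]
    rw [this, add_smul]; abel
  have h2 : z - y = (t / (s + t)) • (z - x) - (y - m) := by
    have : (1 : ℝ) = t / (s + t) + s / (s + t) := by field_simp; ring
    rw [hm, smul_sub]
    nth_rewrite 1 [← one_smul ℝ z]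
    rw [this, add_smul]; abel
  rw [h1, h2]
  generalize y - m = w
  rw [norm_add_sq_real, norm_sub_sq_real, norm_smul, norm_smul, inner_smul_left,
    inner_smul_right, real_inner_comm w (z - x), Real.norm_of_nonneg (by positivity),
    Real.norm_of_nonneg (by positivity)]
  simp only [conj_trivial]
  field_simp
  ring

lemma gauss_mul_gauss {d : ℕ} {s t : ℝ} (hs : 0 < s) (ht : 0 < t) (x y z : Space d) :
    gauss s (y - x) * gauss t (z - y) =
      ENNReal.ofReal ((s * t / (s + t)) ^ (-((d : ℝ) / 2))) * gauss (s + t) (z - x) *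
        ENNReal.ofReal (Real.exp (-((s + t) / (8 * (s * t)) *
          ‖y - ((t / (s + t)) • x + (s / (s + t)) • z)‖ ^ 2))) := by
  have hst : 0 < s + t := by positivity
  rw [gauss_of_pos hs, gauss_of_pos ht, gauss_of_pos hst, ← ENNReal.ofReal_mul (by positivity),
    ← ENNReal.ofReal_mul (by positivity), ← ENNReal.ofReal_mul (by positivity)]
  congr 1
  have h := norm_sq_div_add_norm_sq_div hs ht x y z
  have e1 : Real.exp (-(‖y - x‖ ^ 2 / (8 * s))) * Real.exp (-(‖z - y‖ ^ 2 / (8 * t))) =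
      Real.exp (-(‖z - x‖ ^ 2 / (8 * (s + t)))) * Real.exp (-((s + t) / (8 * (s * t)) *
          ‖y - ((t / (s + t)) • x + (s / (s + t)) • z)‖ ^ 2)) := by
    rw [← Real.exp_add, ← Real.exp_add]
    congr 1
    rw [show ∀ a b : ℝ, a / (8 * b) = a / b / 8 from fun a b => by rw [mul_comm, div_div],
      show ∀ a b : ℝ, a / (8 * b) = a / b / 8 from fun a b => by rw [mul_comm, div_div],
      show ∀ a b : ℝ, a / (8 * b) = a / b / 8 from fun a b => by rw [mul_comm, div_div],
      show ∀ a b : ℝ, a / (8 * b) = a / b / 8 from fun a b => by rw [mul_comm, div_div]]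
    linarith
  have e2 : s ^ (-((d : ℝ) / 2)) * t ^ (-((d : ℝ) / 2)) =
      (s * t / (s + t)) ^ (-((d : ℝ) / 2)) * (s + t) ^ (-((d : ℝ) / 2)) := by
    rw [← Real.mul_rpow hs.le ht.le, ← Real.mul_rpow (by positivity) hst.le]
    congr 1; field_simp
  calc _ = (s ^ (-((d : ℝ) / 2)) * t ^ (-((d : ℝ) / 2))) *
        (Real.exp (-(‖y - x‖ ^ 2 / (8 * s))) * Real.exp (-(‖z - y‖ ^ 2 / (8 * t)))) := by ring
    _ = _ := by rw [e1, e2]; ring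

/-- The constant in `lintegral_bridge_le`. -/
def bridgeConst (d : ℕ) (r : ℝ≥0∞) : ℝ :=
  gaussConst d (1 - (r⁻¹).toReal) * 8 ^ ((d : ℝ) / 2 * (1 - (r⁻¹).toReal))

lemma inv_toReal_le_one {r : ℝ≥0∞} (hr : 1 ≤ r) : (r⁻¹).toReal ≤ 1 :=
  ENNReal.toReal_le_of_le_ofReal zero_le_one (by simpa using hr)

lemma bridgeConst_nonneg {d : ℕ} {r : ℝ≥0∞} (hr : 1 ≤ r) : 0 ≤ bridgeConst d r := by
  unfold bridgeConst gaussConst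
  have : 0 ≤ 1 - (r⁻¹).toReal := by linarith [inv_toReal_le_one hr]
  positivity

/-- After completing the square, `y` sees a Gaussian of variance proportional to `st/(s+t)`, and
Hölder's inequality leaves `(st/(s+t))^(-d/(2r))`. Keeping the numerator `(s+t)^(d/(2r))`, instead
of estimating it, lets the bound be iterated without loss. -/
lemma lintegral_bridge_le {d : ℕ} {r : ℝ≥0∞} (hr : 1 ≤ r) {φ : Space d → ℝ≥0∞}
    (hφ : Measurable φ) (s t : ℝ) (x z : Space d) :
    ∫⁻ y, φ y * (gauss s (y - x) * gauss t (z - y)) ≤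
      ENNReal.ofReal (bridgeConst d r) * eLpNorm φ r volume *
        (pw (-((d : ℝ) / 2 * (r⁻¹).toReal)) s * pw (-((d : ℝ) / 2 * (r⁻¹).toReal)) t *
          pw ((d : ℝ) / 2 * (r⁻¹).toReal) (s + t)) * gauss (s + t) (z - x) := by
  rcases le_or_gt s 0 with hs | hs
  · simp [gauss_of_nonpos hs]
  rcases le_or_gt t 0 with ht | ht
  · simp [gauss_of_nonpos ht]
  have hst : 0 < s + t := by positivity
  have hr0 : r ≠ 0 := (zero_lt_one.trans_le hr).ne'
  set m := (t / (s + t)) • x + (s / (s + t)) • z with hm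
  have hc : 0 < (s + t) / (8 * (s * t)) := by positivity
  calc _ = ENNReal.ofReal ((s * t / (s + t)) ^ (-((d : ℝ) / 2))) * gauss (s + t) (z - x) *
        ∫⁻ y, φ y ^ (1 : ℝ) *
          ENNReal.ofReal (Real.exp (-((s + t) / (8 * (s * t)) * ‖y - m‖ ^ 2))) := by
        rw [← lintegral_const_mul _ (by fun_prop)]
        refine lintegral_congr fun y => ?_
        rw [gauss_mul_gauss hs ht, ENNReal.rpow_one, mul_left_comm]
    _ ≤ ENNReal.ofReal ((s * t / (s + t)) ^ (-((d : ℝ) / 2))) * gauss (s + t) (z - x) *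
        (eLpNorm φ r volume ^ (1 : ℝ) * ENNReal.ofReal (gaussConst d (1 - 1 * (r⁻¹).toReal) *
          ((s + t) / (8 * (s * t))) ^ (-((d : ℝ) / 2 * (1 - 1 * (r⁻¹).toReal))))) := by
        gcongr
        exact lintegral_rpow_mul_exp_le one_pos hr0
          (by simpa using inv_toReal_le_one hr) hφ hc m
    _ = _ := by
        rw [one_mul, ENNReal.rpow_one, pw_of_pos hs, pw_of_pos ht, pw_of_pos hst,
          ← ENNReal.ofReal_mul (by positivity), ← ENNReal.ofReal_mul (by positivity)]
        have hE : (s * t / (s + t)) ^ (-((d : ℝ) / 2)) * (gaussConst d (1 - (r⁻¹).toReal) *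
            ((s + t) / (8 * (s * t))) ^ (-((d : ℝ) / 2 * (1 - (r⁻¹).toReal)))) =
            bridgeConst d r * (s ^ (-((d : ℝ) / 2 * (r⁻¹).toReal)) *
              t ^ (-((d : ℝ) / 2 * (r⁻¹).toReal)) * (s + t) ^ ((d : ℝ) / 2 * (r⁻¹).toReal)) := by
          set ρ := (r⁻¹).toReal
          have hu : 0 < s * t / (s + t) := by positivity
          have e1 : ((s + t) / (8 * (s * t))) ^ (-((d : ℝ) / 2 * (1 - ρ))) =
              8 ^ ((d : ℝ) / 2 * (1 - ρ)) * (s * t / (s + t)) ^ ((d : ℝ) / 2 * (1 - ρ)) := by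
            rw [Real.rpow_neg hc.le, ← Real.inv_rpow hc.le,
              ← Real.mul_rpow (by norm_num) hu.le]
            congr 1; field_simp
          have e2 : (s * t / (s + t)) ^ (-((d : ℝ) / 2 * ρ)) =
              s ^ (-((d : ℝ) / 2 * ρ)) * t ^ (-((d : ℝ) / 2 * ρ)) *
                (s + t) ^ ((d : ℝ) / 2 * ρ) := by
            rw [Real.div_rpow (by positivity) hst.le, Real.mul_rpow hs.le ht.le,
              Real.rpow_neg hst.le, div_inv_eq_mul]
          have e3 : (s * t / (s + t)) ^ (-((d : ℝ) / 2 * ρ)) =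
              (s * t / (s + t)) ^ (-((d : ℝ) / 2)) *
              (s * t / (s + t)) ^ ((d : ℝ) / 2 * (1 - ρ)) := by
            rw [← Real.rpow_add hu]; ring_nf
          rw [e1, ← e2, e3, bridgeConst]; ring
        calc _ = ENNReal.ofReal ((s * t / (s + t)) ^ (-((d : ℝ) / 2))) * ENNReal.ofReal
              (gaussConst d (1 - (r⁻¹).toReal) *
            ((s + t) / (8 * (s * t))) ^ (-((d : ℝ) / 2 * (1 - (r⁻¹).toReal)))) *
              eLpNorm φ r volume * gauss (s + t) (z - x) := by ring
          _ = _ := by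
            rw [← ENNReal.ofReal_mul (by positivity), hE,
              ENNReal.ofReal_mul (bridgeConst_nonneg hr)]
            ring

/-- The product of the Gaussian bumps along a chain of points, weighted by the functions `φᵢ`. -/
def spaceChain {d n : ℕ} (ν : ℝ) (φ : Fin n → Space d → ℝ≥0∞) (a : ℝ) (u : Fin n → ℝ)
    (x : Space d) (y : Fin n → Space d) : ℝ≥0∞ :=
  ∏ i, φ i (y i) * gauss (ν * (u i - withStart a u i.castSucc)) (y i - withStart x y i.castSucc)

lemma measurable_spaceChain {d n : ℕ} (ν : ℝ) {φ : Fin n → Space d → ℝ≥0∞}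
    (hφ : ∀ i, Measurable (φ i)) (a : ℝ) (u : Fin n → ℝ) (x : Space d) :
    Measurable (spaceChain ν φ a u x) := by
  unfold spaceChain
  refine Finset.measurable_prod _ fun i _ => ?_
  have h1 := (hφ i).comp (f := fun y : Fin n → Space d => y i) (measurable_pi_apply i)
  have h2 : Measurable fun y : Fin n → Space d => withStart x y i.castSucc :=
    measurable_withStart measurable_const measurable_id _
  exact h1.mul (measurable_gauss measurable_const ((measurable_pi_apply i).sub h2))

/-- In the induction, the positive power of `τ - u₀` from the later points cancels the negative
power produced by the bridge estimate at the first point. Hence each gap is charged exactly once,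
and a Gaussian in the endpoints survives; the weights used later rely on it. -/
lemma lintegral_spaceChain_le {d : ℕ} {r : ℝ≥0∞} (hr : 1 ≤ r) (ν : ℝ) (n : ℕ)
    (φ : Fin n → Space d → ℝ≥0∞) (hφ : ∀ i, Measurable (φ i)) (a τ : ℝ) (u : Fin n → ℝ)
    (x z : Space d) :
    ∫⁻ y, spaceChain ν φ a u x y *
        gauss (ν * (τ - withStart a u (Fin.last n))) (z - withStart x y (Fin.last n)) ≤
      ENNReal.ofReal (bridgeConst d r) ^ n *
        (∏ i, eLpNorm (φ i) r volume *
          pw (-((d : ℝ) / 2 * (r⁻¹).toReal)) (ν * (u i - withStart a u i.castSucc))) *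
        pw (-((d : ℝ) / 2 * (r⁻¹).toReal)) (ν * (τ - withStart a u (Fin.last n))) *
        (pw ((d : ℝ) / 2 * (r⁻¹).toReal) (ν * (τ - a)) * gauss (ν * (τ - a)) (z - x)) := by
  induction n generalizing a x with
  | zero =>
    rw [volume_pi, Measure.pi_of_empty]
    simp only [spaceChain, Finset.univ_eq_empty, Finset.prod_empty, withStart,
      one_mul, pow_zero, Fin.last_zero, Fin.cons_zero, lintegral_const, measure_univ, mul_one]
    rw [← mul_assoc, pw_mul_pw, neg_add_cancel]
    rcases le_or_gt (ν * (τ - a)) 0 with h | h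
    · simp [gauss_of_nonpos h]
    · simp [pw_of_pos h]
  | succ n ih =>
    set e := (d : ℝ) / 2 * (r⁻¹).toReal with he
    set K := ENNReal.ofReal (bridgeConst d r) with hK
    obtain ⟨⟨u0, u'⟩, rfl⟩ := (consEquiv ℝ n).surjective u
    have hφ' : ∀ i : Fin n, Measurable (φ i.succ) := fun i => hφ i.succ
    have hφ0 := hφ 0
    rw [consEquiv_apply]
    have hlast : ∀ {Y : Type} (b : Y) (v0 : Y) (v : Fin n → Y),
        withStart b (Fin.cons v0 v : Fin (n + 1) → Y) (Fin.last (n + 1)) =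
          withStart v0 v (Fin.last n) := fun b v0 v => rfl
    have hsplit : ∀ (y0 : Space d) (y : Fin n → Space d),
        spaceChain ν φ a (Fin.cons u0 u' : Fin (n + 1) → ℝ) x (Fin.cons y0 y : Fin (n + 1) → _) =
          φ 0 y0 * gauss (ν * (u0 - a)) (y0 - x) *
            spaceChain ν (fun i => φ i.succ) u0 u' y0 y := fun y0 y => by
      simp [spaceChain, Fin.prod_univ_succ, withStart]
    rw [lintegral_cons]
    · set P := ∏ i : Fin n, eLpNorm (φ i.succ) r volume *
          pw (-e) (ν * (u' i - withStart u0 u' i.castSucc)) with hP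
      calc _ = ∫⁻ y0, φ 0 y0 * gauss (ν * (u0 - a)) (y0 - x) *
            ∫⁻ y, spaceChain ν (fun i => φ i.succ) u0 u' y0 y *
              gauss (ν * (τ - withStart u0 u' (Fin.last n))) (z - withStart y0 y (Fin.last n)) := by
            refine lintegral_congr fun y0 => ?_
            rw [← lintegral_const_mul _ (by
              have := measurable_spaceChain ν hφ' u0 u' y0
              fun_prop)]
            refine lintegral_congr fun y => ?_
            rw [hlast, hlast, hsplit, mul_assoc]
        _ ≤ ∫⁻ y0, φ 0 y0 * gauss (ν * (u0 - a)) (y0 - x) * (K ^ n * P *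
              pw (-e) (ν * (τ - withStart u0 u' (Fin.last n))) *
              (pw e (ν * (τ - u0)) * gauss (ν * (τ - u0)) (z - y0))) := by
            gcongr with y0
            exact ih _ hφ' u0 u' y0
        _ = K ^ n * P * pw (-e) (ν * (τ - withStart u0 u' (Fin.last n))) * pw e (ν * (τ - u0)) *
            ∫⁻ y0, φ 0 y0 * (gauss (ν * (u0 - a)) (y0 - x) * gauss (ν * (τ - u0)) (z - y0)) := by
            rw [← lintegral_const_mul _ (by fun_prop)]
            refine lintegral_congr fun y0 => ?_
            ring
        _ ≤ K ^ n * P * pw (-e) (ν * (τ - withStart u0 u' (Fin.last n))) * pw e (ν * (τ - u0)) *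
            (K * eLpNorm (φ 0) r volume *
        (pw (-e) (ν * (u0 - a)) * pw (-e) (ν * (τ - u0)) * pw e (ν * (τ - a))) *
          gauss (ν * (τ - a)) (z - x)) := by
            gcongr
            have := lintegral_bridge_le hr hφ0 (ν * (u0 - a)) (ν * (τ - u0)) x z
            rwa [show ν * (u0 - a) + ν * (τ - u0) = ν * (τ - a) by ring] at this
        _ = K ^ (n + 1) * (eLpNorm (φ 0) r volume * pw (-e) (ν * (u0 - a)) * P) *
              pw (-e) (ν * (τ - withStart u0 u' (Fin.last n))) *
              (pw e (ν * (τ - a)) * gauss (ν * (τ - a)) (z - x)) *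
              (pw e (ν * (τ - u0)) * pw (-e) (ν * (τ - u0))) := by ring
        _ ≤ K ^ (n + 1) * (eLpNorm (φ 0) r volume * pw (-e) (ν * (u0 - a)) * P) *
              pw (-e) (ν * (τ - withStart u0 u' (Fin.last n))) *
              (pw e (ν * (τ - a)) * gauss (ν * (τ - a)) (z - x)) * 1 := by
            gcongr
            rw [pw_mul_pw, add_neg_cancel]
            unfold pw; split_ifs <;> simp
        _ = _ := by
            rw [mul_one, hlast, Fin.prod_univ_succ]
            rfl
    · have h1 := measurable_spaceChain ν hφ a (Fin.cons u0 u' : Fin (n + 1) → ℝ) x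
      have h2 : Measurable fun y : Fin (n + 1) → Space d => withStart x y (Fin.last (n + 1)) :=
        measurable_withStart measurable_const measurable_id _
      exact h1.mul (by fun_prop)

/-! ### The heat kernel and its derivatives -/

/-- The heat kernel `(4πσ)^(-d/2) exp (-‖x‖²/(4σ))`. -/
def heatK {d : ℕ} (σ : ℝ) (x : Space d) : ℝ :=
  (4 * Real.pi * σ) ^ (-(d : ℝ) / 2) * Real.exp (-(‖x‖ ^ 2 / (4 * σ)))

/-- The first derivatives of the heat kernel. -/
def heatK1 {d : ℕ} (i : Fin d) (σ : ℝ) (x : Space d) : ℝ := -(x i / (2 * σ)) * heatK σ x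

/-- The second derivatives of the heat kernel. -/
def heatK2 {d : ℕ} (i j : Fin d) (σ : ℝ) (x : Space d) : ℝ :=
  (x i * x j / (4 * σ ^ 2) - if i = j then 1 / (2 * σ) else 0) * heatK σ x

@[fun_prop]
lemma measurable_heatK {d : ℕ} {Ω : Type*} [MeasurableSpace Ω] {σ : Ω → ℝ} {x : Ω → Space d}
    (hσ : Measurable σ) (hx : Measurable x) : Measurable fun ω => heatK (σ ω) (x ω) := by
  unfold heatK; fun_prop

@[fun_prop]
lemma measurable_heatK1 {d : ℕ} {Ω : Type*} [MeasurableSpace Ω] (i : Fin d) {σ : Ω → ℝ}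
    {x : Ω → Space d} (hσ : Measurable σ) (hx : Measurable x) :
    Measurable fun ω => heatK1 i (σ ω) (x ω) := by
  unfold heatK1; fun_prop

@[fun_prop]
lemma measurable_heatK2 {d : ℕ} {Ω : Type*} [MeasurableSpace Ω] (i j : Fin d) {σ : Ω → ℝ}
    {x : Ω → Space d} (hσ : Measurable σ) (hx : Measurable x) :
    Measurable fun ω => heatK2 i j (σ ω) (x ω) := by
  unfold heatK2
  by_cases h : i = j
  · simp only [h, if_true]; fun_prop
  · simp only [h, if_false]; fun_prop

lemma heatKernel_eq {d : ℕ} {ν s : ℝ} (hν : 0 < ν) (hs : 0 < s) (x : Space d) :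
    heatKernel ν x s = heatK (ν * s) x := by
  have h : 0 < s * ν := by positivity
  unfold heatKernel gaussProfile heatK
  rw [norm_smul, norm_inv, Real.norm_of_nonneg (Real.sqrt_nonneg _), mul_pow, inv_pow,
    Real.sq_sqrt h.le, ← mul_assoc, ← Real.mul_rpow h.le (by positivity)]
  congr 2
  · ring
  · field_simp

lemma hasFDerivAt_heatK {d : ℕ} (σ : ℝ) (x : Space d) :
    HasFDerivAt (heatK (d := d) σ) ((heatK σ x * (-(1 / (2 * σ)))) • innerSL ℝ x) x := by
  have h1 := (hasStrictFDerivAt_norm_sq x).hasFDerivAt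
  have h2 := ((h1.const_mul (1 / (4 * σ))).fun_neg.exp).const_mul
    ((4 * Real.pi * σ) ^ (-(d : ℝ) / 2))
  have e : heatK (d := d) σ = fun y => (4 * Real.pi * σ) ^ (-(d : ℝ) / 2) *
      Real.exp (-(1 / (4 * σ) * ‖y‖ ^ 2)) := by
    funext y; unfold heatK; ring_nf
  rw [e]
  refine h2.congr_fderiv ?_
  ext v
  simp only [smul_apply, smul_eq_mul, neg_apply, two_nsmul, add_apply]
  ring

lemma fderiv_heatK_single {d : ℕ} (σ : ℝ) (x : Space d) (i : Fin d) :
    fderiv ℝ (heatK (d := d) σ) x (EuclideanSpace.single i 1) = heatK1 i σ x := by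
  rw [(hasFDerivAt_heatK σ x).fderiv]
  simp only [smul_apply, innerSL_apply_apply, smul_eq_mul,
    EuclideanSpace.inner_single_right, heatK1]
  simp
  ring

lemma partialDeriv_heatK {d : ℕ} (σ : ℝ) (i : Fin d) (x : Space d) :
    partialDeriv i (heatK σ) x = heatK1 i σ x := by
  rw [partialDeriv, (hasFDerivAt_heatK σ x).differentiableAt.lineDeriv_eq_fderiv,
    fderiv_heatK_single]

lemma partialDeriv_heatK1 {d : ℕ} {σ : ℝ} (hσ : σ ≠ 0) (i j : Fin d) (x : Space d) :
    partialDeriv i (heatK1 j σ) x = heatK2 i j σ x := by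
  have h1 : HasFDerivAt (fun y : Space d => y j) (EuclideanSpace.proj j : Space d →L[ℝ] ℝ) x :=
    (EuclideanSpace.proj j : Space d →L[ℝ] ℝ).hasFDerivAt
  have h2 := ((h1.mul_const (2 * σ)⁻¹).neg).mul (hasFDerivAt_heatK σ x)
  have h3 : HasFDerivAt (heatK1 j σ) _ x := h2
  rw [partialDeriv, h3.differentiableAt.lineDeriv_eq_fderiv, h3.fderiv]
  simp only [add_apply, smul_apply, smul_eq_mul,
    neg_apply, innerSL_apply_apply, EuclideanSpace.inner_single_right,
    PiLp.proj_apply, Pi.neg_apply, heatK2]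
  by_cases h : i = j
  · subst h; simp; field_simp; ring
  · have h' : j ≠ i := fun h' => h h'.symm
    simp [h, h']; field_simp; ring

lemma IsOfType.zero_eq {d : ℕ} {ν : ℝ} (hν : 0 < ν) {h : Space d → ℝ → ℝ} (hh : IsOfType ν 0 h)
    (s : ℝ) (hs : 0 < s) : (fun x => h x s) = heatK (ν * s) := by
  subst hh
  exact funext fun x => heatKernel_eq hν hs x

lemma IsOfType.one_eq {d : ℕ} {ν : ℝ} (hν : 0 < ν) {h : Space d → ℝ → ℝ} (hh : IsOfType ν 1 h) :
    ∃ i, ∀ s, 0 < s → (fun x => h x s) = heatK1 i (ν * s) := by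
  obtain ⟨g, i, hg, rfl⟩ := hh
  refine ⟨i, fun s hs => funext fun x => ?_⟩
  have h0 := hg.zero_eq hν s hs
  simp only [h0, partialDeriv_heatK]

lemma IsOfType.two_eq {d : ℕ} {ν : ℝ} (hν : 0 < ν) {h : Space d → ℝ → ℝ} (hh : IsOfType ν 2 h) :
    ∃ i j, ∀ s, 0 < s → (fun x => h x s) = heatK2 i j (ν * s) := by
  obtain ⟨g, i, hg, rfl⟩ := hh
  obtain ⟨j, hj⟩ := hg.one_eq hν
  refine ⟨i, j, fun s hs => funext fun x => ?_⟩
  have h1 := hj s hs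
  simp only [h1, partialDeriv_heatK1 (mul_pos hν hs).ne']

/-! ### Pointwise bounds -/

lemma heatK_pos {d : ℕ} {σ : ℝ} (hσ : 0 < σ) (x : Space d) : 0 < heatK σ x := by
  unfold heatK; positivity

lemma heatK_le {d : ℕ} {σ : ℝ} (hσ : 0 < σ) (x : Space d) :
    heatK σ x ≤ σ ^ (-((d : ℝ) / 2)) * Real.exp (-((‖x‖ / √σ) ^ 2 / 4)) := by
  unfold heatK
  rw [div_pow, Real.sq_sqrt hσ.le, neg_div, Real.mul_rpow (by positivity) hσ.le,
    show ‖x‖ ^ 2 / (4 * σ) = ‖x‖ ^ 2 / σ / 4 by rw [div_div, mul_comm]]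
  gcongr
  refine mul_le_of_le_one_left (by positivity) ?_
  refine Real.rpow_le_one_of_one_le_of_nonpos ?_ ?_
  · have := Real.pi_gt_three; linarith
  · have : (0 : ℝ) ≤ d := by positivity
    linarith

lemma exp_eq_gauss {d : ℕ} {σ : ℝ} (hσ : 0 < σ) (x : Space d) :
    ENNReal.ofReal (σ ^ (-((d : ℝ) / 2)) * Real.exp (-((‖x‖ / √σ) ^ 2 / 8))) = gauss σ x := by
  rw [gauss_of_pos hσ, div_pow, Real.sq_sqrt hσ.le, div_div, mul_comm σ 8]

/-- In the variable `y = ‖x‖/√σ` the kernel decays like `exp(-y²/4)` and `gauss` only like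
`exp(-y²/8)`. The difference absorbs the polynomial prefactors of the derivatives. -/
lemma enorm_mul_heatK_le {d : ℕ} {σ : ℝ} (hσ : 0 < σ) (x : Space d) {a B : ℝ} (hB : 0 ≤ B)
    (ha : |a| ≤ B * Real.exp ((‖x‖ / √σ) ^ 2 / 8)) :
    ‖a * heatK σ x‖ₑ ≤ ENNReal.ofReal B * gauss σ x := by
  rw [Real.enorm_eq_ofReal_abs, abs_mul, abs_of_pos (heatK_pos hσ x), ← exp_eq_gauss hσ,
    ← ENNReal.ofReal_mul hB]
  refine ENNReal.ofReal_le_ofReal ?_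
  calc _ ≤ B * Real.exp ((‖x‖ / √σ) ^ 2 / 8) *
        (σ ^ (-((d : ℝ) / 2)) * Real.exp (-((‖x‖ / √σ) ^ 2 / 4))) :=
        mul_le_mul ha (heatK_le hσ x) (heatK_pos hσ x).le (by positivity)
    _ = B * (σ ^ (-((d : ℝ) / 2)) *
        (Real.exp ((‖x‖ / √σ) ^ 2 / 8) * Real.exp (-((‖x‖ / √σ) ^ 2 / 4)))) := by ring
    _ = _ := by rw [← Real.exp_add]; ring_nf

lemma enorm_heatK_le {d : ℕ} {σ : ℝ} (hσ : 0 < σ) (x : Space d) :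
    ‖heatK σ x‖ₑ ≤ gauss σ x := by
  have := enorm_mul_heatK_le hσ x (a := 1) zero_le_one (by
    rw [abs_one, one_mul, Real.one_le_exp_iff]; positivity)
  simpa using this

lemma sqrt_rpow_neg_half {σ : ℝ} (hσ : 0 < σ) : σ ^ (-(1 / 2) : ℝ) = (√σ)⁻¹ := by
  rw [Real.rpow_neg hσ.le, Real.sqrt_eq_rpow]

lemma abs_coord_le {d : ℕ} (x : Space d) (i : Fin d) : |x i| ≤ ‖x‖ := by
  simpa using PiLp.norm_apply_le x i

lemma enorm_heatK1_le {d : ℕ} {σ : ℝ} (hσ : 0 < σ) (i : Fin d) (x : Space d) :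
    ‖heatK1 i σ x‖ₑ ≤ pw (-(1 / 2)) σ * gauss σ x := by
  rw [pw_of_pos hσ, sqrt_rpow_neg_half hσ]
  have hq : 0 < √σ := by positivity
  refine enorm_mul_heatK_le hσ x (by positivity) ?_
  set y := ‖x‖ / √σ with hy
  have h1 : |-(x i / (2 * σ))| ≤ (√σ)⁻¹ * (y / 2) := by
    rw [abs_neg, abs_div, abs_of_pos (by positivity : 0 < 2 * σ)]
    have : (√σ)⁻¹ * (y / 2) = ‖x‖ / (2 * σ) := by
      rw [hy]; nth_rewrite 3 [← Real.mul_self_sqrt hσ.le]; field_simp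
    rw [this]
    gcongr
    exact abs_coord_le x i
  refine h1.trans ?_
  gcongr
  have := Real.add_one_le_exp (y ^ 2 / 8)
  nlinarith [sq_nonneg (y - 2)]

lemma abs_heatK2_coeff_le {d : ℕ} {σ : ℝ} (hσ : 0 < σ) (i j : Fin d) (x : Space d) :
    |x i * x j / (4 * σ ^ 2) - if i = j then 1 / (2 * σ) else 0| ≤
      σ⁻¹ * ((‖x‖ / √σ) ^ 2 / 4 + 1 / 2) := by
  refine (abs_sub _ _).trans ?_
  rw [div_pow, Real.sq_sqrt hσ.le, mul_add]
  refine add_le_add ?_ ?_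
  · rw [abs_div, abs_mul, abs_of_pos (by positivity : 0 < 4 * σ ^ 2)]
    calc |x i| * |x j| / (4 * σ ^ 2) ≤ ‖x‖ * ‖x‖ / (4 * σ ^ 2) := by
          gcongr <;> exact abs_coord_le x _
      _ = _ := by field_simp
  · split_ifs
    · rw [abs_of_pos (by positivity)]; apply le_of_eq; field_simp
    · rw [abs_zero]; positivity

lemma enorm_heatK2_le {d : ℕ} {σ : ℝ} (hσ : 0 < σ) (i j : Fin d) (x : Space d) :
    ‖heatK2 i j σ x‖ₑ ≤ ENNReal.ofReal 3 * (pw (-1) σ * gauss σ x) := by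
  rw [pw_of_pos hσ, Real.rpow_neg_one, ← mul_assoc, ← ENNReal.ofReal_mul (by norm_num)]
  refine enorm_mul_heatK_le hσ x (by positivity) ((abs_heatK2_coeff_le hσ i j x).trans ?_)
  have := Real.add_one_le_exp ((‖x‖ / √σ) ^ 2 / 8)
  have h2 : 0 ≤ (‖x‖ / √σ) ^ 2 := by positivity
  rw [mul_comm 3, mul_assoc]
  gcongr
  linarith

/-- The Gaussian weight `exp (-‖z‖²/(16S))`. -/
def weight {d : ℕ} (S : ℝ) (z : Space d) : ℝ := Real.exp (-(‖z‖ ^ 2 / (16 * S)))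

@[fun_prop]
lemma measurable_weight {d : ℕ} {Ω : Type*} [MeasurableSpace Ω] {σ : Ω → ℝ} {x : Ω → Space d}
    (hσ : Measurable σ) (hx : Measurable x) : Measurable fun ω => weight (σ ω) (x ω) := by
  unfold weight; fun_prop

lemma weight_pos {d : ℕ} (S : ℝ) (z : Space d) : 0 < weight S z := Real.exp_pos _

/-- For `v - u ≥ 1` the left side is at most 1. Otherwise `v² - u² ≤ (v-u)(2u+1) ≤ 2(v-u)(1+u²)`,
and `(1+u²) exp(-u²) ≤ 1`. -/
lemma exp_neg_sq_sub_le {u v : ℝ} (hu : 0 ≤ u) (hv : 0 ≤ v) :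
    |Real.exp (-u ^ 2) - Real.exp (-v ^ 2)| ≤ 2 * |u - v| := by
  wlog h : u ≤ v generalizing u v
  · rw [abs_sub_comm, abs_sub_comm u]; exact this hv hu (le_of_not_ge h)
  have hmono : Real.exp (-v ^ 2) ≤ Real.exp (-u ^ 2) := by
    rw [Real.exp_le_exp]; nlinarith
  have hu1 : Real.exp (-u ^ 2) ≤ 1 := by rw [Real.exp_le_one_iff]; nlinarith
  rw [abs_of_nonneg (by linarith), abs_of_nonpos (by linarith)]
  rcases le_or_gt 1 (v - u) with h1 | h1
  · linarith [Real.exp_pos (-v ^ 2)]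
  · have e1 : Real.exp (-v ^ 2) = Real.exp (-u ^ 2) * Real.exp (-(v ^ 2 - u ^ 2)) := by
      rw [← Real.exp_add]; ring_nf
    have e2 := Real.add_one_le_exp (-(v ^ 2 - u ^ 2))
    have e3 : (1 + u ^ 2) * Real.exp (-u ^ 2) ≤ 1 := by
      have := Real.add_one_le_exp (u ^ 2)
      rw [Real.exp_neg, ← div_eq_mul_inv, div_le_one (Real.exp_pos _)]; linarith
    have hp := Real.exp_pos (-u ^ 2)
    rw [e1]
    calc _ = Real.exp (-u ^ 2) * (1 - Real.exp (-(v ^ 2 - u ^ 2))) := by ring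
      _ ≤ Real.exp (-u ^ 2) * ((v - u) * (2 * (1 + u ^ 2))) := by
        gcongr
        nlinarith [sq_nonneg (u - 1), mul_nonneg (sub_nonneg.2 h) (sub_nonneg.2 h1.le),
          mul_nonneg (sub_nonneg.2 h) (sq_nonneg u), mul_nonneg (sub_nonneg.2 h) (sq_nonneg (u-1))]
      _ = 2 * (v - u) * ((1 + u ^ 2) * Real.exp (-u ^ 2)) := by ring
      _ ≤ 2 * (v - u) * 1 := by
        have : 0 ≤ v - u := by linarith
        gcongr
      _ = _ := by ring

/-- The point is moved first and the scale second. The first change is Lipschitz at scale `√S`; the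
second uses `y exp(-y) ≤ 1`. -/
lemma abs_weight_sub_le {d : ℕ} {S σ : ℝ} (hS : 0 < S) (hσ : 0 < σ) (z z' : Space d) :
    |weight S z - weight (S + σ) z'| ≤ ‖z' - z‖ / √S + σ / S := by
  have h1 : |weight S z - weight S z'| ≤ ‖z' - z‖ / √S := by
    have hw : ∀ y : Space d, weight S y = Real.exp (-(‖y‖ / (4 * √S)) ^ 2) := fun y => by
      rw [weight, div_pow, mul_pow, Real.sq_sqrt hS.le]; norm_num
    rw [hw, hw]
    refine (exp_neg_sq_sub_le (by positivity) (by positivity)).trans ?_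
    rw [← sub_div, abs_div, abs_of_pos (by positivity : 0 < 4 * √S)]
    calc 2 * (|‖z‖ - ‖z'‖| / (4 * √S)) ≤ 2 * (‖z' - z‖ / (4 * √S)) := by
          gcongr; rw [norm_sub_rev]; exact abs_norm_sub_norm_le z z'
      _ = (1 / 2) * (‖z' - z‖ / √S) := by field_simp; ring
      _ ≤ _ := by
        have : 0 ≤ ‖z' - z‖ / √S := by positivity
        linarith
  have h2 : |weight S z' - weight (S + σ) z'| ≤ σ / S := by
    unfold weight
    set y := ‖z'‖ ^ 2 / (16 * (S + σ)) with hy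
    have hy0 : 0 ≤ y := by positivity
    have e : ‖z'‖ ^ 2 / (16 * S) = y + y * (σ / S) := by rw [hy]; field_simp
    have hm : 0 ≤ y * (σ / S) := by positivity
    rw [e, abs_sub_comm, abs_of_nonneg (by
      rw [sub_nonneg, Real.exp_le_exp]; linarith), neg_add, Real.exp_add]
    have e2 := Real.add_one_le_exp (-(y * (σ / S)))
    have e3 : y * Real.exp (-y) ≤ 1 := by
      have := Real.add_one_le_exp y
      rw [Real.exp_neg, ← div_eq_mul_inv, div_le_one (Real.exp_pos _)]; linarith
    calc _ = Real.exp (-y) * (1 - Real.exp (-(y * (σ / S)))) := by ring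
      _ ≤ Real.exp (-y) * (y * (σ / S)) := by gcongr; linarith
      _ = (y * Real.exp (-y)) * (σ / S) := by ring
      _ ≤ 1 * (σ / S) := by gcongr
      _ = _ := one_mul _
  calc _ = |(weight S z - weight S z') + (weight S z' - weight (S + σ) z')| := by ring_nf
    _ ≤ _ := (abs_add_le _ _).trans (add_le_add h1 h2)

/-- At the distance `√σ` seen by the kernel, the two weights differ by a quantity of order `√(σ/S)`.
This turns the non-integrable `σ^(-1)` into `σ^(-1/2) S^(-1/2)`; the hypothesis `σ ≤ S` is what
allows `σ/S ≤ √(σ/S)`. -/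
lemma enorm_heatK2_mul_weight_sub_le {d : ℕ} {S σ : ℝ} (hσ : 0 < σ) (hσS : σ ≤ S)
    (i j : Fin d) (z z' : Space d) :
    ‖heatK2 i j σ (z' - z) * (weight S z - weight (S + σ) z')‖ₑ ≤
      ENNReal.ofReal 23 * (pw (-(1 / 2)) σ * pw (-(1 / 2)) S * gauss σ (z' - z)) := by
  have hS : 0 < S := hσ.trans_le hσS
  rw [pw_of_pos hσ, pw_of_pos hS, sqrt_rpow_neg_half hσ, sqrt_rpow_neg_half hS, ← mul_assoc,
    ← ENNReal.ofReal_mul (by positivity), ← ENNReal.ofReal_mul (by positivity), heatK2,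
    mul_right_comm]
  refine enorm_mul_heatK_le hσ _ (by positivity) ?_
  have h1 := abs_heatK2_coeff_le hσ i j (z' - z)
  have h2 := abs_weight_sub_le hS hσ z z'
  rw [abs_mul]
  set y := ‖z' - z‖ / √σ with hy
  have hy0 : 0 ≤ y := by positivity
  have hqσ : 0 < √σ := by positivity
  have hqS : 0 < √S := by positivity
  have h3 : ‖z' - z‖ / √S + σ / S ≤ √σ / √S * (y + 1) := by
    have e1 : ‖z' - z‖ / √S = √σ / √S * y := by rw [hy]; field_simp
    have e2 : σ / S ≤ √σ / √S := by
      have : σ / S = (√σ / √S) ^ 2 := by rw [div_pow, Real.sq_sqrt hσ.le, Real.sq_sqrt hS.le]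
      rw [this]
      have h5 : √σ / √S ≤ 1 := by rw [div_le_one hqS]; exact Real.sqrt_le_sqrt hσS
      have h6 : 0 ≤ √σ / √S := by positivity
      nlinarith
    rw [e1]; linarith
  -- Each polynomial factor is absorbed by one copy of `exp(y²/16)`, with constants 4 and 5; 23
  -- merely exceeds their product.
  have h4 : (y ^ 2 / 4 + 1 / 2) * (y + 1) ≤ 23 * Real.exp (y ^ 2 / 8) := by
    have e := Real.add_one_le_exp (y ^ 2 / 16)
    have e2 : Real.exp (y ^ 2 / 8) = Real.exp (y ^ 2 / 16) * Real.exp (y ^ 2 / 16) := by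
      rw [← Real.exp_add]; ring_nf
    set E := Real.exp (y ^ 2 / 16)
    have a1 : y ^ 2 / 4 + 1 / 2 ≤ 4 * E := by linarith
    have a2 : y + 1 ≤ 5 * E := by nlinarith [sq_nonneg (y - 8 / 5)]
    calc _ ≤ 4 * E * (5 * E) := mul_le_mul a1 a2 (by positivity) (by positivity)
      _ ≤ _ := by rw [e2]; nlinarith [mul_self_nonneg E]
  calc _ ≤ σ⁻¹ * (y ^ 2 / 4 + 1 / 2) * (√σ / √S * (y + 1)) :=
        mul_le_mul h1 (h2.trans h3) (abs_nonneg _) (by positivity)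
    _ = (√σ)⁻¹ * (√S)⁻¹ * ((y ^ 2 / 4 + 1 / 2) * (y + 1)) := by
        nth_rewrite 1 [← Real.mul_self_sqrt hσ.le]; field_simp
    _ ≤ (√σ)⁻¹ * (√S)⁻¹ * (23 * Real.exp (y ^ 2 / 8)) := by gcongr
    _ = _ := by ring

/-! ### Gaussian moments -/

lemma lintegral_gauss_lt_top {d : ℕ} (σ : ℝ) (m : Space d) : ∫⁻ y, gauss σ (y - m) < ∞ := by
  have h := lintegral_mul_gauss_le (r := ∞) le_top (φ := fun _ : Space d => 1) measurable_const σ m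
  simp only [one_mul] at h
  refine h.trans_lt (ENNReal.mul_lt_top (ENNReal.mul_lt_top ENNReal.ofReal_lt_top
    (pw_ne_top _ _).lt_top) ?_)
  rw [eLpNorm_exponent_top]
  refine (eLpNormEssSup_le_of_ae_enorm_bound (C := 1) (ae_of_all _ fun x => ?_)).trans_lt
    ENNReal.one_lt_top
  simp

lemma integrable_mul_heatK {d : ℕ} {σ : ℝ} (hσ : 0 < σ) {p : Space d → ℝ} (hp : Measurable p)
    {B : ℝ} (hB : ∀ x, |p x| ≤ B * (1 + ‖x‖ ^ 2)) : Integrable fun x => p x * heatK σ x := by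
  have hB0 : 0 ≤ B := by
    have := (abs_nonneg _).trans (hB 0)
    simpa using this
  refine ⟨(hp.mul (by fun_prop)).aestronglyMeasurable, ?_⟩
  have hb : ∀ x : Space d, ‖p x * heatK σ x‖ₑ ≤ ENNReal.ofReal (B * (1 + 8 * σ)) * gauss σ x := by
    intro x
    refine enorm_mul_heatK_le hσ x (by positivity) ((hB x).trans ?_)
    rw [mul_assoc]
    gcongr
    rw [div_pow, Real.sq_sqrt hσ.le]
    have h1 := Real.add_one_le_exp (‖x‖ ^ 2 / σ / 8)
    have h2 : ‖x‖ ^ 2 = 8 * σ * (‖x‖ ^ 2 / σ / 8) := by field_simp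
    have h3 : 0 ≤ ‖x‖ ^ 2 / σ / 8 := by positivity
    rw [h2]
    calc 1 + 8 * σ * (‖x‖ ^ 2 / σ / 8) ≤ (1 + 8 * σ) * (‖x‖ ^ 2 / σ / 8 + 1) := by nlinarith
      _ ≤ (1 + 8 * σ) * Real.exp (‖x‖ ^ 2 / σ / 8) := by gcongr
      _ = _ := by congr 2; field_simp
  refine (lintegral_mono hb).trans_lt ?_
  rw [lintegral_const_mul _ (by fun_prop)]
  refine ENNReal.mul_lt_top ENNReal.ofReal_lt_top ?_
  simpa using lintegral_gauss_lt_top σ (0 : Space d)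

lemma integrable_heatK {d : ℕ} {σ : ℝ} (hσ : 0 < σ) : Integrable (heatK (d := d) σ) := by
  simpa using integrable_mul_heatK hσ (p := fun _ : Space d => 1) measurable_const (B := 1)
    (fun x => by rw [abs_one, one_mul]; nlinarith [norm_nonneg x])

lemma integral_heatK {d : ℕ} {σ : ℝ} (hσ : 0 < σ) : ∫ x : Space d, heatK σ x = 1 := by
  unfold heatK
  have h := GaussianFourier.integral_rexp_neg_mul_sq_norm (V := Space d)
    (b := 1 / (4 * σ)) (by positivity)
  rw [integral_const_mul]
  have e : (fun x : Space d => Real.exp (-(‖x‖ ^ 2 / (4 * σ)))) =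
      fun v => Real.exp (-(1 / (4 * σ)) * ‖v‖ ^ 2) := by
    funext x; ring_nf
  rw [e, h, finrank_euclideanSpace, Fintype.card_fin, neg_div, Real.rpow_neg (by positivity)]
  rw [show Real.pi / (1 / (4 * σ)) = 4 * Real.pi * σ by field_simp]
  exact inv_mul_cancel₀ (by positivity)

lemma heatK_neg {d : ℕ} (σ : ℝ) (x : Space d) : heatK σ (-x) = heatK σ x := by
  simp [heatK]

lemma integral_coord_mul_heatK {d : ℕ} (σ : ℝ) (i : Fin d) :
    ∫ x : Space d, x i * heatK σ x = 0 := by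
  have h := integral_neg_eq_self (fun x : Space d => x i * heatK σ x) volume
  simp only [heatK_neg, PiLp.neg_apply, neg_mul, integral_neg] at h
  linarith

lemma one_add_sq_bounds (t : ℝ) : t ≤ 1 + t ^ 2 := by nlinarith [sq_nonneg (t - 1)]

lemma abs_coord_mul_coord_le {d : ℕ} (x : Space d) (i j : Fin d) :
    |x i * x j| ≤ 1 * (1 + ‖x‖ ^ 2) := by
  rw [abs_mul]
  nlinarith [mul_le_mul (abs_coord_le x i) (abs_coord_le x j) (abs_nonneg _) (norm_nonneg x)]

lemma integrable_coord_mul_heatK {d : ℕ} {σ : ℝ} (hσ : 0 < σ) (i : Fin d) :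
    Integrable fun x : Space d => x i * heatK σ x :=
  integrable_mul_heatK hσ (by fun_prop) (B := 1) fun x => by
    rw [one_mul]; exact (abs_coord_le x i).trans (one_add_sq_bounds _)

lemma integrable_coord_mul_coord_mul_heatK {d : ℕ} {σ : ℝ} (hσ : 0 < σ) (i j : Fin d) :
    Integrable fun x : Space d => x i * x j * heatK σ x :=
  integrable_mul_heatK hσ (by fun_prop) (B := 1) fun x => abs_coord_mul_coord_le x i j

lemma integrable_heatK1 {d : ℕ} {σ : ℝ} (hσ : 0 < σ) (i : Fin d) :
    Integrable (heatK1 (d := d) i σ) := by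
  refine ((integrable_coord_mul_heatK hσ i).const_mul (-(1 / (2 * σ)))).congr
    (ae_of_all _ fun x => ?_)
  simp only [heatK1]; ring

/-- Integration by parts, since `x_j K = -2σ ∂_j K` and `K` has mass 1. -/
lemma integral_coord_mul_coord_mul_heatK {d : ℕ} {σ : ℝ} (hσ : 0 < σ) (i j : Fin d) :
    ∫ x : Space d, x i * x j * heatK σ x = if i = j then 2 * σ else 0 := by
  have hpr : ∀ x : Space d, HasFDerivAt (fun y : Space d => y i)
      (EuclideanSpace.proj i : Space d →L[ℝ] ℝ) x :=
    fun x => (EuclideanSpace.proj i : Space d →L[ℝ] ℝ).hasFDerivAt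
  have hf : ∀ x : Space d, fderiv ℝ (fun y : Space d => y i) x (EuclideanSpace.single j 1) =
      if i = j then 1 else 0 := fun x => by
    rw [(hpr x).fderiv]; simp [PiLp.proj_apply]
  have key := integral_mul_fderiv_eq_neg_fderiv_mul_of_integrable
    (μ := (volume : Measure (Space d)))
    (f := fun y : Space d => y i) (g := heatK (d := d) σ) (v := EuclideanSpace.single j 1) ?_ ?_ ?_
    (fun x _ => (hpr x).differentiableAt) (fun x _ => (hasFDerivAt_heatK σ x).differentiableAt)
  · simp only [hf, fderiv_heatK_single] at key
    have e1 : ∀ x : Space d, x i * heatK1 j σ x = -(1 / (2 * σ)) * (x i * x j * heatK σ x) :=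
      fun x => by unfold heatK1; ring
    simp only [e1] at key
    rw [integral_const_mul, integral_const_mul, integral_heatK hσ] at key
    field_simp at key
    split_ifs at key ⊢ <;> linarith
  · simp only [hf]
    exact (integrable_heatK hσ).const_mul _
  · simp only [fderiv_heatK_single]
    refine ((integrable_coord_mul_coord_mul_heatK hσ i j).const_mul (-(1 / (2 * σ)))).congr
      (ae_of_all _ fun x => ?_)
    simp only [heatK1]; ring
  · exact integrable_coord_mul_heatK hσ i

/-! ### The composition identity -/

/-- The parallelogram law separates the midpoint from the half-difference. -/
lemma heatK_mul_heatK {d : ℕ} {τ : ℝ} (hτ : 0 < τ) (x h : Space d) :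
    heatK τ (x - h) * heatK τ (x + h) = heatK (τ / 2) x * heatK (2 * τ) ((2 : ℝ) • h) := by
  unfold heatK
  have hn : ‖x - h‖ ^ 2 + ‖x + h‖ ^ 2 = 2 * (‖x‖ ^ 2 + ‖h‖ ^ 2) := by
    rw [norm_add_sq_real, norm_sub_sq_real]; ring
  rw [norm_smul, mul_mul_mul_comm,
    mul_mul_mul_comm ((4 * Real.pi * (τ / 2)) ^ (-(d : ℝ) / 2)),
    ← Real.mul_rpow (by positivity)
    (by positivity), ← Real.mul_rpow (by positivity) (by positivity), ← Real.exp_add,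
    ← Real.exp_add]
  congr 2
  · ring
  · rw [← neg_add, ← neg_add, ← add_div, hn]
    simp only [Real.norm_ofNat]
    field_simp

/-- The semigroup law `K_τ * K_τ = K_{2τ}` differentiated once in each endpoint; the sign appears
because `K_{2τ}` depends on `z - z'`. After recentring at the midpoint, only the moments of `heatK
(τ/2)` of order at most two are needed. -/
lemma integral_heatK1_mul_heatK1 {d : ℕ} {τ : ℝ} (hτ : 0 < τ) (i j : Fin d) (z z' : Space d) :
    ∫ y, heatK1 i τ (y - z) * heatK1 j τ (y - z') = -heatK2 i j (2 * τ) (z - z') := by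
  set h := (2⁻¹ : ℝ) • (z - z') with hh
  set m := (2⁻¹ : ℝ) • (z + z') with hm
  have e2 : (2 : ℝ) • h = z - z' := by rw [hh, smul_smul]; norm_num
  have ez : ∀ x : Space d, x + m - z = x - h := fun x => by
    have : m - z = -h := by
      rw [hm, hh, ← smul_neg, neg_sub, sub_eq_iff_eq_add]
      have : (2⁻¹ : ℝ) • (z + z') = (2⁻¹ : ℝ) • (z' - z) + ((2⁻¹ : ℝ) • z + (2⁻¹ : ℝ) • z) := by
        rw [← smul_add, ← smul_add]; congr 1; abel
      rw [this, ← add_smul]; norm_num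
    rw [add_sub_assoc, this, sub_eq_add_neg]
  have ez' : ∀ x : Space d, x + m - z' = x + h := fun x => by
    have : m - z' = h := by
      rw [hm, hh, sub_eq_iff_eq_add]
      have : (2⁻¹ : ℝ) • (z + z') = (2⁻¹ : ℝ) • (z - z') + ((2⁻¹ : ℝ) • z' + (2⁻¹ : ℝ) • z') := by
        rw [← smul_add, ← smul_add]; congr 1; abel
      rw [this, ← add_smul]; norm_num
    rw [add_sub_assoc, this]
  rw [← integral_add_right_eq_self _ m]
  simp only [ez, ez']
  have e3 : ∀ x : Space d, heatK1 i τ (x - h) * heatK1 j τ (x + h) =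
      heatK (2 * τ) (z - z') / (4 * τ ^ 2) * (x i * x j * heatK (τ / 2) x +
        (h j * (x i * heatK (τ / 2) x) + (-h i * (x j * heatK (τ / 2) x) +
          -(h i * h j) * heatK (τ / 2) x))) := fun x => by
    have e4 : heatK1 i τ (x - h) * heatK1 j τ (x + h) = (x i - h i) * (x j + h j) / (4 * τ ^ 2) *
        (heatK τ (x - h) * heatK τ (x + h)) := by
      simp only [heatK1, PiLp.sub_apply, PiLp.add_apply]; field_simp; ring
    rw [e4, heatK_mul_heatK hτ, e2]
    ring
  have hτ2 : 0 < τ / 2 := by positivity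
  have i1 := integrable_coord_mul_coord_mul_heatK hτ2 i j
  have i2 := (integrable_coord_mul_heatK hτ2 i).const_mul (h j)
  have i3 := (integrable_coord_mul_heatK hτ2 j).const_mul (-h i)
  have i4 := (integrable_heatK (d := d) hτ2).const_mul (-(h i * h j))
  simp only [e3]
  have hz : ∀ k, (z - z') k = 2 * h k := fun k => by rw [← e2]; simp
  rw [integral_const_mul, integral_add i1 (i2.fun_add (i3.fun_add i4)),
    integral_add i2 (i3.fun_add i4),
    integral_add i3 i4, integral_const_mul, integral_const_mul, integral_const_mul,
    integral_coord_mul_coord_mul_heatK hτ2, integral_coord_mul_heatK, integral_coord_mul_heatK,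
    integral_heatK hτ2, heatK2, hz, hz]
  split_ifs <;> field_simp <;> ring

/-! ### The quadratic form of the second derivatives -/

/-- The convolution of a first derivative of the heat kernel with `a`. -/
def gradConv {d : ℕ} (i : Fin d) (τ : ℝ) (a : Space d → ℝ) (y : Space d) : ℝ :=
  ∫ z, heatK1 i τ (y - z) * a z

/-- The squared `L²` norm of the gradient of the heat semigroup, at time `σ/2`. -/
def dissip {d : ℕ} (a : Space d → ℝ) (σ : ℝ) : ℝ≥0∞ :=
  ∑ i, ∫⁻ y, ‖gradConv i (σ / 2) a y‖ₑ ^ 2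

lemma exists_abs_heatK1_le {d : ℕ} {τ : ℝ} (hτ : 0 < τ) (i : Fin d) :
    ∃ M, ∀ x : Space d, ‖heatK1 i τ x‖ ≤ M := by
  refine ⟨τ ^ (-(1 / 2) : ℝ) * (τ ^ (-((d : ℝ) / 2))), fun x => ?_⟩
  have h := enorm_heatK1_le hτ i x
  rw [pw_of_pos hτ, gauss_of_pos hτ, ← ENNReal.ofReal_mul (by positivity),
    ← ofReal_norm] at h
  rw [ENNReal.ofReal_le_ofReal_iff (by positivity)] at h
  refine h.trans ?_
  gcongr
  refine mul_le_of_le_one_right (by positivity) ?_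
  rw [Real.exp_le_one_iff, neg_nonpos]
  positivity

/-- The justification of Fubini's theorem: one kernel is integrable, so its product with `a` is a
convolution integrand, and the other kernel is bounded. -/
lemma integrable_heatK1_mul_heatK1 {d : ℕ} {τ : ℝ} (hτ : 0 < τ) (i j : Fin d)
    {a b : Space d → ℝ} (ha : Integrable a) (hb : Integrable b) :
    Integrable fun p : Space d × Space d × Space d =>
      (heatK1 i τ (p.1 - p.2.1) * a p.2.1) * (heatK1 j τ (p.1 - p.2.2) * b p.2.2) := by
  have h1 : Integrable (fun p : Space d × Space d => a p.2 * heatK1 i τ (p.1 - p.2))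
      (volume.prod volume) :=
    ha.convolution_integrand (ContinuousLinearMap.mul ℝ ℝ) (integrable_heatK1 hτ i)
  have h2 := h1.mul_prod hb
  obtain ⟨M, hM⟩ := exists_abs_heatK1_le hτ j (d := d)
  have h3 : Integrable (fun p : (Space d × Space d) × Space d =>
      heatK1 j τ (p.1.1 - p.2) * (a p.1.2 * heatK1 i τ (p.1.1 - p.1.2) * b p.2))
      ((volume.prod volume).prod volume) :=
    h2.bdd_mul (by fun_prop : Measurable _).aestronglyMeasurable (ae_of_all _ fun p => hM _)
  have h4 := (measurePreserving_prodAssoc (volume : Measure (Space d)) (volume : Measure (Space d))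
    (volume : Measure (Space d))).symm.integrable_comp_of_integrable h3
  refine h4.congr (ae_of_all _ fun p => ?_)
  simp only [Function.comp, MeasurableEquiv.prodAssoc, MeasurableEquiv.symm_mk,
    MeasurableEquiv.coe_mk, Equiv.prodAssoc_symm_apply]
  ring

lemma integrable_gradConv_mul_gradConv {d : ℕ} {τ : ℝ} (hτ : 0 < τ) (i j : Fin d)
    {a b : Space d → ℝ} (ha : Integrable a) (hb : Integrable b) :
    Integrable (fun y => gradConv i τ a y * gradConv j τ b y) := by
  have h := (integrable_heatK1_mul_heatK1 hτ i j ha hb).integral_prod_left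
  refine h.congr (ae_of_all _ fun y => ?_)
  exact integral_prod_mul (fun z => heatK1 i τ (y - z) * a z) (fun z => heatK1 j τ (y - z) * b z)

lemma integral_gradConv_mul_gradConv {d : ℕ} {τ : ℝ} (hτ : 0 < τ) (i j : Fin d)
    {a b : Space d → ℝ} (ha : Integrable a) (hb : Integrable b) :
    ∫ y, gradConv i τ a y * gradConv j τ b y =
      -∫ p : Space d × Space d, a p.1 * heatK2 i j (2 * τ) (p.1 - p.2) * b p.2 := by
  have h := integral_integral_swap (f := fun (y : Space d) (p : Space d × Space d) =>
    (heatK1 i τ (y - p.1) * a p.1) * (heatK1 j τ (y - p.2) * b p.2))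
    (integrable_heatK1_mul_heatK1 hτ i j ha hb)
  rw [← integral_neg]
  refine Eq.trans (integral_congr_ae (ae_of_all _ fun y => ?_)) (h.trans
    (integral_congr_ae (ae_of_all _ fun p => ?_)))
  · exact (integral_prod_mul (fun z => heatK1 i τ (y - z) * a z)
      (fun z => heatK1 j τ (y - z) * b z)).symm
  · simp only
    calc _ = ∫ y, (a p.1 * b p.2) * (heatK1 i τ (y - p.1) * heatK1 j τ (y - p.2)) := by
          congr 1; funext y; ring
      _ = _ := by rw [integral_const_mul, integral_heatK1_mul_heatK1 hτ]; ring

lemma heatK2_neg {d : ℕ} (i j : Fin d) (σ : ℝ) (x : Space d) :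
    heatK2 i j σ (-x) = heatK2 i j σ x := by
  simp [heatK2, heatK_neg]

lemma measurable_gradConv {d : ℕ} (i : Fin d) (τ : ℝ) {a : Space d → ℝ} (ha : Measurable a) :
    Measurable (gradConv i τ a) := by
  have : StronglyMeasurable fun p : Space d × Space d => heatK1 i τ (p.1 - p.2) * a p.2 :=
    (by fun_prop : Measurable _).stronglyMeasurable
  exact this.integral_prod_right'.measurable

/-- The second derivative is divided evenly between `a` and `b`. In contrast to a pointwise bound of
size `σ^(-1)`, the right side retains the integrability in `σ` given by the energy estimate. -/
lemma enorm_integral_heatK2_le {d : ℕ} {σ : ℝ} (hσ : 0 < σ) (i j : Fin d)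
    {a b : Space d → ℝ} (ham : Measurable a) (hbm : Measurable b) (ha : Integrable a)
    (hb : Integrable b) :
    ‖∫ p : Space d × Space d, a p.1 * heatK2 i j σ (p.2 - p.1) * b p.2‖ₑ ≤
      dissip a σ ^ (1 / 2 : ℝ) * dissip b σ ^ (1 / 2 : ℝ) := by
  have h := integral_gradConv_mul_gradConv (half_pos hσ) i j ha hb
  rw [mul_div_cancel₀ _ (two_ne_zero' ℝ)] at h
  have e : ∫ p : Space d × Space d, a p.1 * heatK2 i j σ (p.2 - p.1) * b p.2 =
      -∫ y, gradConv i (σ / 2) a y * gradConv j (σ / 2) b y := by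
    rw [h, neg_neg]
    refine integral_congr_ae (ae_of_all _ fun p => ?_)
    simp only
    rw [← heatK2_neg, neg_sub]
  rw [e, enorm_neg]
  refine (enorm_integral_le_lintegral_enorm _).trans ?_
  have hi := measurable_gradConv i (σ / 2) ham
  have hj := measurable_gradConv j (σ / 2) hbm
  have cs := ENNReal.lintegral_mul_le_Lp_mul_Lq (volume : Measure (Space d))
    Real.HolderConjugate.two_two hi.enorm.aemeasurable hj.enorm.aemeasurable
  simp only [enorm_mul]
  refine cs.trans ?_
  simp only [ENNReal.rpow_two]
  unfold dissip
  gcongr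
  · exact Finset.single_le_sum (f := fun i => ∫⁻ y, ‖gradConv i (σ / 2) a y‖ₑ ^ 2)
      (fun _ _ => zero_le) (Finset.mem_univ i)
  · exact Finset.single_le_sum (f := fun i => ∫⁻ y, ‖gradConv i (σ / 2) b y‖ₑ ^ 2)
      (fun _ _ => zero_le) (Finset.mem_univ j)

/-! ### The energy estimate -/

lemma sum_heatK2 {d : ℕ} (σ : ℝ) (x : Space d) :
    ∑ i, heatK2 i i σ x = (‖x‖ ^ 2 / (4 * σ ^ 2) - d / (2 * σ)) * heatK σ x := by
  simp only [heatK2, if_true, ← Finset.sum_mul, Finset.sum_sub_distrib, ← Finset.sum_div,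
    EuclideanSpace.real_norm_sq_eq, ← pow_two]
  simp

/-- The heat equation. It makes the dissipation a derivative in `σ`. -/
lemma hasDerivAt_heatK {d : ℕ} {σ : ℝ} (hσ : 0 < σ) (x : Space d) :
    HasDerivAt (fun s => heatK s x) (∑ i, heatK2 i i σ x) σ := by
  have hpi : 0 < 4 * Real.pi := by positivity
  have h1 : HasDerivAt (fun s : ℝ => (4 * Real.pi * s) ^ (-(d : ℝ) / 2)) _ σ :=
    ((hasDerivAt_id σ).const_mul (4 * Real.pi)).rpow_const (p := -(d : ℝ) / 2)
      (Or.inl (mul_pos hpi hσ).ne')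
  have h2 : HasDerivAt (fun s : ℝ => Real.exp (-(‖x‖ ^ 2 / 4 * s⁻¹))) _ σ :=
    ((hasDerivAt_inv hσ.ne').const_mul (‖x‖ ^ 2 / 4)).fun_neg.exp
  have h3 := h1.mul h2
  have e : (fun s => heatK s x) = (fun s : ℝ => (4 * Real.pi * s) ^ (-(d : ℝ) / 2)) *
      fun s : ℝ => Real.exp (-(‖x‖ ^ 2 / 4 * s⁻¹)) := by
    funext s; simp only [heatK, Pi.mul_apply]; ring_nf
  rw [e]
  refine h3.congr_deriv ?_
  rw [sum_heatK2]
  have e1 : heatK σ x = (4 * Real.pi * σ) ^ (-(d : ℝ) / 2) *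
      Real.exp (-(‖x‖ ^ 2 / 4 * σ⁻¹)) := by simpa using congrFun e σ
  rw [e1, id, Real.rpow_sub_one (by positivity)]
  field_simp
  ring

lemma abs_sum_heatK2_le {d : ℕ} {ε σ : ℝ} (hε : 0 < ε) (hσ : ε ≤ σ) (x : Space d) :
    ‖∑ i, heatK2 i i σ x‖ ≤ d * (3 * (ε ^ (-1 : ℝ) * ε ^ (-((d : ℝ) / 2)))) := by
  have hσ0 := hε.trans_le hσ
  refine (norm_sum_le _ _).trans ?_
  have : ∀ i : Fin d, ‖heatK2 i i σ x‖ ≤ 3 * (ε ^ (-1 : ℝ) * ε ^ (-((d : ℝ) / 2))) := fun i => by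
    have h := enorm_heatK2_le hσ0 i i x
    rw [pw_of_pos hσ0, gauss_of_pos hσ0, ← ENNReal.ofReal_mul (by positivity),
      ← ENNReal.ofReal_mul (by positivity), ← ofReal_norm,
      ENNReal.ofReal_le_ofReal_iff (by positivity)] at h
    refine h.trans ?_
    have hd : (0 : ℝ) ≤ d / 2 := by positivity
    have e1 : σ ^ (-((d : ℝ) / 2)) ≤ ε ^ (-((d : ℝ) / 2)) :=
      Real.rpow_le_rpow_of_nonpos hε hσ (by linarith)
    have e2 : σ ^ (-1 : ℝ) ≤ ε ^ (-1 : ℝ) :=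
      Real.rpow_le_rpow_of_nonpos hε hσ (by norm_num)
    have e3 : Real.exp (-(‖x‖ ^ 2 / (8 * σ))) ≤ 1 := by
      rw [Real.exp_le_one_iff, neg_nonpos]; positivity
    gcongr
    calc _ ≤ ε ^ (-((d : ℝ) / 2)) * 1 := by gcongr
      _ = _ := mul_one _
  refine (Finset.sum_le_sum fun i _ => this i).trans ?_
  simp

/-- The dissipation is `-⟨a, ΔK_σ a⟩`, by the composition identity with `i = j`. The sign is
recorded separately because it is needed to move `ENNReal.ofReal` through the integral over `σ`. -/
lemma dissip_eq {d : ℕ} {a : Space d → ℝ} (ha : Integrable a) {σ : ℝ} (hσ : 0 < σ) :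
    0 ≤ ∫ p : Space d × Space d, -(a p.1 * (∑ i, heatK2 i i σ (p.1 - p.2)) * a p.2) ∧
    dissip a σ = ENNReal.ofReal
      (∫ p : Space d × Space d, -(a p.1 * (∑ i, heatK2 i i σ (p.1 - p.2)) * a p.2)) := by
  have hσ2 := half_pos hσ
  have h1 : ∀ i : Fin d, ∫⁻ y, ‖gradConv i (σ / 2) a y‖ₑ ^ 2 =
      ENNReal.ofReal (∫ p : Space d × Space d, -(a p.1 * heatK2 i i σ (p.1 - p.2) * a p.2)) := by
    intro i
    have h2 := integral_gradConv_mul_gradConv hσ2 i i ha ha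
    rw [mul_div_cancel₀ _ (two_ne_zero' ℝ), ← integral_neg] at h2
    rw [← h2, ofReal_integral_eq_lintegral_ofReal
      (integrable_gradConv_mul_gradConv hσ2 i i ha ha)
      (ae_of_all _ fun y => mul_self_nonneg _)]
    refine lintegral_congr fun y => ?_
    rw [Real.enorm_eq_ofReal_abs, ← ENNReal.ofReal_pow (abs_nonneg _), sq_abs, pow_two]
  have h0 : ∀ i : Fin d,
      0 ≤ ∫ p : Space d × Space d, -(a p.1 * heatK2 i i σ (p.1 - p.2) * a p.2) := by
    intro i
    have h2 := integral_gradConv_mul_gradConv hσ2 i i ha ha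
    rw [mul_div_cancel₀ _ (two_ne_zero' ℝ), ← integral_neg] at h2
    rw [← h2]
    exact integral_nonneg fun y => mul_self_nonneg _
  have hint : ∀ i : Fin d, Integrable fun p : Space d × Space d =>
      -(a p.1 * heatK2 i i σ (p.1 - p.2) * a p.2) := by
    intro i
    have h3 := (integrable_heatK1_mul_heatK1 hσ2 i i ha ha).swap.integral_prod_left
    refine h3.congr (ae_of_all _ fun p => ?_)
    simp only [Function.comp, Prod.fst_swap, Prod.snd_swap]
    calc _ = ∫ y, (a p.1 * a p.2) *
          (heatK1 i (σ / 2) (y - p.1) * heatK1 i (σ / 2) (y - p.2)) := by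
          congr 1; funext y; ring
      _ = _ := by
        rw [integral_const_mul, integral_heatK1_mul_heatK1 hσ2,
          mul_div_cancel₀ _ (two_ne_zero' ℝ)]
        ring
  have e : ∫ p : Space d × Space d, -(a p.1 * (∑ i, heatK2 i i σ (p.1 - p.2)) * a p.2) =
      ∑ i, ∫ p : Space d × Space d, -(a p.1 * heatK2 i i σ (p.1 - p.2) * a p.2) := by
    rw [← integral_finsetSum _ fun i _ => hint i]
    congr 1; funext p
    rw [Finset.sum_neg_distrib, Finset.mul_sum, Finset.sum_mul]
  rw [e]
  refine ⟨Finset.sum_nonneg fun i _ => h0 i, ?_⟩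
  unfold dissip
  rw [Finset.sum_congr rfl fun i _ => h1 i, ← ENNReal.ofReal_sum_of_nonneg fun i _ => h0 i]

lemma lintegral_heatK {d : ℕ} {σ : ℝ} (hσ : 0 < σ) (m : Space d) :
    ∫⁻ y, ‖heatK σ (m - y)‖ₑ = 1 := by
  rw [lintegral_sub_left_eq_self (fun y : Space d => ‖heatK σ y‖ₑ),
    ← ofReal_integral_norm_eq_lintegral_enorm (integrable_heatK hσ)]
  simp only [Real.norm_of_nonneg (heatK_pos hσ _).le, integral_heatK hσ, ENNReal.ofReal_one]

/-- Schur's test: `|a(z) a(z')| ≤ (a(z)² + a(z')²)/2`, and the kernel has mass 1 in either variable.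
-/
lemma lintegral_heatK_form_le {d : ℕ} {a : Space d → ℝ} (ham : Measurable a) {σ : ℝ} (hσ : 0 < σ) :
    ∫⁻ p : Space d × Space d, ‖a p.1 * heatK σ (p.1 - p.2) * a p.2‖ₑ ≤ ∫⁻ z, ‖a z‖ₑ ^ 2 := by
  have hpt : ∀ p : Space d × Space d, ‖a p.1 * heatK σ (p.1 - p.2) * a p.2‖ₑ ≤
      2⁻¹ * (‖a p.1‖ₑ ^ 2 * ‖heatK σ (p.1 - p.2)‖ₑ) +
        2⁻¹ * (‖a p.2‖ₑ ^ 2 * ‖heatK σ (p.2 - p.1)‖ₑ) := by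
    intro p
    have hh : heatK σ (p.2 - p.1) = heatK σ (p.1 - p.2) := by rw [← heatK_neg, neg_sub]
    rw [hh, enorm_mul, enorm_mul]
    simp only [Real.enorm_eq_ofReal_abs]
    have h2 : (2⁻¹ : ℝ≥0∞) = ENNReal.ofReal 2⁻¹ := by
      rw [ENNReal.ofReal_inv_of_pos two_pos]; simp
    rw [h2, ← ENNReal.ofReal_pow (abs_nonneg _), ← ENNReal.ofReal_pow (abs_nonneg _),
      ← ENNReal.ofReal_mul (by positivity), ← ENNReal.ofReal_mul (by positivity),
      ← ENNReal.ofReal_mul (by positivity), ← ENNReal.ofReal_mul (by positivity),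
      ← ENNReal.ofReal_mul (by positivity), ← ENNReal.ofReal_mul (by positivity),
      ← ENNReal.ofReal_add (by positivity) (by positivity)]
    refine ENNReal.ofReal_le_ofReal ?_
    have := two_mul_le_add_sq |a p.1| |a p.2|
    nlinarith [mul_le_mul_of_nonneg_left this (abs_nonneg (heatK σ (p.1 - p.2)))]
  have hA : ∫⁻ p : Space d × Space d, ‖a p.1‖ₑ ^ 2 * ‖heatK σ (p.1 - p.2)‖ₑ =
      ∫⁻ z, ‖a z‖ₑ ^ 2 := by
    rw [Measure.volume_eq_prod, lintegral_prod _ (by fun_prop)]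
    refine lintegral_congr fun z => ?_
    simp only
    rw [lintegral_const_mul _ (by fun_prop), lintegral_heatK hσ, mul_one]
  have hB : ∫⁻ p : Space d × Space d, ‖a p.2‖ₑ ^ 2 * ‖heatK σ (p.2 - p.1)‖ₑ =
      ∫⁻ z, ‖a z‖ₑ ^ 2 := by
    rw [Measure.volume_eq_prod, lintegral_prod_symm _ (by fun_prop)]
    refine lintegral_congr fun z => ?_
    simp only
    rw [lintegral_const_mul _ (by fun_prop), lintegral_heatK hσ, mul_one]
  refine (lintegral_mono hpt).trans ?_
  rw [lintegral_add_left (by fun_prop), lintegral_const_mul _ (by fun_prop),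
    lintegral_const_mul _ (by fun_prop), hA, hB, ← add_mul, ENNReal.inv_two_add_inv_two, one_mul]

/-- By the heat equation the left side is `⟨a, K_ε a⟩ - ⟨a, K_R a⟩`; estimating both terms in
absolute value gives the factor 2. Integrability of `a` is used only to exchange integrals, where
the kernel is bounded because `σ ≥ ε`. -/
lemma setLIntegral_dissip_Icc_le {d : ℕ} {a : Space d → ℝ} (ham : Measurable a)
    (ha : Integrable a) {ε R : ℝ} (hε : 0 < ε) (hεR : ε ≤ R) :
    ∫⁻ σ in Ioc ε R, dissip a σ ≤ 2 * ∫⁻ z, ‖a z‖ₑ ^ 2 := by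
  have hR := hε.trans_le hεR
  set G : ℝ → Space d × Space d → ℝ := fun σ p =>
    -(a p.1 * (∑ i, heatK2 i i σ (p.1 - p.2)) * a p.2) with hG
  have hGm : Measurable (Function.uncurry G) := by
    have : Measurable fun q : ℝ × (Space d × Space d) =>
        ∑ i, heatK2 i i q.1 (q.2.1 - q.2.2) := by fun_prop
    simp only [hG, Function.uncurry_def]
    fun_prop
  have hGint : Integrable (Function.uncurry G) ((volume.restrict (Ioc ε R)).prod volume) := by
    have h1 : Integrable (fun p : Space d × Space d => a p.1 * a p.2) (volume.prod volume) :=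
      ha.mul_prod ha
    have h2 : Integrable (fun q : ℝ × (Space d × Space d) => (1 : ℝ) * (a q.2.1 * a q.2.2))
        ((volume.restrict (Ioc ε R)).prod (volume.prod volume)) :=
      Integrable.mul_prod (integrable_const (1 : ℝ)) h1
    have h3 := h2.const_mul (d * (3 * (ε ^ (-1 : ℝ) * ε ^ (-((d : ℝ) / 2)))))
    refine h3.mono hGm.aestronglyMeasurable ?_
    rw [Measure.restrict_prod_eq_prod_univ]
    refine (ae_restrict_iff' (measurableSet_Ioc.prod MeasurableSet.univ)).2
      (ae_of_all _ fun q hq => ?_)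
    have hb := abs_sum_heatK2_le hε hq.1.1.le (q.2.1 - q.2.2)
    simp only [hG, Function.uncurry_def, norm_neg, norm_mul]
    rw [mul_right_comm, mul_comm, norm_one, one_mul]
    gcongr
    refine hb.trans ?_
    rw [← norm_mul, ← norm_mul, ← norm_mul]
    exact le_abs_self _
  have h1 : ∫⁻ σ in Ioc ε R, dissip a σ = ENNReal.ofReal (∫ σ in Ioc ε R, ∫ p, G σ p) := by
    have hGl : Integrable (fun σ => ∫ p, G σ p) (volume.restrict (Ioc ε R)) :=
      hGint.integral_prod_left
    rw [ofReal_integral_eq_lintegral_ofReal hGl]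
    · refine setLIntegral_congr_fun measurableSet_Ioc fun σ hσ => ?_
      exact (dissip_eq ha (hε.trans hσ.1)).2
    · refine (ae_restrict_iff' measurableSet_Ioc).2 (ae_of_all _ fun σ hσ => ?_)
      exact (dissip_eq ha (hε.trans hσ.1)).1
  have h2 : ∀ p, ∫ σ in Ioc ε R, G σ p =
      a p.1 * heatK ε (p.1 - p.2) * a p.2 - a p.1 * heatK R (p.1 - p.2) * a p.2 := by
    intro p
    rw [← intervalIntegral.integral_of_le hεR]
    rw [intervalIntegral.integral_eq_sub_of_hasDerivAt
      (f := fun σ => -(a p.1 * heatK σ (p.1 - p.2) * a p.2))]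
    · ring
    · intro σ hσ
      rw [uIcc_of_le hεR] at hσ
      exact (((hasDerivAt_heatK (hε.trans_le hσ.1) (p.1 - p.2)).const_mul (a p.1)).mul_const
        (a p.2)).fun_neg
    · rw [intervalIntegrable_iff_integrableOn_Ioc_of_le hεR]
      have hm : Measurable fun σ => G σ p := hGm.comp (measurable_id.prodMk measurable_const)
      refine Measure.integrableOn_of_bounded (M := ‖a p.1‖ *
        (d * (3 * (ε ^ (-1 : ℝ) * ε ^ (-((d : ℝ) / 2))))) * ‖a p.2‖) (by simp)
        hm.aestronglyMeasurable ?_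
      refine (ae_restrict_iff' measurableSet_Ioc).2 (ae_of_all _ fun σ hσ => ?_)
      simp only [hG, norm_neg, norm_mul]
      gcongr
      exact abs_sum_heatK2_le hε hσ.1.le _
  rw [h1, integral_integral_swap hGint]
  simp only [h2]
  refine (ENNReal.ofReal_le_ofReal (le_abs_self _)).trans ?_
  rw [← Real.enorm_eq_ofReal_abs]
  refine (enorm_integral_le_lintegral_enorm _).trans ?_
  refine (lintegral_mono fun p => enorm_sub_le).trans ?_
  rw [lintegral_add_left (by fun_prop), two_mul]
  exact add_le_add (lintegral_heatK_form_le ham hε) (lintegral_heatK_form_le ham hR)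

lemma measurable_dissip {d : ℕ} {Ω : Type*} [MeasurableSpace Ω] {a : Ω → Space d → ℝ}
    {σ : Ω → ℝ} (ha : Measurable (Function.uncurry a)) (hσ : Measurable σ) :
    Measurable fun ω => dissip (a ω) (σ ω) := by
  unfold dissip
  refine Finset.measurable_sum _ fun i _ => ?_
  have h1 : Measurable fun q : (Ω × Space d) × Space d =>
      heatK1 i (σ q.1.1 / 2) (q.1.2 - q.2) * a q.1.1 q.2 := by
    have h2 : Measurable fun q : (Ω × Space d) × Space d => a q.1.1 q.2 :=
      ha.comp (by fun_prop : Measurable fun q : (Ω × Space d) × Space d => (q.1.1, q.2))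
    fun_prop
  have h3 : Measurable fun q : Ω × Space d => gradConv i (σ q.1 / 2) (a q.1) q.2 :=
    h1.stronglyMeasurable.integral_prod_right'.measurable
  exact (h3.enorm.pow_const 2).lintegral_prod_right'

/-- The energy estimate: the dissipation is controlled by the `L²` norm. -/
lemma setLIntegral_dissip_le {d : ℕ} {a : Space d → ℝ} (ham : Measurable a)
    (ha : Integrable a) : ∫⁻ σ in Ioi 0, dissip a σ ≤ 2 * ∫⁻ z, ‖a z‖ₑ ^ 2 := by
  -- A monotone exhaustion by intervals that stay away from `0` and `∞`.
  have hU : Ioi (0 : ℝ) = ⋃ n : ℕ, Ioc (1 / ((n : ℝ) + 1)) (n + 1) := by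
    ext x
    simp only [mem_Ioi, mem_iUnion, mem_Ioc]
    constructor
    · intro hx
      obtain ⟨n, hn⟩ := exists_nat_one_div_lt hx
      obtain ⟨m, hm⟩ := exists_nat_ge x
      refine ⟨max n m, ?_, ?_⟩
      · refine lt_of_le_of_lt ?_ hn
        gcongr
        exact le_max_left _ _
      · have : (m : ℝ) ≤ (max n m : ℕ) := by exact_mod_cast le_max_right _ _
        linarith
    · rintro ⟨n, hn, -⟩
      exact lt_trans (by positivity) hn
  rw [hU, setLIntegral_iUnion_of_directed]
  · refine iSup_le fun n => setLIntegral_dissip_Icc_le ham ha (by positivity) ?_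
    rw [div_le_iff₀ (by positivity)]
    nlinarith [(Nat.cast_nonneg n : (0 : ℝ) ≤ n)]
  · refine Monotone.directed_le fun m n hmn => Ioc_subset_Ioc ?_ ?_
    · gcongr
    · gcongr

lemma setLIntegral_dissip_mul_le {d : ℕ} {a : Space d → ℝ} (ham : Measurable a)
    (ha : Integrable a) {ν : ℝ} (hν : 0 < ν) :
    ∫⁻ s in Ioi 0, dissip a (ν * s) ≤ ENNReal.ofReal (2 * ν⁻¹) * ∫⁻ z, ‖a z‖ₑ ^ 2 := by
  have hm : Measurable fun s => dissip a s :=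
    measurable_dissip (a := fun _ : ℝ => a) (ham.comp measurable_snd) measurable_id
  have e : ∫⁻ s in Ioi 0, dissip a (ν * s) = ENNReal.ofReal ν⁻¹ * ∫⁻ σ in Ioi 0, dissip a σ := by
    rw [← lintegral_indicator measurableSet_Ioi, ← lintegral_indicator measurableSet_Ioi]
    have h1 : ∀ s, (Ioi (0 : ℝ)).indicator (fun s => dissip a (ν * s)) s =
        (Ioi (0 : ℝ)).indicator (fun s => dissip a s) (ν * s) := fun s => by
      simp only [indicator, mem_Ioi, mul_pos_iff_of_pos_left hν]
    rw [lintegral_congr h1]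
    rw [← lintegral_map (f := fun x => (Ioi (0 : ℝ)).indicator (fun s => dissip a s) x)
      (g := fun s => ν * s) (hm.indicator measurableSet_Ioi) (by fun_prop),
      Real.map_volume_mul_left hν.ne', lintegral_smul_measure, abs_of_pos (by positivity)]
    rfl
  rw [e, mul_comm 2, ENNReal.ofReal_mul (by positivity), mul_assoc]
  gcongr
  simpa using setLIntegral_dissip_le ham ha

/-! ### The bilinear time integral -/

/-- Hölder's inequality for `F²` with exponent `q/2`, whose dual exponent is `1/μ`; here `q > 2`
ensures `μ > 0`. What remains is a beta integral with `x = c/μ`. -/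
lemma lintegral_sq_mul_pw_le {q : ℝ≥0∞} (hq : 2 < q) {F : ℝ → ℝ≥0∞} (hF : Measurable F)
    {c μ α : ℝ} (hμ : μ = 1 - 2 * (q⁻¹).toReal) (hc : 0 < c) (hα : 0 ≤ α) (a b : ℝ) :
    ∫⁻ s, F s ^ 2 * (pw (c - μ) (s - a) * pw α (b - s)) ≤
      ENNReal.ofReal ((3 * μ / c) ^ μ * 2 ^ c * (c / (c + α)) ^ c) * pw (c + α) (b - a) *
        eLpNorm F q volume ^ 2 := by
  have hq2 : (q⁻¹).toReal < 1 / 2 := by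
    have h1 : q⁻¹ < 2⁻¹ := ENNReal.inv_lt_inv.2 hq
    have h2 := (ENNReal.toReal_lt_toReal (ne_top_of_lt h1) (by simp)).2 h1
    simpa using h2
  have hμ0 : 0 < μ := by linarith
  have hH := lintegral_rpow_mul_le (μ := volume) hF
    (g := fun s => pw (c - μ) (s - a) * pw α (b - s)) (by fun_prop) (p := q) two_pos
    (by linarith) (zero_lt_two.trans hq).ne'
  rw [← hμ] at hH
  simp only [ENNReal.rpow_two] at hH
  refine hH.trans ?_
  rw [mul_comm]
  gcongr
  set x := c / μ with hx
  have hx0 : 0 < x := by positivity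
  have hpow : ∀ s, (pw (c - μ) (s - a) * pw α (b - s)) ^ μ⁻¹ =
      pw (x - 1) (s - a) * pw (α * μ⁻¹) (b - a - (s - a)) := fun s => by
    rw [ENNReal.mul_rpow_of_nonneg _ _ (inv_nonneg.2 hμ0.le), pw_rpow (inv_pos.2 hμ0),
      pw_rpow (inv_pos.2 hμ0), sub_sub_sub_cancel_right]
    congr 2; rw [hx]; field_simp
  rw [lintegral_congr hpow,
    lintegral_sub_right_eq_self (fun v => pw (x - 1) v * pw (α * μ⁻¹) (b - a - v)) a]
  have hx1 : x * μ = c := by rw [hx]; field_simp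
  calc _ ≤ (ENNReal.ofReal (3 / x * 2 ^ x * (x / (x + α * μ⁻¹)) ^ x) *
        pw (x + α * μ⁻¹) (b - a)) ^ μ := by
        gcongr
        exact lintegral_beta_le hx0 (by positivity) _
    _ = _ := by
        rw [ENNReal.mul_rpow_of_nonneg _ _ hμ0.le, pw_rpow hμ0,
          ENNReal.ofReal_rpow_of_nonneg (by positivity) hμ0.le, Real.mul_rpow (by positivity)
          (by positivity), Real.mul_rpow (by positivity) (by positivity), ← Real.rpow_mul
          (by positivity), ← Real.rpow_mul (by positivity), hx1]
        congr 4
        · rw [hx]; field_simp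
        · rw [hx]; field_simp
        · rw [hx]; field_simp

/-- Minkowski's integral inequality in `L²`. -/
lemma lintegral_sq_lintegral_le {U V : Type*} [MeasurableSpace U] [MeasurableSpace V]
    {μ : Measure U} [SFinite μ] {ρ : Measure V} [SFinite ρ] {X : U → V → ℝ≥0∞}
    (hX : Measurable (Function.uncurry X)) {N : U → ℝ≥0∞} (hN : Measurable N)
    (h : ∀ u, ∫⁻ v, X u v ^ 2 ∂ρ ≤ N u ^ 2) :
    ∫⁻ v, (∫⁻ u, X u v ∂μ) ^ 2 ∂ρ ≤ (∫⁻ u, N u ∂μ) ^ 2 := by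
  have hXu : ∀ u, Measurable (X u) := fun u => hX.comp measurable_prodMk_left
  have hXv : ∀ v, Measurable fun u => X u v := fun v => hX.comp measurable_prodMk_right
  -- Expanding the square of the inner integral reduces the claim to Cauchy–Schwarz for each pair
  -- `u, u'`.
  have hcs : ∀ u u', ∫⁻ v, X u v * X u' v ∂ρ ≤ N u * N u' := by
    intro u u'
    have := ENNReal.lintegral_mul_le_Lp_mul_Lq ρ Real.HolderConjugate.two_two
      (hXu u).aemeasurable (hXu u').aemeasurable
    refine this.trans ?_
    have hsq : ∀ u, (∫⁻ v, X u v ^ (2 : ℝ) ∂ρ) ^ (1 / 2 : ℝ) ≤ N u := fun u => by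
      simp only [ENNReal.rpow_two]
      calc _ ≤ (N u ^ 2) ^ (1 / 2 : ℝ) := by gcongr; exact h u
        _ = N u := by
          rw [← ENNReal.rpow_two, ← ENNReal.rpow_mul]; norm_num
    gcongr
    · exact hsq u
    · exact hsq u'
  calc ∫⁻ v, (∫⁻ u, X u v ∂μ) ^ 2 ∂ρ
      = ∫⁻ v, ∫⁻ u, ∫⁻ u', X u v * X u' v ∂μ ∂μ ∂ρ := by
        refine lintegral_congr fun v => ?_
        rw [pow_two, ← lintegral_mul_const _ (hXv v)]
        refine lintegral_congr fun u => ?_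
        rw [← lintegral_const_mul _ (hXv v)]
    _ = ∫⁻ u, ∫⁻ v, ∫⁻ u', X u v * X u' v ∂μ ∂ρ ∂μ := by
        rw [lintegral_lintegral_swap]
        have h1 : Measurable fun p : (V × U) × U => X p.1.2 p.1.1 * X p.2 p.1.1 :=
          (hX.comp (by fun_prop : Measurable fun p : (V × U) × U => (p.1.2, p.1.1))).mul
            (hX.comp (by fun_prop : Measurable fun p : (V × U) × U => (p.2, p.1.1)))
        exact h1.lintegral_prod_right'.aemeasurable
    _ = ∫⁻ u, ∫⁻ u', ∫⁻ v, X u v * X u' v ∂ρ ∂μ ∂μ := by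
        refine lintegral_congr fun u => ?_
        rw [lintegral_lintegral_swap]
        have h1 : Measurable fun p : V × U => X u p.1 * X p.2 p.1 :=
          ((hXu u).comp measurable_fst).mul (hX.comp measurable_swap)
        exact h1.aemeasurable
    _ ≤ ∫⁻ u, ∫⁻ u', N u * N u' ∂μ ∂μ := by
        gcongr with u u'
        exact hcs u u'
    _ = _ := by
        rw [pow_two, ← lintegral_mul_const _ hN]
        refine lintegral_congr fun u => ?_
        rw [← lintegral_const_mul _ hN]

/-- Where the last gap is at most the elapsed time before it, the elapsed times at the last two
points are comparable. Powers can then be moved from one to the other at bounded cost. -/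
lemma one_le_pw_mul_pw {ρ S S' : ℝ} (hS : 0 < S) (h1 : S ≤ S') (h2 : S' ≤ 2 * S) :
    1 ≤ ENNReal.ofReal (2 ^ |ρ|) * (pw ρ S * pw (-ρ) S') := by
  have hS' : 0 < S' := hS.trans_le h1
  rw [pw_of_pos hS, pw_of_pos hS', ← ENNReal.ofReal_mul (by positivity),
    ← ENNReal.ofReal_mul (by positivity), ENNReal.one_le_ofReal, Real.rpow_neg hS'.le,
    ← div_eq_mul_inv, ← Real.div_rpow hS.le hS'.le]
  rcases le_or_gt 0 ρ with h | h
  · rw [abs_of_nonneg h, ← Real.mul_rpow (by norm_num) (by positivity)]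
    refine Real.one_le_rpow ?_ h
    rw [mul_div_assoc', le_div_iff₀ hS']; linarith
  · have e1 : (1 : ℝ) ≤ 2 ^ |ρ| := Real.one_le_rpow (by norm_num) (abs_nonneg _)
    have e2 : 1 ≤ (S / S') ^ ρ := by
      refine Real.one_le_rpow_of_pos_of_le_one_of_nonpos (by positivity) ?_ h.le
      rw [div_le_one hS']; exact h1
    nlinarith

/-- The indicator of `{0 < s}`. -/
def posInd (s : ℝ) : ℝ≥0∞ := if 0 < s then 1 else 0

@[fun_prop]
lemma Measurable.posInd {α : Type*} [MeasurableSpace α] {g : α → ℝ} (hg : Measurable g) :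
    Measurable fun x => posInd (g x) :=
  Measurable.ite (measurableSet_lt measurable_const hg) measurable_const measurable_const

lemma lintegral_posInd_mul (f : ℝ → ℝ≥0∞) :
    ∫⁻ s, posInd s * f s = ∫⁻ s in Ioi 0, f s := by
  rw [← lintegral_indicator measurableSet_Ioi]
  refine lintegral_congr fun s => ?_
  by_cases h : 0 < s <;> simp [posInd, indicator, h]

lemma posInd_sq (s : ℝ) : posInd s ^ 2 = posInd s := by
  unfold posInd; split_ifs <;> simp

lemma posInd_mul_self (s : ℝ) : posInd s * posInd s = posInd s := by
  rw [← pow_two, posInd_sq]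

lemma pw_mul_self (A v : ℝ) : pw A v ^ 2 = pw (2 * A) v := by
  rw [pow_two, pw_mul_pw, two_mul]

/-- Cauchy–Schwarz in `(τ, θ)` jointly. The factor with `X` carries weights in `τ`, so `θ` is
integrated first; the factor with `Y` carries weights in `θ`, so `τ` is integrated first. In both
cases the inner variable is the gap. The power `(b-θ)^α` is shared equally, using `b - θ ≤ b - τ`,
and `ρ` is free to rebalance the elapsed times. -/
lemma lintegral_bilinear_le {X Y : ℝ → ℝ → ℝ≥0∞} (hX : Measurable (Function.uncurry X))
    (hY : Measurable (Function.uncurry Y)) {N M : ℝ → ℝ≥0∞}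
    (hXN : ∀ τ, ∫⁻ s in Ioi 0, X τ s ^ 2 ≤ N τ ^ 2)
    (hYM : ∀ θ, ∫⁻ s in Ioi 0, Y θ s ^ 2 ≤ M θ ^ 2) {α : ℝ} (hα : 0 ≤ α) (ρ a b : ℝ) :
    ∫⁻ τ, ∫⁻ θ, (if θ - τ ≤ τ - a then posInd (θ - τ) * (X τ (θ - τ) * Y θ (θ - τ)) else 0) *
        pw α (b - θ) ≤
      ENNReal.ofReal (2 ^ |ρ|) *
        ((∫⁻ τ, N τ ^ 2 * (pw (2 * ρ) (τ - a) * pw α (b - τ))) ^ (1 / 2 : ℝ) *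
        (∫⁻ θ, M θ ^ 2 * (pw (2 * -ρ) (θ - a) * pw α (b - θ))) ^ (1 / 2 : ℝ)) := by
  have hX' : ∀ {Ω : Type} [MeasurableSpace Ω] {f g : Ω → ℝ}, Measurable f → Measurable g →
      Measurable fun ω => X (f ω) (g ω) := fun hf hg => hX.comp (hf.prodMk hg)
  have hY' : ∀ {Ω : Type} [MeasurableSpace Ω] {f g : Ω → ℝ}, Measurable f → Measurable g →
      Measurable fun ω => Y (f ω) (g ω) := fun hf hg => hY.comp (hf.prodMk hg)
  set A : ℝ × ℝ → ℝ≥0∞ := fun p => posInd (p.2 - p.1) *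
    (X p.1 (p.2 - p.1) * (pw ρ (p.1 - a) * pw (α / 2) (b - p.1))) with hA
  set B : ℝ × ℝ → ℝ≥0∞ := fun p => posInd (p.2 - p.1) *
    (Y p.2 (p.2 - p.1) * (pw (-ρ) (p.2 - a) * pw (α / 2) (b - p.2))) with hB
  have hAm : Measurable A := by
    have := hX' (Ω := ℝ × ℝ) (f := fun p => p.1) (g := fun p => p.2 - p.1) (by fun_prop)
      (by fun_prop)
    fun_prop
  have hBm : Measurable B := by
    have := hY' (Ω := ℝ × ℝ) (f := fun p => p.2) (g := fun p => p.2 - p.1) (by fun_prop)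
      (by fun_prop)
    fun_prop
  have hpt : ∀ τ θ, (if θ - τ ≤ τ - a then posInd (θ - τ) * (X τ (θ - τ) * Y θ (θ - τ)) else 0) *
        pw α (b - θ) ≤ ENNReal.ofReal (2 ^ |ρ|) * (A (τ, θ) * B (τ, θ)) := by
    intro τ θ
    by_cases h1 : θ - τ ≤ τ - a
    swap
    · simp [h1]
    by_cases h2 : 0 < θ - τ
    swap
    · simp [posInd, h2]
    have hS : 0 < τ - a := h2.trans_le h1
    rw [if_pos h1]
    have e1 : pw α (b - θ) ≤ pw (α / 2) (b - τ) * pw (α / 2) (b - θ) := by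
      rcases le_or_gt (b - θ) 0 with h3 | h3
      · simp [pw_of_nonpos h3]
      · have h4 : 0 < b - τ := by linarith
        rw [← add_halves α, ← pw_mul_pw, add_halves]
        gcongr
        rw [pw_of_pos h3, pw_of_pos h4]
        exact ENNReal.ofReal_le_ofReal (Real.rpow_le_rpow h3.le (by linarith) (by positivity))
    have e2 := one_le_pw_mul_pw (ρ := ρ) hS (by linarith : τ - a ≤ θ - a) (by linarith)
    calc _ = posInd (θ - τ) * (X τ (θ - τ) * Y θ (θ - τ)) * (1 * pw α (b - θ)) := by
          rw [one_mul]
      _ ≤ posInd (θ - τ) * (X τ (θ - τ) * Y θ (θ - τ)) *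
          (ENNReal.ofReal (2 ^ |ρ|) * (pw ρ (τ - a) * pw (-ρ) (θ - a)) *
            (pw (α / 2) (b - τ) * pw (α / 2) (b - θ))) := by gcongr
      _ = _ := by
          simp only [hA, hB]
          nth_rewrite 1 [← posInd_mul_self]
          ring
  have hA2 : ∫⁻ p, A p ^ (2 : ℝ) ∂(volume.prod volume) ≤
      ∫⁻ τ, N τ ^ 2 * (pw (2 * ρ) (τ - a) * pw α (b - τ)) := by
    simp only [ENNReal.rpow_two]
    rw [lintegral_prod _ (by fun_prop)]
    refine lintegral_mono fun τ => ?_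
    simp only [hA, mul_pow, posInd_sq, pw_mul_self, mul_div_cancel₀ α (two_ne_zero' ℝ)]
    have hXτ : Measurable fun θ => X τ (θ - τ) ^ 2 :=
      (hX' measurable_const (by fun_prop)).pow_const 2
    calc _ = (∫⁻ θ, posInd (θ - τ) * X τ (θ - τ) ^ 2) * (pw (2 * ρ) (τ - a) * pw α (b - τ)) := by
          rw [← lintegral_mul_const _ (by fun_prop)]
          refine lintegral_congr fun θ => ?_
          ring
      _ ≤ _ := by
          gcongr
          rw [lintegral_sub_right_eq_self (fun s => posInd s * X τ s ^ 2) τ, lintegral_posInd_mul]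
          exact hXN τ
  have hB2 : ∫⁻ p, B p ^ (2 : ℝ) ∂(volume.prod volume) ≤
      ∫⁻ θ, M θ ^ 2 * (pw (2 * -ρ) (θ - a) * pw α (b - θ)) := by
    simp only [ENNReal.rpow_two]
    rw [lintegral_prod_symm _ (by fun_prop)]
    refine lintegral_mono fun θ => ?_
    simp only [hB, mul_pow, posInd_sq, pw_mul_self, mul_div_cancel₀ α (two_ne_zero' ℝ)]
    have hYθ : Measurable fun τ => Y θ (θ - τ) ^ 2 :=
      (hY' measurable_const (by fun_prop)).pow_const 2
    calc _ = (∫⁻ τ, posInd (θ - τ) * Y θ (θ - τ) ^ 2) *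
            (pw (2 * -ρ) (θ - a) * pw α (b - θ)) := by
          rw [← lintegral_mul_const _ (by fun_prop)]
          refine lintegral_congr fun τ => ?_
          ring
      _ ≤ _ := by
          gcongr
          rw [lintegral_sub_left_eq_self (fun s => posInd s * Y θ s ^ 2) θ, lintegral_posInd_mul]
          exact hYM θ
  calc _ ≤ ∫⁻ τ, ∫⁻ θ, ENNReal.ofReal (2 ^ |ρ|) * (A (τ, θ) * B (τ, θ)) := by
        exact lintegral_mono fun τ => lintegral_mono fun θ => hpt τ θ
    _ = ENNReal.ofReal (2 ^ |ρ|) * ∫⁻ p, (A * B) p ∂(volume.prod volume) := by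
        rw [← lintegral_const_mul _ (by fun_prop), lintegral_prod _ (by fun_prop)]
        rfl
    _ ≤ ENNReal.ofReal (2 ^ |ρ|) * ((∫⁻ p, A p ^ (2 : ℝ) ∂(volume.prod volume)) ^ (1 / 2 : ℝ) *
          (∫⁻ p, B p ^ (2 : ℝ) ∂(volume.prod volume)) ^ (1 / 2 : ℝ)) := by
        gcongr
        exact ENNReal.lintegral_mul_le_Lp_mul_Lq _ Real.HolderConjugate.two_two
          hAm.aemeasurable hBm.aemeasurable
    _ ≤ _ := by gcongr

lemma lintegral_sq_bound {q : ℝ≥0∞} (hq : 2 < q) {F N : ℝ → ℝ≥0∞} (hF : Measurable F)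
    {c μ α β ρ : ℝ} (hμ : μ = 1 - 2 * (q⁻¹).toReal) (hc : 0 < c) (hα : 0 ≤ α) (a b : ℝ)
    {K : ℝ≥0∞} (hN : ∀ τ, N τ ≤ K * F τ * pw β (τ - a)) (hβ : 2 * β + 2 * ρ = c - μ) :
    (∫⁻ τ, N τ ^ 2 * (pw (2 * ρ) (τ - a) * pw α (b - τ))) ^ (1 / 2 : ℝ) ≤
      K * eLpNorm F q volume * (ENNReal.ofReal ((3 * μ / c) ^ μ * 2 ^ c * (c / (c + α)) ^ c) *
        pw (c + α) (b - a)) ^ (1 / 2 : ℝ) := by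
  have h1 : ∫⁻ τ, N τ ^ 2 * (pw (2 * ρ) (τ - a) * pw α (b - τ)) ≤
      (K * eLpNorm F q volume) ^ 2 * (ENNReal.ofReal ((3 * μ / c) ^ μ * 2 ^ c * (c / (c + α)) ^ c) *
        pw (c + α) (b - a)) := by
    calc _ ≤ ∫⁻ τ, K ^ 2 * (F τ ^ 2 * (pw (c - μ) (τ - a) * pw α (b - τ))) := by
          refine lintegral_mono fun τ => ?_
          calc _ ≤ (K * F τ * pw β (τ - a)) ^ 2 * (pw (2 * ρ) (τ - a) * pw α (b - τ)) := by
                gcongr; exact hN τ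
            _ = _ := by
                rw [mul_pow, mul_pow, pw_mul_self, ← hβ, ← pw_mul_pw]; ring
      _ = K ^ 2 * ∫⁻ τ, F τ ^ 2 * (pw (c - μ) (τ - a) * pw α (b - τ)) :=
          lintegral_const_mul _ (by fun_prop)
      _ ≤ K ^ 2 * (ENNReal.ofReal ((3 * μ / c) ^ μ * 2 ^ c * (c / (c + α)) ^ c) *
            pw (c + α) (b - a) * eLpNorm F q volume ^ 2) := by
          gcongr
          exact lintegral_sq_mul_pw_le hq hF hμ hc hα a b
      _ = _ := by ring
  calc _ ≤ ((K * eLpNorm F q volume) ^ 2 *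
        (ENNReal.ofReal ((3 * μ / c) ^ μ * 2 ^ c * (c / (c + α)) ^ c) *
        pw (c + α) (b - a))) ^ (1 / 2 : ℝ) := by gcongr
    _ = _ := by
        rw [ENNReal.mul_rpow_of_nonneg _ _ (by norm_num), ← ENNReal.rpow_two,
          ← ENNReal.rpow_mul]
        norm_num

/-- The time integral of the main term, with powers of the elapsed time as bounds. -/
lemma lintegral_bilinear_pw_le {q : ℝ≥0∞} (hq : 2 < q) {X Y : ℝ → ℝ → ℝ≥0∞}
    (hX : Measurable (Function.uncurry X)) (hY : Measurable (Function.uncurry Y))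
    {N M F F' : ℝ → ℝ≥0∞}
    (hF : Measurable F) (hF' : Measurable F')
    (hXN : ∀ τ, ∫⁻ s in Ioi 0, X τ s ^ 2 ≤ N τ ^ 2)
    (hYM : ∀ θ, ∫⁻ s in Ioi 0, Y θ s ^ 2 ≤ M θ ^ 2)
    {c μ α β β' : ℝ} (hμ : μ = 1 - 2 * (q⁻¹).toReal) (hc : 0 < c) (hα : 0 ≤ α) (a b : ℝ)
    {K K' : ℝ≥0∞} (hNF : ∀ τ, N τ ≤ K * F τ * pw β (τ - a))
    (hMF : ∀ θ, M θ ≤ K' * F' θ * pw β' (θ - a)) (hβ : β + β' = c - μ) :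
    ∫⁻ τ, ∫⁻ θ, (if θ - τ ≤ τ - a then posInd (θ - τ) * (X τ (θ - τ) * Y θ (θ - τ)) else 0) *
        pw α (b - θ) ≤
      ENNReal.ofReal (2 ^ (|β' - β| / 2)) * (K * K') *
        ENNReal.ofReal ((3 * μ / c) ^ μ * 2 ^ c * (c / (c + α)) ^ c) * pw (c + α) (b - a) *
        (eLpNorm F q volume * eLpNorm F' q volume) := by
  -- The choice `ρ = (β' - β)/2` gives the elapsed time the same exponent `β + β' = c - μ` in both
  -- squares, however negative `β` or `β'` may be.
  refine (lintegral_bilinear_le hX hY hXN hYM hα ((β' - β) / 2) a b).trans ?_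
  have h1 := lintegral_sq_bound (ρ := (β' - β) / 2) hq hF hμ hc hα a b hNF (by linarith)
  have h2 := lintegral_sq_bound (ρ := -((β' - β) / 2)) hq hF' hμ hc hα a b hMF (by linarith)
  set Z := ENNReal.ofReal ((3 * μ / c) ^ μ * 2 ^ c * (c / (c + α)) ^ c) * pw (c + α) (b - a)
    with hZ
  have hZZ : Z ^ (1 / 2 : ℝ) * Z ^ (1 / 2 : ℝ) = Z := by
    rw [← ENNReal.rpow_add_of_nonneg _ _ (by norm_num) (by norm_num)]; norm_num
  rw [abs_div, abs_of_pos (two_pos : (0 : ℝ) < 2)]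
  calc _ ≤ ENNReal.ofReal (2 ^ (|β' - β| / 2)) * ((K * eLpNorm F q volume * Z ^ (1 / 2 : ℝ)) *
        (K' * eLpNorm F' q volume * Z ^ (1 / 2 : ℝ))) := by gcongr
    _ = ENNReal.ofReal (2 ^ (|β' - β| / 2)) * (K * K') * (Z ^ (1 / 2 : ℝ) * Z ^ (1 / 2 : ℝ)) *
        (eLpNorm F q volume * eLpNorm F' q volume) := by ring
    _ = _ := by rw [hZZ, hZ]; ring

/-! ### Bounds for the constants -/

lemma rpow_self_pos {x : ℝ} (hx : 0 ≤ x) : 0 < x ^ x := by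
  rcases hx.eq_or_lt with rfl | h
  · simp
  · positivity

lemma gammaFactor_nonneg {k : ℕ} {δ α : ℝ} (hδ : 0 ≤ δ) (hα : 0 ≤ α) :
    0 ≤ gammaFactor k δ α := by
  unfold gammaFactor; positivity

lemma gammaFactor_zero {δ α : ℝ} (hα : 0 ≤ α) : gammaFactor 0 δ α = 1 := by
  simp [gammaFactor, (rpow_self_pos hα).ne']

/-- The telescoping property: `γ_k(α)` is a product of one-step factors whose parameters are the
successive exponents of the time integration. -/
lemma gammaFactor_succ {k : ℕ} {δ α : ℝ} (hδ : 0 ≤ δ) (hα : 0 ≤ α) :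
    gammaFactor (k + 1) δ α = gammaFactor k δ α * gammaFactor 1 δ (α + k * δ) := by
  have h : 0 < (α + k * δ) ^ (α + k * δ) := rpow_self_pos (by positivity)
  unfold gammaFactor
  push_cast
  rw [show α + (k + 1) * δ = α + k * δ + 1 * δ by ring]
  field_simp

/-- With `c = kδ` the claim is `(α+c)^α ≤ e^c α^α`, which follows from `(1 + c/α)^α ≤ e^c`. -/
lemma rpow_neg_le_gammaFactor {k : ℕ} {δ α : ℝ} (hδ : 0 < δ) (hk : 0 < k) (hα : 0 ≤ α) :
    (α + k * δ) ^ (-(k * δ)) ≤ Real.exp (k * δ) * gammaFactor k δ α := by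
  have hk' : (0 : ℝ) < k := by exact_mod_cast hk
  set c := k * δ with hc
  have hc0 : 0 < c := by positivity
  unfold gammaFactor
  rw [← hc]
  have hac : 0 < α + c := by positivity
  have key : (α + c) ^ α ≤ Real.exp c * α ^ α := by
    rcases hα.eq_or_lt with rfl | hα0
    · simp [hc0.le]
    · have h1 : (α + c) ^ α = (1 + c / α) ^ α * α ^ α := by
        rw [← Real.mul_rpow (by positivity) hα]; congr 1; field_simp
      rw [h1]
      gcongr
      have h2 : 1 + c / α ≤ Real.exp (c / α) := by
        linarith [Real.add_one_le_exp (c / α)]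
      calc (1 + c / α) ^ α ≤ Real.exp (c / α) ^ α :=
            Real.rpow_le_rpow (by positivity) h2 hα
        _ = _ := by rw [← Real.exp_mul]; congr 1; field_simp
  rw [Real.rpow_neg hac.le, Real.rpow_add hac, ← mul_div_assoc, inv_eq_one_div,
    div_le_div_iff₀ (by positivity) (by positivity)]
  have : 0 < (α + c) ^ c := by positivity
  nlinarith

lemma prod_step_le {δ C : ℝ} (hδ : 0 < δ) (hδ2 : δ ≤ 2) (hC : 0 ≤ C) {α : ℝ} (hα : 0 ≤ α) (k : ℕ) :
    ∏ j ∈ Finset.range k, C * (α + j * δ + 2) ^ (-δ) ≤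
      (C * Real.exp δ) ^ k * gammaFactor k δ α := by
  induction k with
  | zero => simp [gammaFactor_zero hα]
  | succ k ih =>
    rw [Finset.prod_range_succ, gammaFactor_succ hδ.le hα]
    have hA : 0 ≤ α + k * δ := by positivity
    have h1 : (α + k * δ + 2) ^ (-δ) ≤ Real.exp δ * gammaFactor 1 δ (α + k * δ) := by
      have h2 := rpow_neg_le_gammaFactor hδ one_pos hA
      simp only [Nat.cast_one, one_mul] at h2
      refine le_trans ?_ h2
      exact Real.rpow_le_rpow_of_nonpos (by positivity) (by linarith) (by linarith)
    calc _ ≤ (C * Real.exp δ) ^ k * gammaFactor k δ α *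
          (C * (Real.exp δ * gammaFactor 1 δ (α + k * δ))) := by
          have := gammaFactor_nonneg (k := k) hδ.le hα
          gcongr
      _ = _ := by ring

/-- A crude form of Stirling's formula: `m^m ≤ e^m m!` for `m = n + 2`, together with `(n+2)! ≤
4^(n+2) n!`. -/
lemma factorial_rpow_neg_le {δ : ℝ} (hδ : 0 ≤ δ) (n : ℕ) :
    ((n.factorial : ℝ)) ^ (-δ) ≤
      (4 * Real.exp 1) ^ ((n + 2 : ℕ) * δ) * ((n + 2 : ℕ) : ℝ) ^ (-((n + 2 : ℕ) * δ)) := by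
  have hf : (0 : ℝ) < n.factorial := by exact_mod_cast n.factorial_pos
  have h1 : ((n + 2 : ℕ) : ℝ) ^ (n + 2) ≤ Real.exp 1 ^ (n + 2) * (n + 2).factorial := by
    have := Real.pow_div_factorial_le_exp ((n + 2 : ℕ) : ℝ) (by positivity) (n + 2)
    rw [div_le_iff₀ (by positivity)] at this
    rwa [← Real.exp_nat_mul, mul_one]
  have h2 : ((n + 2).factorial : ℝ) ≤ 4 ^ (n + 2) * n.factorial := by
    rw [Nat.factorial_succ, Nat.factorial_succ, ← mul_assoc]
    push_cast
    gcongr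
    have a1 : ((n + 1 + 1 : ℕ) : ℝ) ≤ 2 ^ (n + 2) := by
      exact_mod_cast (Nat.lt_two_pow_self (n := n + 2)).le
    have a2 : ((n + 1 : ℕ) : ℝ) ≤ 2 ^ (n + 2) :=
      le_trans (by push_cast; linarith) a1
    push_cast at a1 a2
    calc _ ≤ (2 : ℝ) ^ (n + 2) * 2 ^ (n + 2) := by gcongr
      _ = _ := by rw [← mul_pow]; norm_num
  set m : ℝ := ((n + 2 : ℕ) : ℝ) with hm
  have hm0 : 0 < m := by rw [hm]; positivity
  have h3 : m ^ (n + 2) ≤ (4 * Real.exp 1) ^ (n + 2) * n.factorial := by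
    refine h1.trans ?_
    rw [mul_pow]
    calc _ ≤ Real.exp 1 ^ (n + 2) * (4 ^ (n + 2) * n.factorial) := by gcongr
      _ = _ := by ring
  have h4 : (m ^ (n + 2)) ^ δ ≤ (4 * Real.exp 1) ^ (m * δ) * (n.factorial : ℝ) ^ δ := by
    calc _ ≤ ((4 * Real.exp 1) ^ (n + 2) * (n.factorial : ℝ)) ^ δ :=
          Real.rpow_le_rpow (by positivity) h3 hδ
      _ = _ := by
        rw [Real.mul_rpow (by positivity) hf.le, ← Real.rpow_natCast, ← Real.rpow_mul
          (by positivity)]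
  rw [← Real.rpow_natCast, ← Real.rpow_mul hm0.le] at h4
  rw [Real.rpow_neg hf.le, Real.rpow_neg hm0.le, ← div_eq_mul_inv, inv_eq_one_div,
    div_le_div_iff₀ (by positivity) (by positivity), one_mul]
  exact h4

/-- The chain inside the main term ends with exponent `-κ`. Since `-κ + jδ + 2 ≥ (j+1)δ`, its
one-step factors produce a factorial. -/
lemma prod_step_neg_le {δ κ C : ℝ} (hδ : 0 < δ) (hδ1 : δ ≤ 1) (hκ1 : κ ≤ 1) (hC : 0 ≤ C) (n : ℕ) :
    ∏ j ∈ Finset.range n, C * (-κ + j * δ + 2) ^ (-δ) ≤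
      C ^ n * (δ ^ (-(n * δ)) * (n.factorial : ℝ) ^ (-δ)) := by
  induction n with
  | zero => simp
  | succ n ih =>
    rw [Finset.prod_range_succ]
    have h1 : (-κ + n * δ + 2) ^ (-δ) ≤ δ ^ (-δ) * ((n + 1 : ℕ) : ℝ) ^ (-δ) := by
      rw [← Real.mul_rpow hδ.le (by positivity)]
      refine Real.rpow_le_rpow_of_nonpos (by positivity) ?_ (by linarith)
      push_cast; linarith
    calc _ ≤ C ^ n * (δ ^ (-(n * δ)) * (n.factorial : ℝ) ^ (-δ)) *
          (C * (δ ^ (-δ) * ((n + 1 : ℕ) : ℝ) ^ (-δ))) := by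
          have h0 : 0 ≤ -κ + n * δ + 2 := by
            have : 0 ≤ n * δ := by positivity
            linarith
          gcongr
      _ = C ^ (n + 1) * ((δ ^ (-(n * δ)) * δ ^ (-δ)) *
          (((n + 1 : ℕ) : ℝ) ^ (-δ) * (n.factorial : ℝ) ^ (-δ))) := by ring
      _ = _ := by
          rw [← Real.rpow_add hδ, ← Real.mul_rpow (by positivity) (by positivity),
            Nat.factorial_succ]
          push_cast
          congr 3; ring

/-- Let `c = (n+2)δ`. The inner chain supplies `n!^(-δ)`, comparable to `(n+2)^(-c)` up to a
geometric factor, and the last two times supply `(c/(c+α))^c`. The power of `n + 2` in `c^c`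
cancels, and the remaining `(c+α)^(-c)` is at most `e^c γ_{n+2}(α)`. -/
lemma exists_main_const (d : ℕ) {δ κ μ C : ℝ} (hδ : 0 < δ) (hδ1 : δ ≤ 1) (hκ1 : κ ≤ 1)
    (hμ : 0 < μ) (hμ1 : μ ≤ 1) (hC : 0 ≤ C) :
    ∃ K : ℝ, 0 < K ∧ ∀ (n : ℕ) (α : ℝ), 0 ≤ α →
      (∏ j ∈ Finset.range n, C * (-κ + j * δ + 2) ^ (-δ)) *
        (2 ^ (|(d : ℝ) / 2 - n * δ| / 2) * ((3 * μ / ((n + 2 : ℕ) * δ)) ^ μ *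
          2 ^ ((n + 2 : ℕ) * δ) *
          (((n + 2 : ℕ) * δ) / ((n + 2 : ℕ) * δ + α)) ^ ((n + 2 : ℕ) * δ))) ≤
        K ^ (n + 2) * gammaFactor (n + 2) δ α := by
  set E := Real.exp 1 with hE
  have hE1 : 1 ≤ E := Real.one_le_exp (by norm_num)
  -- The factors are the bases appearing in `f1`, `f2`, `f3`, `f4`, `f5` and `f6`.
  refine ⟨(C + 1) * (2 ^ (d + 1) * ((1 + 3 / δ) * (2 * (4 * E * E)))), by positivity, ?_⟩
  intro n α hα
  set m : ℝ := ((n + 2 : ℕ) : ℝ) with hm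
  have hm2 : 2 ≤ m := by rw [hm]; push_cast; linarith [(Nat.cast_nonneg n : (0 : ℝ) ≤ n)]
  set c := m * δ with hc
  have hc0 : 0 < c := by positivity
  have hcm : c ≤ m := by nlinarith
  have hγ := gammaFactor_nonneg (k := n + 2) hδ.le hα
  have hpow : ∀ {x : ℝ}, 1 ≤ x → x ^ c ≤ x ^ (n + 2) := fun {x} hx => by
    rw [← Real.rpow_natCast]
    exact Real.rpow_le_rpow_of_exponent_le hx (by rw [← hm]; exact hcm)
  have f1 : C ^ n ≤ (C + 1) ^ (n + 2) := by
    calc C ^ n ≤ (C + 1) ^ n := by gcongr; linarith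
      _ ≤ _ := pow_le_pow_right₀ (by linarith) (by omega)
  have f2 : (2 : ℝ) ^ (|(d : ℝ) / 2 - n * δ| / 2) ≤ (2 ^ (d + 1)) ^ (n + 2) := by
    rw [← pow_mul, ← Real.rpow_natCast]
    refine Real.rpow_le_rpow_of_exponent_le (by norm_num) ?_
    have : |(d : ℝ) / 2 - n * δ| ≤ d / 2 + n := by
      have hn : (0 : ℝ) ≤ n := by positivity
      have hd : (0 : ℝ) ≤ d := by positivity
      rw [abs_le]; constructor <;> nlinarith
    push_cast
    have hn : (0 : ℝ) ≤ n := by positivity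
    have hd : (0 : ℝ) ≤ d := by positivity
    nlinarith
  have f3 : (3 * μ / c) ^ μ ≤ (1 + 3 / δ) ^ (n + 2) := by
    have a1 : 3 * μ / c ≤ 1 + 3 / δ := by
      have : 3 * μ / c ≤ 3 / δ := by
        rw [div_le_div_iff₀ hc0 hδ, hc]; nlinarith
      linarith
    have a2 : 1 ≤ 1 + 3 / δ := by
      have : 0 ≤ 3 / δ := by positivity
      linarith
    calc (3 * μ / c) ^ μ ≤ (1 + 3 / δ) ^ μ := Real.rpow_le_rpow (by positivity) a1 hμ.le
      _ ≤ (1 + 3 / δ) ^ (1 : ℝ) := Real.rpow_le_rpow_of_exponent_le a2 hμ1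
      _ = (1 + 3 / δ) ^ 1 := by simp
      _ ≤ _ := pow_le_pow_right₀ a2 (by omega)
  have f4 : (2 : ℝ) ^ c ≤ 2 ^ (n + 2) := hpow (by norm_num)
  have f5 : (4 * E) ^ c ≤ (4 * E) ^ (n + 2) := hpow (by linarith)
  have f6 : Real.exp c ≤ E ^ (n + 2) := by
    rw [hE, ← Real.exp_nat_mul, mul_one, Real.exp_le_exp]; exact hcm
  have f7 := rpow_neg_le_gammaFactor (k := n + 2) hδ (by omega) hα
  rw [← hm, ← hc] at f7
  have f8 : δ ^ (-(n * δ)) * (n.factorial : ℝ) ^ (-δ) * (c / (c + α)) ^ c ≤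
      (4 * E) ^ c * (Real.exp c * gammaFactor (n + 2) δ α) := by
    have a1 := factorial_rpow_neg_le hδ.le n
    rw [← hm, ← hc] at a1
    have a2 : (c / (c + α)) ^ c = δ ^ c * m ^ c * (α + c) ^ (-c) := by
      rw [Real.div_rpow hc0.le (by positivity), Real.rpow_neg (by positivity), add_comm c α,
        ← Real.mul_rpow hδ.le (by positivity), ← div_eq_mul_inv, hc, mul_comm m δ]
    have a3 : δ ^ (-(n * δ)) * δ ^ c ≤ 1 := by
      rw [← Real.rpow_add hδ]
      refine Real.rpow_le_one hδ.le hδ1 ?_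
      rw [hc, hm]; push_cast; nlinarith
    have a4 : m ^ (-c) * m ^ c = 1 := by
      rw [← Real.rpow_add (by positivity), neg_add_cancel, Real.rpow_zero]
    calc _ = δ ^ (-(n * δ)) * (n.factorial : ℝ) ^ (-δ) * (δ ^ c * m ^ c * (α + c) ^ (-c)) := by
          rw [a2]
      _ ≤ δ ^ (-(n * δ)) * ((4 * E) ^ c * m ^ (-c)) * (δ ^ c * m ^ c *
            (Real.exp c * gammaFactor (n + 2) δ α)) := by gcongr
      _ = (δ ^ (-(n * δ)) * δ ^ c) * (m ^ (-c) * m ^ c) * ((4 * E) ^ c *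
            (Real.exp c * gammaFactor (n + 2) δ α)) := by ring
      _ ≤ 1 * 1 * ((4 * E) ^ c * (Real.exp c * gammaFactor (n + 2) δ α)) := by
          rw [a4]; gcongr
      _ = _ := by ring
  calc _ ≤ C ^ n * (δ ^ (-(n * δ)) * (n.factorial : ℝ) ^ (-δ)) *
        (2 ^ (|(d : ℝ) / 2 - n * δ| / 2) * ((3 * μ / c) ^ μ * 2 ^ c * (c / (c + α)) ^ c)) := by
        gcongr
        exact prod_step_neg_le hδ hδ1 hκ1 hC n
    _ = C ^ n * (2 ^ (|(d : ℝ) / 2 - n * δ| / 2) * ((3 * μ / c) ^ μ * (2 ^ c *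
          (δ ^ (-(n * δ)) * (n.factorial : ℝ) ^ (-δ) * (c / (c + α)) ^ c)))) := by ring
    _ ≤ (C + 1) ^ (n + 2) * ((2 ^ (d + 1)) ^ (n + 2) * ((1 + 3 / δ) ^ (n + 2) * (2 ^ (n + 2) *
          ((4 * E) ^ (n + 2) * (E ^ (n + 2) * gammaFactor (n + 2) δ α))))) := by
        have f9 := f8.trans (mul_le_mul f5 (mul_le_mul_of_nonneg_right f6 hγ) (by positivity)
          (by positivity))
        generalize δ ^ (-(n * δ)) * (n.factorial : ℝ) ^ (-δ) * (c / (c + α)) ^ c = Q at f9 ⊢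
        have : 0 ≤ (4 * E) ^ (n + 2) * (E ^ (n + 2) * gammaFactor (n + 2) δ α) := by positivity
        have g1 : 2 ^ c * Q ≤ 2 ^ (n + 2) * ((4 * E) ^ (n + 2) *
            (E ^ (n + 2) * gammaFactor (n + 2) δ α)) :=
          (mul_le_mul_of_nonneg_left f9 (by positivity)).trans
            (mul_le_mul_of_nonneg_right f4 this)
        have g2 := (mul_le_mul_of_nonneg_left g1 (by positivity : 0 ≤ (3 * μ / c) ^ μ)).trans
            (mul_le_mul_of_nonneg_right f3 (by positivity))
        have g3 := (mul_le_mul_of_nonneg_left g2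
          (by positivity : (0 : ℝ) ≤ 2 ^ (|(d : ℝ) / 2 - n * δ| / 2))).trans
            (mul_le_mul_of_nonneg_right f2 (by positivity))
        exact (mul_le_mul_of_nonneg_left g3 (by positivity : 0 ≤ C ^ n)).trans
            (mul_le_mul_of_nonneg_right f1 (by positivity))
    _ = _ := by simp only [mul_pow]; ring

/-! ### Chains of kernels -/

lemma measurable_eLpNorm_section {X Y : Type*} [MeasurableSpace X] [MeasurableSpace Y]
    {μ : Measure X} [SFinite μ] {f : X → Y → ℝ} (hf : Measurable (Function.uncurry f))
    {r : ℝ≥0∞} (hr : r ≠ 0) : Measurable fun t => eLpNorm (fun x => f x t) r μ := by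
  have hf' : Measurable fun p : Y × X => ‖f p.2 p.1‖ₑ :=
    (hf.comp measurable_swap).enorm
  rcases eq_or_ne r ∞ with rfl | hrt
  · simp only [eLpNorm_exponent_top]
    refine measurable_of_Ioi fun c => ?_
    -- The essential supremum exceeds `c` exactly when the set where the function exceeds `c` has
    -- positive measure, and that measure depends measurably on `t`.
    have : (fun t => eLpNormEssSup (fun x => f x t) μ) ⁻¹' Ioi c =
        (fun t => μ (Prod.mk t ⁻¹' {p : Y × X | c < ‖f p.2 p.1‖ₑ})) ⁻¹' Ioi 0 := by
      ext t
      simp only [mem_preimage, mem_Ioi, ← not_le, nonpos_iff_eq_zero, not_iff_not]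
      constructor
      · intro h
        have := ae_le_eLpNormEssSup (f := fun x => f x t) (μ := μ)
        rw [← nonpos_iff_eq_zero]
        refine le_of_le_of_eq (measure_mono fun x hx => ?_) (ae_iff.1 this)
        simp only [mem_ofPred_eq, not_le]
        exact h.trans_lt (not_le.1 hx)
      · intro h
        refine eLpNormEssSup_le_of_ae_enorm_bound (ae_iff.2 ?_)
        exact h
    rw [this]
    exact (measurable_measure_prodMk_left
      (measurableSet_lt measurable_const hf')) measurableSet_Ioi
  · simp only [eLpNorm_eq_lintegral_rpow_enorm_toReal hr hrt]
    exact ((hf'.pow_const _).lintegral_prod_right').pow_const _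

lemma prod_snoc {M X T : Type*} [CommMonoid M] {n : ℕ} (G : Fin (n + 1) → X → X → T → T → M)
    (x₀ : X) (t₀ : T) (y : Fin n → X) (z : X) (u : Fin n → T) (τ : T) :
    ∏ i, G i ((Fin.snoc (α := fun _ => X) y z : Fin (n + 1) → X) i)
        (withStart x₀ (Fin.snoc (α := fun _ => X) y z : Fin (n + 1) → X) i.castSucc)
        ((Fin.snoc (α := fun _ => T) u τ : Fin (n + 1) → T) i)
        (withStart t₀ (Fin.snoc (α := fun _ => T) u τ : Fin (n + 1) → T) i.castSucc) =
      (∏ i : Fin n, G i.castSucc (y i) (withStart x₀ y i.castSucc) (u i)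
        (withStart t₀ u i.castSucc)) *
        G (Fin.last n) z (withStart x₀ y (Fin.last n)) τ (withStart t₀ u (Fin.last n)) := by
  rw [Fin.prod_univ_castSucc]
  simp only [withStart, Fin.cons_snoc_eq_snoc_cons, Fin.snoc_castSucc, Fin.snoc_last]

lemma withStart_snoc_last {X : Type*} {n : ℕ} (x₀ : X) (y : Fin n → X) (z : X) :
    withStart x₀ (Fin.snoc (α := fun _ => X) y z : Fin (n + 1) → X) (Fin.last (n + 1)) = z := by
  simp [withStart]

lemma withStart_strictMono {n : ℕ} {a : ℝ} {v : Fin n → ℝ}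
    (hv : ∀ i : Fin n, 0 < v i - withStart a v i.castSucc) : StrictMono (withStart a v) := by
  rw [Fin.strictMono_iff_lt_succ]
  intro i
  have := hv i
  simp only [withStart, Fin.cons_succ] at this ⊢
  linarith

lemma enorm_finsetProd {ι : Type*} (s : Finset ι) (g : ι → ℝ) :
    ‖∏ i ∈ s, g i‖ₑ = ∏ i ∈ s, ‖g i‖ₑ := by
  induction s using Finset.cons_induction with
  | empty => simp
  | cons a s ha ih => rw [Finset.prod_cons, Finset.prod_cons, enorm_mul, ih]

/-- The integrand of a block without the final power of time. -/
def chainProd {d m : ℕ} (f h : Fin m → Space d → ℝ → ℝ) (t₀ : ℝ) (s : Fin m → ℝ)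
    (z : Fin m → Space d) : ℝ :=
  ∏ i, f i (z i) (s i) * h i (z i - withStart 0 z i.castSucc) (s i - withStart t₀ s i.castSucc)

lemma chainProd_snoc {d n : ℕ} (f h : Fin (n + 1) → Space d → ℝ → ℝ) (t₀ : ℝ) (u : Fin n → ℝ)
    (τ : ℝ) (y : Fin n → Space d) (z : Space d) :
    chainProd f h t₀ (Fin.snoc (α := fun _ => ℝ) u τ : Fin (n + 1) → ℝ)
        (Fin.snoc (α := fun _ => Space d) y z : Fin (n + 1) → Space d) =
      chainProd (fun i => f i.castSucc) (fun i => h i.castSucc) t₀ u y *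
        (f (Fin.last n) z τ * h (Fin.last n) (z - withStart 0 y (Fin.last n))
          (τ - withStart t₀ u (Fin.last n))) :=
  prod_snoc (fun i x x' s s' => f i x s * h i (x - x') (s - s')) 0 t₀ y z u τ

lemma measurable_chainProd {d m : ℕ} {f h : Fin m → Space d → ℝ → ℝ}
    (hf : ∀ i, Measurable (Function.uncurry (f i))) (hh : ∀ i, Measurable (Function.uncurry (h i)))
    (t₀ : ℝ) {Ω : Type*} [MeasurableSpace Ω] {s : Ω → Fin m → ℝ} {z : Ω → Fin m → Space d}
    (hs : Measurable s) (hz : Measurable z) :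
    Measurable fun ω => chainProd f h t₀ (s ω) (z ω) := by
  unfold chainProd
  refine Finset.measurable_prod _ fun i _ => ?_
  have hsi := measurable_pi_iff.1 hs i
  have hzi := measurable_pi_iff.1 hz i
  refine Measurable.mul ?_ ?_
  · exact (hf i).comp (hzi.prodMk hsi)
  · exact (hh i).comp ((hzi.sub (measurable_withStart measurable_const hz _)).prodMk
      (hsi.sub (measurable_withStart measurable_const hs _)))

/-- The functions and kernels of a chain that starts with a kernel of order `0`, followed by
kernels of order `1`. -/
structure ChainData (d m : ℕ) (r : ℝ≥0∞) (ν : ℝ) where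
  /-- The functions. -/
  f : Fin m → Space d → ℝ → ℝ
  /-- The kernels. -/
  h : Fin m → Space d → ℝ → ℝ
  measurable_f : ∀ i, Measurable (Function.uncurry (f i))
  measurable_h : ∀ i, Measurable (Function.uncurry (h i))
  norm_ne_top : ∀ i t, eLpNorm (fun x => f i x t) r volume ≠ ∞
  enorm_h_le : ∀ i x s, ‖h i x s‖ₑ ≤
    (if (i : ℕ) = 0 then 1 else pw (-(1 / 2)) (ν * s)) * gauss (ν * s) x

namespace ChainData

variable {d n m : ℕ} {r : ℝ≥0∞} {ν : ℝ}

/-- The spatial norm of the `i`-th function. -/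
def F (D : ChainData d m r ν) (i : Fin m) (t : ℝ) : ℝ≥0∞ := eLpNorm (fun x => D.f i x t) r volume

lemma measurable_F (D : ChainData d m r ν) (hr : r ≠ 0) (i : Fin m) : Measurable (D.F i) :=
  measurable_eLpNorm_section (D.measurable_f i) hr

/-- The chain of kernels, integrated over all points but the last. -/
def A (D : ChainData d (n + 1) r ν) (t₀ : ℝ) (u : Fin n → ℝ) (τ : ℝ) (z : Space d) : ℝ :=
  ∫ y : Fin n → Space d, chainProd D.f D.h t₀ (Fin.snoc (α := fun _ => ℝ) u τ : Fin (n + 1) → ℝ)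
    (Fin.snoc (α := fun _ => Space d) y z : Fin (n + 1) → Space d)

/-- The time density of the chain. -/
def B (D : ChainData d (n + 1) r ν) (κ t₀ : ℝ) (u : Fin n → ℝ) (τ : ℝ) : ℝ≥0∞ :=
  (∏ i : Fin n, D.F i.castSucc (u i) * pw (-κ) (ν * (u i - withStart t₀ u i.castSucc))) *
    pw (-κ) (ν * (τ - withStart t₀ u (Fin.last n)))

/-- The first kernel carries no derivative. Its absent factor `gap^(-1/2)` is inserted and paid for
by the square root of the whole elapsed time, which is at least the first gap. This square root
later offsets half of the singularity of the second derivative. -/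
lemma prod_order_le {ν : ℝ} (hν : 0 < ν) {t₀ : ℝ} {v : Fin (n + 1) → ℝ}
    (hv : ∀ i : Fin (n + 1), 0 < v i - withStart t₀ v i.castSucc) :
    ∏ i : Fin (n + 1), (if (i : ℕ) = 0 then 1 else
        pw (-(1 / 2)) (ν * (v i - withStart t₀ v i.castSucc))) ≤
      pw (1 / 2) (ν * (v (Fin.last n) - t₀)) *
        ∏ i : Fin (n + 1), pw (-(1 / 2)) (ν * (v i - withStart t₀ v i.castSucc)) := by
  rw [Fin.prod_univ_succ, Fin.prod_univ_succ, ← mul_assoc]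
  simp only [Fin.val_zero, if_true, Fin.val_succ, Nat.add_eq_zero_iff, one_ne_zero, and_false,
    if_false]
  gcongr
  have h0 := hv 0
  have hle : v 0 ≤ v (Fin.last n) := by
    have hm := (withStart_strictMono hv).monotone
    have := hm (Fin.succ_le_succ_iff.2 (Fin.zero_le (Fin.last n)))
    simpa [withStart] using this
  have e0 : withStart t₀ v (Fin.castSucc 0) = t₀ := by simp [withStart]
  rw [e0] at h0 ⊢
  have hp : 0 < ν * (v 0 - t₀) := by positivity
  have hp' : 0 < ν * (v (Fin.last n) - t₀) := mul_pos hν (by linarith)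
  rw [pw_of_pos hp, pw_of_pos hp', ← ENNReal.ofReal_mul (by positivity), ENNReal.one_le_ofReal,
    Real.rpow_neg hp.le, ← div_eq_mul_inv, one_le_div (by positivity)]
  refine Real.rpow_le_rpow hp.le ?_ (by norm_num)
  gcongr

/-- The bound holds for the integral of the absolute value, so it yields both absolute convergence
and the Gaussian domination of `A`. -/
lemma lintegral_chain_le (D : ChainData d (n + 1) r ν) (hr : 1 ≤ r) (hν : 0 < ν)
    (t₀ : ℝ) (u : Fin n → ℝ) (τ : ℝ) (z : Space d) :
    ∫⁻ y : Fin n → Space d, ‖chainProd D.f D.h t₀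
        (Fin.snoc (α := fun _ => ℝ) u τ : Fin (n + 1) → ℝ)
        (Fin.snoc (α := fun _ => Space d) y z : Fin (n + 1) → Space d)‖ₑ ≤
      ENNReal.ofReal (bridgeConst d r) ^ n * (pw (1 / 2) (ν * (τ - t₀)) *
        D.B (1 / 2 + (d : ℝ) / 2 * (r⁻¹).toReal) t₀ u τ *
          pw ((d : ℝ) / 2 * (r⁻¹).toReal) (ν * (τ - t₀))) *
        gauss (ν * (τ - t₀)) z * ‖D.f (Fin.last n) z τ‖ₑ := by
  set v : Fin (n + 1) → ℝ := Fin.snoc (α := fun _ => ℝ) u τ with hv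
  have hvl : v (Fin.last n) = τ := by simp [hv]
  have hpt : ∀ y : Fin n → Space d, ‖chainProd D.f D.h t₀ v
      (Fin.snoc (α := fun _ => Space d) y z : Fin (n + 1) → Space d)‖ₑ ≤
      (∏ i : Fin (n + 1), (if (i : ℕ) = 0 then 1 else
        pw (-(1 / 2)) (ν * (v i - withStart t₀ v i.castSucc)))) *
      (spaceChain ν (fun i x => ‖D.f i.castSucc x (u i)‖ₑ) t₀ u 0 y *
        gauss (ν * (τ - withStart t₀ u (Fin.last n))) (z - withStart 0 y (Fin.last n)) *
          ‖D.f (Fin.last n) z τ‖ₑ) := by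
    intro y
    have hG := prod_snoc (fun (i : Fin (n + 1)) (x x' : Space d) (s s' : ℝ) =>
      ‖D.f i x s‖ₑ * gauss (ν * (s - s')) (x - x')) 0 t₀ y z u τ
    unfold chainProd spaceChain
    rw [show ∀ a b c : ℝ≥0∞, a * b * c = a * (c * b) from fun a b c => by ring, ← hG, ← hv,
      ← Finset.prod_mul_distrib, enorm_finsetProd]
    refine Finset.prod_le_prod' fun i _ => ?_
    rw [enorm_mul, mul_left_comm]
    gcongr
    exact D.enorm_h_le _ _ _
  by_cases hpos : ∀ i : Fin (n + 1), 0 < v i - withStart t₀ v i.castSucc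
  · have hord := prod_order_le hν hpos
    rw [hvl] at hord
    have hsc := lintegral_spaceChain_le hr ν n (fun i x => ‖D.f i.castSucc x (u i)‖ₑ)
      (fun i => ((D.measurable_f i.castSucc).comp measurable_prodMk_right).enorm) t₀ τ u 0 z
    simp only [sub_zero, eLpNorm_enorm] at hsc
    have hpr := prod_snoc (fun (i : Fin (n + 1)) (x x' : ℝ) (s s' : ℝ) =>
      pw (-(1 / 2)) (ν * (s - s'))) 0 t₀ (fun _ => 0) 0 u τ
    rw [← hv] at hpr
    have hms : Measurable fun y : Fin n → Space d =>
        spaceChain ν (fun i x => ‖D.f i.castSucc x (u i)‖ₑ) t₀ u 0 y *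
        gauss (ν * (τ - withStart t₀ u (Fin.last n))) (z - withStart 0 y (Fin.last n)) := by
      have h1 := measurable_spaceChain ν (φ := fun i x => ‖D.f i.castSucc x (u i)‖ₑ)
        (fun i => ((D.measurable_f i.castSucc).comp measurable_prodMk_right).enorm) t₀ u 0
      have h2 : Measurable fun y : Fin n → Space d => withStart 0 y (Fin.last n) :=
        measurable_withStart measurable_const measurable_id _
      exact h1.mul (by fun_prop)
    refine (lintegral_mono hpt).trans ?_
    rw [lintegral_const_mul _ (hms.mul_const _), lintegral_mul_const _ hms]
    refine (mul_le_mul' hord (mul_le_mul_left hsc _)).trans_eq ?_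
    rw [hpr, B, neg_add, ← pw_mul_pw]
    have hB : ∏ i : Fin n, D.F i.castSucc (u i) *
        pw (-(1 / 2) + -((d : ℝ) / 2 * (r⁻¹).toReal)) (ν * (u i - withStart t₀ u i.castSucc)) =
        (∏ i : Fin n, eLpNorm (fun x => D.f i.castSucc x (u i)) r volume *
          pw (-((d : ℝ) / 2 * (r⁻¹).toReal)) (ν * (u i - withStart t₀ u i.castSucc))) *
        ∏ i : Fin n, pw (-(1 / 2)) (ν * (u i - withStart t₀ u i.castSucc)) := by
      rw [← Finset.prod_mul_distrib]
      refine Finset.prod_congr rfl fun i _ => ?_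
      rw [← pw_mul_pw, F]; ring
    rw [hB]
    ring
  -- A nonpositive gap makes the corresponding `gauss`, hence the kernel, vanish.
  · push Not at hpos
    obtain ⟨i, hi⟩ := hpos
    have h0 : ∀ y : Fin n → Space d, ‖chainProd D.f D.h t₀ v
        (Fin.snoc (α := fun _ => Space d) y z : Fin (n + 1) → Space d)‖ₑ = 0 := by
      intro y
      rw [chainProd, enorm_finsetProd]
      refine Finset.prod_eq_zero (Finset.mem_univ i) ?_
      rw [enorm_mul]
      have := D.enorm_h_le i ((Fin.snoc (α := fun _ => Space d) y z : Fin (n + 1) → Space d) i -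
        withStart 0 (Fin.snoc (α := fun _ => Space d) y z : Fin (n + 1) → Space d) i.castSucc)
        (v i - withStart t₀ v i.castSucc)
      rw [gauss_of_nonpos (mul_nonpos_of_nonneg_of_nonpos hν.le hi), mul_zero,
        nonpos_iff_eq_zero] at this
      rw [this, mul_zero]
    simp [h0]

/-- The factor in front of the Gaussian in `enorm_A_le`. -/
def G (D : ChainData d (n + 1) r ν) (t₀ : ℝ) (u : Fin n → ℝ) (τ : ℝ) : ℝ≥0∞ :=
  ENNReal.ofReal (bridgeConst d r) ^ n * (pw (1 / 2) (ν * (τ - t₀)) *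
    D.B (1 / 2 + (d : ℝ) / 2 * (r⁻¹).toReal) t₀ u τ *
      pw ((d : ℝ) / 2 * (r⁻¹).toReal) (ν * (τ - t₀)))

lemma B_ne_top (D : ChainData d (n + 1) r ν) (κ t₀ : ℝ) (u : Fin n → ℝ) (τ : ℝ) :
    D.B κ t₀ u τ ≠ ∞ := by
  refine ENNReal.mul_ne_top ?_ (pw_ne_top _ _)
  exact ENNReal.prod_ne_top fun i _ => ENNReal.mul_ne_top (D.norm_ne_top _ _) (pw_ne_top _ _)

lemma G_ne_top (D : ChainData d (n + 1) r ν) (t₀ : ℝ) (u : Fin n → ℝ) (τ : ℝ) :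
    D.G t₀ u τ ≠ ∞ :=
  ENNReal.mul_ne_top (ENNReal.pow_ne_top ENNReal.ofReal_ne_top)
    (ENNReal.mul_ne_top (ENNReal.mul_ne_top (pw_ne_top _ _) (D.B_ne_top _ _ _ _))
      (pw_ne_top _ _))

lemma enorm_A_le (D : ChainData d (n + 1) r ν) (hr : 1 ≤ r) (hν : 0 < ν)
    (t₀ : ℝ) (u : Fin n → ℝ) (τ : ℝ) (z : Space d) :
    ‖D.A t₀ u τ z‖ₑ ≤ D.G t₀ u τ * gauss (ν * (τ - t₀)) z * ‖D.f (Fin.last n) z τ‖ₑ :=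
  (enorm_integral_le_lintegral_enorm _).trans (D.lintegral_chain_le hr hν t₀ u τ z)

lemma measurable_A (D : ChainData d (n + 1) r ν) (t₀ : ℝ) {Ω : Type*} [MeasurableSpace Ω]
    {u : Ω → Fin n → ℝ} {τ : Ω → ℝ} {z : Ω → Space d} (hu : Measurable u) (hτ : Measurable τ)
    (hz : Measurable z) : Measurable fun ω => D.A t₀ (u ω) (τ ω) (z ω) := by
  have h1 : Measurable fun p : Ω × (Fin n → Space d) => chainProd D.f D.h t₀
      (Fin.snoc (α := fun _ => ℝ) (u p.1) (τ p.1) : Fin (n + 1) → ℝ)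
      (Fin.snoc (α := fun _ => Space d) p.2 (z p.1) : Fin (n + 1) → Space d) := by
    refine measurable_chainProd D.measurable_f D.measurable_h t₀ ?_ ?_
    · exact measurable_snoc.comp
        ((hu.comp measurable_fst).prodMk (hτ.comp measurable_fst))
    · exact measurable_snoc.comp (measurable_snd.prodMk (hz.comp measurable_fst))
  exact h1.stronglyMeasurable.integral_prod_right'.measurable

end ChainData

/-! ### The last two points of a chain -/

lemma two_mul_inv_toReal_le_one {r : ℝ≥0∞} (hr : 2 ≤ r) : 2 * (r⁻¹).toReal ≤ 1 := by
  have h1 : r⁻¹ ≤ 2⁻¹ := ENNReal.inv_le_inv.2 hr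
  have := ENNReal.toReal_mono (by simp) h1
  simp only [ENNReal.toReal_inv, ENNReal.toReal_ofNat] at this ⊢
  linarith

lemma ofReal_weight {d : ℕ} {S : ℝ} (hS : 0 < S) (z : Space d) :
    ENNReal.ofReal (weight S z) = ENNReal.ofReal ((2 * S) ^ ((d : ℝ) / 2)) * gauss (2 * S) z := by
  rw [gauss_of_pos (by positivity), ← ENNReal.ofReal_mul (by positivity), ← mul_assoc,
    ← Real.rpow_add (by positivity), add_neg_cancel, Real.rpow_zero, one_mul, weight]
  congr 4
  ring

/-- The weight takes half of the Gaussian exponent. Dividing by it therefore leaves a bump of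
doubled variance, which still decays. -/
lemma gauss_eq_mul_weight {d : ℕ} {S : ℝ} (hS : 0 < S) (z : Space d) :
    gauss S z = ENNReal.ofReal (2 ^ ((d : ℝ) / 2)) * gauss (2 * S) z *
      ENNReal.ofReal (weight S z) := by
  rw [gauss_of_pos (by positivity), gauss_of_pos (by positivity),
    ← ENNReal.ofReal_mul (by positivity), ← ENNReal.ofReal_mul (by positivity), weight,
    Real.mul_rpow (by norm_num) hS.le, Real.rpow_neg (zero_le_two)]
  congr 1
  have h2 : (0 : ℝ) < 2 ^ ((d : ℝ) / 2) := by positivity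
  rw [show -(‖z‖ ^ 2 / (8 * S)) = -(‖z‖ ^ 2 / (8 * (2 * S))) + -(‖z‖ ^ 2 / (16 * S)) by
    field_simp; ring, Real.exp_add]
  field_simp

lemma enorm_div_weight_le {d : ℕ} {S : ℝ} (hS : 0 < S) {z : Space d} {A : ℝ} {Γ φ : ℝ≥0∞}
    (hA : ‖A‖ₑ ≤ Γ * gauss S z * φ) :
    ‖A / weight S z‖ₑ ≤ ENNReal.ofReal (2 ^ ((d : ℝ) / 2)) * Γ * (φ * gauss (2 * S) z) := by
  have hw := weight_pos S z
  have hwe : ‖weight S z‖ₑ = ENNReal.ofReal (weight S z) := Real.enorm_of_nonneg hw.le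
  have hw0 : ENNReal.ofReal (weight S z) ≠ 0 := by simpa using hw
  rw [← ENNReal.mul_le_mul_iff_left hw0 ENNReal.ofReal_ne_top, ← hwe, ← enorm_mul,
    div_mul_cancel₀ _ hw.ne', hwe]
  refine hA.trans_eq ?_
  rw [gauss_eq_mul_weight hS]
  ring

lemma lintegral_two_point_le {d : ℕ} {r : ℝ≥0∞} (hr : 1 ≤ r) {φ ψ : Space d → ℝ≥0∞}
    (hφ : Measurable φ) (hψ : Measurable ψ) (S σ : ℝ) :
    ∫⁻ p : Space d × Space d, φ p.1 * gauss S p.1 * (ψ p.2 * gauss σ (p.2 - p.1)) ≤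
      (ENNReal.ofReal (bridgeConst d r) * pw (-((d : ℝ) / 2 * (r⁻¹).toReal)) S *
        eLpNorm φ r volume) *
      (ENNReal.ofReal (bridgeConst d r) * pw (-((d : ℝ) / 2 * (r⁻¹).toReal)) σ *
        eLpNorm ψ r volume) := by
  rw [Measure.volume_eq_prod, lintegral_prod _ (by fun_prop)]
  have h1 : ∀ x : Space d, ∫⁻ y, φ x * gauss S x * (ψ y * gauss σ (y - x)) ≤
      φ x * gauss S x * (ENNReal.ofReal (bridgeConst d r) *
        pw (-((d : ℝ) / 2 * (r⁻¹).toReal)) σ * eLpNorm ψ r volume) := by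
    intro x
    rw [lintegral_const_mul _ (by fun_prop)]
    gcongr
    exact lintegral_mul_gauss_le hr hψ σ x
  refine (lintegral_mono h1).trans ?_
  rw [lintegral_mul_const _ (by fun_prop)]
  gcongr
  have := lintegral_mul_gauss_le hr hφ S 0
  rw [← bridgeConst] at this
  simpa only [sub_zero] using this

section TwoPoint

variable {d : ℕ} {r : ℝ≥0∞} {A g : Space d → ℝ} {φ : Space d → ℝ≥0∞} {Γ : ℝ≥0∞} {S σ : ℝ}

/-- No cancellation is used, so the factor `σ^(-1)` remains. This suffices for absolute convergence
at fixed times and for the region `σ > S`. -/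
lemma lintegral_heatK2_form_le (hr : 1 ≤ r) (hφ : Measurable φ) (hg : Measurable g)
    (hA : ∀ z, ‖A z‖ₑ ≤ Γ * gauss S z * φ z) (hΓ : Γ ≠ ∞) (hσ : 0 < σ) (i j : Fin d) :
    ∫⁻ p : Space d × Space d, ‖A p.1 * heatK2 i j σ (p.2 - p.1) * g p.2‖ₑ ≤
      Γ * (ENNReal.ofReal 3 * pw (-1) σ) *
      ((ENNReal.ofReal (bridgeConst d r) * pw (-((d : ℝ) / 2 * (r⁻¹).toReal)) S *
        eLpNorm φ r volume) *
      (ENNReal.ofReal (bridgeConst d r) * pw (-((d : ℝ) / 2 * (r⁻¹).toReal)) σ *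
        eLpNorm g r volume)) := by
  have h := lintegral_two_point_le hr hφ hg.enorm S σ
  rw [eLpNorm_enorm] at h
  refine le_trans ?_ (mul_le_mul_right h _)
  rw [← lintegral_const_mul' _ _ (ENNReal.mul_ne_top hΓ
    (ENNReal.mul_ne_top ENNReal.ofReal_ne_top (pw_ne_top _ _)))]
  refine lintegral_mono fun p => ?_
  rw [enorm_mul, enorm_mul]
  refine (mul_le_mul' (mul_le_mul' (hA _) (enorm_heatK2_le hσ i j _)) le_rfl).trans_eq ?_
  ring

lemma integrable_div_weight (hr : 1 ≤ r) (hAm : Measurable A) (hφ : Measurable φ)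
    (hA : ∀ z, ‖A z‖ₑ ≤ Γ * gauss S z * φ z) (hΓ : Γ ≠ ∞) (hφr : eLpNorm φ r volume ≠ ∞)
    (hS : 0 < S) : Integrable fun z => A z / weight S z := by
  refine ⟨(hAm.div (measurable_weight measurable_const measurable_id)).aestronglyMeasurable, ?_⟩
  rw [HasFiniteIntegral]
  refine (lintegral_mono fun z => enorm_div_weight_le hS (hA z)).trans_lt ?_
  rw [lintegral_const_mul _ (by fun_prop)]
  have := lintegral_mul_gauss_le hr hφ (2 * S) 0
  simp only [sub_zero] at this
  refine (mul_le_mul_right this _).trans_lt ?_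
  exact ENNReal.mul_lt_top (ENNReal.mul_lt_top ENNReal.ofReal_lt_top hΓ.lt_top)
    (ENNReal.mul_lt_top (ENNReal.mul_lt_top ENNReal.ofReal_lt_top (pw_ne_top _ _).lt_top)
      hφr.lt_top)

lemma integrable_weight_mul (hr : 1 ≤ r) (hg : Measurable g) (hgr : eLpNorm g r volume ≠ ∞)
    (hS : 0 < S) : Integrable fun z => weight S z * g z := by
  refine ⟨((measurable_weight measurable_const measurable_id).mul hg).aestronglyMeasurable, ?_⟩
  rw [HasFiniteIntegral]
  have h1 : ∀ z : Space d, ‖weight S z * g z‖ₑ =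
      ENNReal.ofReal ((2 * S) ^ ((d : ℝ) / 2)) * (‖g z‖ₑ * gauss (2 * S) (z - 0)) := by
    intro z
    rw [enorm_mul, Real.enorm_of_nonneg (weight_pos S z).le, ofReal_weight hS, sub_zero]
    ring
  simp only [h1]
  rw [lintegral_const_mul _ (by fun_prop)]
  have := lintegral_mul_gauss_le hr hg.enorm (2 * S) 0
  rw [eLpNorm_enorm] at this
  refine (mul_le_mul_right this _).trans_lt ?_
  exact ENNReal.mul_lt_top ENNReal.ofReal_lt_top
    (ENNReal.mul_lt_top (ENNReal.mul_lt_top ENNReal.ofReal_lt_top (pw_ne_top _ _).lt_top)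
      hgr.lt_top)

lemma pw_two_mul_le {e : ℝ} (he : 0 ≤ e) (S : ℝ) : pw (-e) (2 * S) ≤ pw (-e) S := by
  rcases le_or_gt S 0 with hS | hS
  · rw [pw_of_nonpos (by linarith)]
    exact zero_le
  · rw [pw_of_pos hS, pw_of_pos (by linarith)]
    exact ENNReal.ofReal_le_ofReal (Real.rpow_le_rpow_of_nonpos hS (by linarith) (by linarith))

/-- The form is split as `(A/w_S) K (w_S - w_{S+σ}) g + (A/w_S) K (w_{S+σ} g)`. The second weight
has parameter `S + σ`, the elapsed time at the last point scaled by the viscosity. The function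
`w_{S+σ} g` therefore does not depend on the last but one time, as the later Cauchy–Schwarz
inequality in the two times requires. -/
lemma enorm_integral_heatK2_form_le (hr : 1 ≤ r) (hAm : Measurable A) (hφ : Measurable φ)
    (hg : Measurable g) (hA : ∀ z, ‖A z‖ₑ ≤ Γ * gauss S z * φ z) (hΓ : Γ ≠ ∞)
    (hφr : eLpNorm φ r volume ≠ ∞) (hgr : eLpNorm g r volume ≠ ∞) (hσ : 0 < σ) (hσS : σ ≤ S)
    (i j : Fin d) :
    ‖∫ p : Space d × Space d, A p.1 * heatK2 i j σ (p.2 - p.1) * g p.2‖ₑ ≤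
      ENNReal.ofReal (23 * 2 ^ ((d : ℝ) / 2)) * (Γ * (pw (-(1 / 2)) σ * pw (-(1 / 2)) S) *
      ((ENNReal.ofReal (bridgeConst d r) * pw (-((d : ℝ) / 2 * (r⁻¹).toReal)) S *
        eLpNorm φ r volume) *
      (ENNReal.ofReal (bridgeConst d r) * pw (-((d : ℝ) / 2 * (r⁻¹).toReal)) σ *
        eLpNorm g r volume))) +
      dissip (fun z => A z / weight S z) σ ^ (1 / 2 : ℝ) *
        dissip (fun z => weight (S + σ) z * g z) σ ^ (1 / 2 : ℝ) := by
  have hS : 0 < S := hσ.trans_le hσS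
  have hgform : ∫⁻ p : Space d × Space d, ‖A p.1 * heatK2 i j σ (p.2 - p.1) * g p.2‖ₑ < ∞ := by
    refine (lintegral_heatK2_form_le hr hφ hg hA hΓ hσ i j).trans_lt ?_
    refine ENNReal.mul_lt_top (ENNReal.mul_lt_top hΓ.lt_top
      (ENNReal.mul_lt_top ENNReal.ofReal_lt_top (pw_ne_top _ _).lt_top)) (ENNReal.mul_lt_top ?_ ?_)
    · exact ENNReal.mul_lt_top (ENNReal.mul_lt_top ENNReal.ofReal_lt_top (pw_ne_top _ _).lt_top)
        hφr.lt_top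
    · exact ENNReal.mul_lt_top (ENNReal.mul_lt_top ENNReal.ofReal_lt_top (pw_ne_top _ _).lt_top)
        hgr.lt_top
  have hint : Integrable fun p : Space d × Space d => A p.1 * heatK2 i j σ (p.2 - p.1) * g p.2 := by
    refine ⟨Measurable.aestronglyMeasurable ?_, hgform⟩
    have := measurable_heatK2 (d := d) i j (measurable_const (a := σ))
      (measurable_snd.sub measurable_fst)
    exact ((hAm.comp measurable_fst).mul this).mul (hg.comp measurable_snd)
  set E : Space d × Space d → ℝ := fun p => A p.1 / weight S p.1 *
    (heatK2 i j σ (p.2 - p.1) * (weight S p.1 - weight (S + σ) p.2)) * g p.2 with hE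
  have hEle : ∫⁻ p, ‖E p‖ₑ ≤ ENNReal.ofReal (23 * 2 ^ ((d : ℝ) / 2)) *
      (Γ * (pw (-(1 / 2)) σ * pw (-(1 / 2)) S) *
      ((ENNReal.ofReal (bridgeConst d r) * pw (-((d : ℝ) / 2 * (r⁻¹).toReal)) S *
        eLpNorm φ r volume) *
      (ENNReal.ofReal (bridgeConst d r) * pw (-((d : ℝ) / 2 * (r⁻¹).toReal)) σ *
        eLpNorm g r volume))) := by
    have h := lintegral_two_point_le hr hφ hg.enorm (2 * S) σ
    rw [eLpNorm_enorm] at h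
    have he : 0 ≤ (d : ℝ) / 2 * (r⁻¹).toReal := by positivity
    have h' := h.trans (mul_le_mul_left (mul_le_mul_left
      (mul_le_mul_right (pw_two_mul_le he S) _) _) _)
    rw [← mul_assoc]
    refine le_trans ?_ (mul_le_mul_right h' _)
    rw [← lintegral_const_mul' _ _ (ENNReal.mul_ne_top ENNReal.ofReal_ne_top
      (ENNReal.mul_ne_top hΓ (ENNReal.mul_ne_top (pw_ne_top _ _) (pw_ne_top _ _))))]
    refine lintegral_mono fun p => ?_
    rw [hE, enorm_mul, enorm_mul]
    refine (mul_le_mul' (mul_le_mul' (enorm_div_weight_le hS (hA _))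
      (enorm_heatK2_mul_weight_sub_le hσ hσS i j _ _)) le_rfl).trans_eq ?_
    rw [ENNReal.ofReal_mul (by norm_num)]
    ring
  have hEint : Integrable E := by
    refine ⟨Measurable.aestronglyMeasurable ?_, hEle.trans_lt ?_⟩
    · have h1 := measurable_heatK2 (d := d) i j (measurable_const (a := σ))
        (measurable_snd.sub measurable_fst)
      have h2 := measurable_weight (d := d) (measurable_const (a := S))
        (measurable_fst (β := Space d))
      have h3 := measurable_weight (d := d) (measurable_const (a := S + σ))
        (measurable_snd (α := Space d))
      exact (((hAm.comp measurable_fst).div h2).mul (h1.mul (h2.sub h3))).mul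
        (hg.comp measurable_snd)
    · refine ENNReal.mul_lt_top ENNReal.ofReal_lt_top (ENNReal.mul_lt_top
        (ENNReal.mul_lt_top hΓ.lt_top
          (ENNReal.mul_lt_top (pw_ne_top _ _).lt_top (pw_ne_top _ _).lt_top))
        (ENNReal.mul_lt_top ?_ ?_))
      · exact ENNReal.mul_lt_top (ENNReal.mul_lt_top ENNReal.ofReal_lt_top
          (pw_ne_top _ _).lt_top) hφr.lt_top
      · exact ENNReal.mul_lt_top (ENNReal.mul_lt_top ENNReal.ofReal_lt_top
          (pw_ne_top _ _).lt_top) hgr.lt_top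
  have hsplit : ∀ p : Space d × Space d, A p.1 * heatK2 i j σ (p.2 - p.1) * g p.2 - E p =
      A p.1 / weight S p.1 * heatK2 i j σ (p.2 - p.1) * (weight (S + σ) p.2 * g p.2) := by
    intro p
    have := (weight_pos S p.1).ne'
    simp only [hE]
    field_simp
    ring
  have hadd : ∫ p : Space d × Space d, A p.1 * heatK2 i j σ (p.2 - p.1) * g p.2 =
      (∫ p, E p) + ∫ p : Space d × Space d,
        A p.1 / weight S p.1 * heatK2 i j σ (p.2 - p.1) * (weight (S + σ) p.2 * g p.2) := by
    rw [← integral_congr_ae (ae_of_all _ hsplit), integral_sub hint hEint]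
    ring
  rw [hadd]
  refine (enorm_add_le _ _).trans (add_le_add
    ((enorm_integral_le_lintegral_enorm _).trans hEle) ?_)
  exact enorm_integral_heatK2_le hσ i j
    (hAm.div (measurable_weight measurable_const measurable_id))
    ((measurable_weight measurable_const measurable_id).mul hg)
    (integrable_div_weight hr hAm hφ hA hΓ hφr hS)
    (integrable_weight_mul hr hg hgr (by positivity))

/-- The constant in the `L²` bounds of weighted functions. -/
def sqConst (d : ℕ) (r : ℝ≥0∞) : ℝ :=
  gaussConst d (1 - 2 * (r⁻¹).toReal) * 8 ^ ((d : ℝ) / 2 * (1 - 2 * (r⁻¹).toReal))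

lemma lintegral_sq_mul_exp_le (hr : 2 ≤ r) (hφ : Measurable φ) (hS : 0 < S) :
    ∫⁻ y, φ y ^ 2 * ENNReal.ofReal (Real.exp (-(‖y‖ ^ 2 / (8 * S)))) ≤
      ENNReal.ofReal (sqConst d r) * pw ((d : ℝ) / 2 - 2 * ((d : ℝ) / 2 * (r⁻¹).toReal)) S *
        eLpNorm φ r volume ^ 2 := by
  have hr1 := two_mul_inv_toReal_le_one hr
  have hr0 : r ≠ 0 := fun h => by simp [h] at hr
  have h := lintegral_rpow_mul_exp_le (θ := 2) two_pos hr0 hr1 hφ (c := 1 / (8 * S))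
    (by positivity) 0
  simp only [sub_zero, ENNReal.rpow_two] at h
  refine le_trans (le_of_eq ?_) (h.trans_eq ?_)
  · congr 1
    funext y
    congr 4
    ring
  · rw [pw_of_pos hS, ← ENNReal.ofReal_mul' (by positivity), mul_comm, sqConst]
    congr 2
    rw [one_div, Real.inv_rpow (by positivity), ← Real.rpow_neg (by positivity), neg_neg,
      Real.mul_rpow (by norm_num) hS.le, mul_assoc]
    congr 3
    ring

lemma lintegral_sq_div_weight_le (hr : 2 ≤ r) (hφ : Measurable φ)
    (hA : ∀ z, ‖A z‖ₑ ≤ Γ * gauss S z * φ z) (hS : 0 < S) :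
    ∫⁻ z, ‖A z / weight S z‖ₑ ^ 2 ≤ ENNReal.ofReal (sqConst d r) *
      (Γ * pw (-((d : ℝ) / 4) - (d : ℝ) / 2 * (r⁻¹).toReal) S * eLpNorm φ r volume) ^ 2 := by
  have hpt : ∀ z, ‖A z / weight S z‖ₑ ^ 2 ≤ Γ ^ 2 * pw (-d) S *
      (φ z ^ 2 * ENNReal.ofReal (Real.exp (-(‖z‖ ^ 2 / (8 * S))))) := by
    intro z
    refine (pow_le_pow_left' (enorm_div_weight_le hS (hA z)) 2).trans_eq ?_
    rw [gauss_of_pos (by positivity), pw_of_pos hS]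
    have h1 : ENNReal.ofReal (S ^ (-(d : ℝ))) *
        ENNReal.ofReal (Real.exp (-(‖z‖ ^ 2 / (8 * S)))) =
        (ENNReal.ofReal (2 ^ ((d : ℝ) / 2)) * ENNReal.ofReal ((2 * S) ^ (-((d : ℝ) / 2)) *
          Real.exp (-(‖z‖ ^ 2 / (8 * (2 * S)))))) ^ 2 := by
      rw [← ENNReal.ofReal_mul (by positivity), ← ENNReal.ofReal_mul (by positivity),
        ← ENNReal.ofReal_pow (by positivity)]
      congr 1
      rw [mul_pow, mul_pow, ← Real.exp_nat_mul, ← Real.rpow_mul_natCast (by norm_num),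
        ← Real.rpow_mul_natCast (by positivity), Real.mul_rpow (by norm_num) hS.le, ← mul_assoc,
        ← mul_assoc, ← Real.rpow_add (by norm_num)]
      push_cast
      rw [show (d : ℝ) / 2 * 2 + -((d : ℝ) / 2) * 2 = 0 by ring, Real.rpow_zero, one_mul]
      congr 2
      · ring_nf
      · field_simp
    calc _ = Γ ^ 2 * φ z ^ 2 * (ENNReal.ofReal (2 ^ ((d : ℝ) / 2)) *
          ENNReal.ofReal ((2 * S) ^ (-((d : ℝ) / 2)) *
            Real.exp (-(‖z‖ ^ 2 / (8 * (2 * S)))))) ^ 2 := by ring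
      _ = _ := by rw [← h1]; ring
  refine (lintegral_mono hpt).trans ?_
  rw [lintegral_const_mul _ (by fun_prop)]
  refine (mul_le_mul_right (lintegral_sq_mul_exp_le hr hφ hS) _).trans_eq ?_
  rw [mul_pow, mul_pow, pw_mul_self, show 2 * (-((d : ℝ) / 4) - (d : ℝ) / 2 * (r⁻¹).toReal) =
    -d + ((d : ℝ) / 2 - 2 * ((d : ℝ) / 2 * (r⁻¹).toReal)) by ring, ← pw_mul_pw]
  ring

lemma lintegral_sq_weight_mul_le (hr : 2 ≤ r) (hg : Measurable g) (hS : 0 < S) :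
    ∫⁻ z, ‖weight S z * g z‖ₑ ^ 2 ≤ ENNReal.ofReal (sqConst d r) *
      (pw ((d : ℝ) / 4 - (d : ℝ) / 2 * (r⁻¹).toReal) S * eLpNorm g r volume) ^ 2 := by
  have hpt : ∀ z, ‖weight S z * g z‖ₑ ^ 2 =
      ‖g z‖ₑ ^ 2 * ENNReal.ofReal (Real.exp (-(‖z‖ ^ 2 / (8 * S)))) := by
    intro z
    rw [enorm_mul, Real.enorm_of_nonneg (weight_pos S z).le, mul_pow, mul_comm, weight,
      ← ENNReal.ofReal_pow (by positivity), ← Real.exp_nat_mul]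
    congr 3
    push_cast
    field_simp
    ring
  simp only [hpt]
  have h := lintegral_sq_mul_exp_le hr hg.enorm hS
  rw [eLpNorm_enorm] at h
  refine h.trans_eq ?_
  rw [mul_pow, pw_mul_self, mul_assoc, show 2 * ((d : ℝ) / 4 - (d : ℝ) / 2 * (r⁻¹).toReal) =
    (d : ℝ) / 2 - 2 * ((d : ℝ) / 2 * (r⁻¹).toReal) by ring]

end TwoPoint

/-! ### Blocks with a second derivative at the end -/

/-- Appending two coordinates. -/
def snocTwo {X : Type*} {n : ℕ} (u : Fin n → X) (p : X × X) : Fin (n + 2) → X :=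
  Fin.snoc (α := fun _ => X) (Fin.snoc (α := fun _ => X) u p.1 : Fin (n + 1) → X) p.2

/-- Splitting off the last two coordinates. -/
def snocTwoEquiv (X : Type*) [MeasurableSpace X] (n : ℕ) :
    (Fin n → X) × (X × X) ≃ᵐ (Fin (n + 2) → X) :=
  (MeasurableEquiv.prodAssoc.symm.trans
    (MeasurableEquiv.prodCongr (snocEquiv X n) (MeasurableEquiv.refl X))).trans
    (snocEquiv X (n + 1))

lemma snocTwoEquiv_apply {X : Type*} [MeasurableSpace X] {n : ℕ} (p : (Fin n → X) × (X × X)) :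
    snocTwoEquiv X n p = snocTwo p.1 p.2 := by
  have : snocTwoEquiv X n p = snocEquiv X (n + 1) (snocEquiv X n (p.1, p.2.1), p.2.2) := rfl
  rw [this, snocEquiv_apply, snocEquiv_apply, snocTwo]

lemma measurePreserving_snocTwoEquiv {X : Type*} [MeasureSpace X]
    [SigmaFinite (volume : Measure X)] {n : ℕ} :
    MeasurePreserving (snocTwoEquiv X n) volume volume := by
  have h1 : MeasurePreserving (MeasurableEquiv.prodAssoc (α := Fin n → X) (β := X) (γ := X)).symm
      volume volume := (measurePreserving_prodAssoc volume volume volume).symm _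
  have h2 : MeasurePreserving
      (MeasurableEquiv.prodCongr (snocEquiv X n) (MeasurableEquiv.refl X)) volume volume :=
    (measurePreserving_snocEquiv (X := X) (n := n)).prod (MeasurePreserving.id volume)
  exact (measurePreserving_snocEquiv.comp h2).comp h1

lemma measurable_snocTwo {X : Type*} [MeasurableSpace X] {n : ℕ} :
    Measurable fun p : (Fin n → X) × (X × X) => snocTwo p.1 p.2 := by
  simpa only [funext snocTwoEquiv_apply] using (snocTwoEquiv X n).measurable

/-- The functions and kernels of a block of length at least two. -/
structure BlockData (d n : ℕ) (r : ℝ≥0∞) (ν : ℝ) where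
  /-- The functions. -/
  f : Fin (n + 2) → Space d → ℝ → ℝ
  /-- The kernels. -/
  h : Fin (n + 2) → Space d → ℝ → ℝ
  measurable_f : ∀ i, Measurable (Function.uncurry (f i))
  measurable_h : ∀ i, Measurable (Function.uncurry (h i))
  norm_ne_top : ∀ i t, eLpNorm (fun x => f i x t) r volume ≠ ∞
  enorm_h_le : ∀ (i : Fin (n + 1)) x s, ‖h i.castSucc x s‖ₑ ≤
    (if (i : ℕ) = 0 then 1 else pw (-(1 / 2)) (ν * s)) * gauss (ν * s) x
  /-- The first direction of the second derivative. -/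
  i : Fin d
  /-- The second direction of the second derivative. -/
  j : Fin d
  h_last : ∀ x s, 0 < s → h (Fin.last (n + 1)) x s = heatK2 i j (ν * s) x
  h_last_nonpos : ∀ x s, s ≤ 0 → h (Fin.last (n + 1)) x s = 0

namespace BlockData

variable {d n : ℕ} {r : ℝ≥0∞} {ν : ℝ}

/-- The chain without the last function and kernel. -/
def chain (D : BlockData d n r ν) : ChainData d (n + 1) r ν where
  f i := D.f i.castSucc
  h i := D.h i.castSucc
  measurable_f _ := D.measurable_f _
  measurable_h _ := D.measurable_h _
  norm_ne_top _ := D.norm_ne_top _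
  enorm_h_le := D.enorm_h_le

/-- The last function. -/
def g (D : BlockData d n r ν) (θ : ℝ) (z : Space d) : ℝ := D.f (Fin.last (n + 1)) z θ

lemma measurable_g (D : BlockData d n r ν) : Measurable (Function.uncurry D.g) :=
  (D.measurable_f (Fin.last (n + 1))).comp measurable_swap

/-- The spatial norm of the `i`-th function. -/
def F (D : BlockData d n r ν) (i : Fin (n + 2)) (t : ℝ) : ℝ≥0∞ :=
  eLpNorm (fun x => D.f i x t) r volume

lemma measurable_F (D : BlockData d n r ν) (hr : r ≠ 0) (i : Fin (n + 2)) : Measurable (D.F i) :=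
  measurable_eLpNorm_section (D.measurable_f i) hr

lemma chainProd_snocTwo (D : BlockData d n r ν) (t₀ : ℝ) (u : Fin n → ℝ) (τ θ : ℝ)
    (y : Fin n → Space d) (p : Space d × Space d) :
    chainProd D.f D.h t₀ (snocTwo u (τ, θ)) (snocTwo y p) =
      chainProd D.chain.f D.chain.h t₀ (Fin.snoc (α := fun _ => ℝ) u τ : Fin (n + 1) → ℝ)
        (Fin.snoc (α := fun _ => Space d) y p.1 : Fin (n + 1) → Space d) *
      (D.g θ p.2 * D.h (Fin.last (n + 1)) (p.2 - p.1) (θ - τ)) := by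
  rw [snocTwo, snocTwo, chainProd_snoc, withStart_snoc_last, withStart_snoc_last]
  rfl

lemma measurable_chainProd_space (D : BlockData d n r ν) (t₀ : ℝ) (s : Fin (n + 2) → ℝ) :
    Measurable (chainProd D.f D.h t₀ s) :=
  measurable_chainProd D.measurable_f D.measurable_h t₀ measurable_const measurable_id

/-- The integral of the absolute chain over all points but the last two obeys the same Gaussian
bound as `A`. At fixed times the crude estimate of the second derivative form is then finite. -/
lemma lintegral_chainProd_lt_top (D : BlockData d n r ν) (hr : 1 ≤ r) (hν : 0 < ν) (t₀ : ℝ)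
    (u : Fin n → ℝ) (τ θ : ℝ) :
    ∫⁻ z, ‖chainProd D.f D.h t₀ (snocTwo u (τ, θ)) z‖ₑ < ∞ := by
  have hm := D.measurable_chainProd_space t₀ (snocTwo u (τ, θ))
  have hm' : Measurable fun a : (Fin n → Space d) × (Space d × Space d) =>
      ‖chainProd D.f D.h t₀ (snocTwo u (τ, θ)) (snocTwoEquiv (Space d) n a)‖ₑ :=
    hm.enorm.comp (snocTwoEquiv (Space d) n).measurable
  rw [← (measurePreserving_snocTwoEquiv (X := Space d) (n := n)).lintegral_comp hm.enorm,
    Measure.volume_eq_prod, lintegral_prod_symm _ hm'.aemeasurable]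
  simp only [snocTwoEquiv_apply, D.chainProd_snocTwo]
  rcases le_or_gt θ τ with hθ | hθ
  · simp [D.h_last_nonpos _ _ (sub_nonpos.2 hθ)]
  have hσ : 0 < ν * (θ - τ) := mul_pos hν (sub_pos.2 hθ)
  simp only [D.h_last _ _ (sub_pos.2 hθ), enorm_mul (chainProd _ _ _ _ _)]
  set w : Space d → ℝ≥0∞ := fun z => ∫⁻ y : Fin n → Space d, ‖chainProd D.chain.f D.chain.h t₀
    (Fin.snoc (α := fun _ => ℝ) u τ : Fin (n + 1) → ℝ)
    (Fin.snoc (α := fun _ => Space d) y z : Fin (n + 1) → Space d)‖ₑ with hw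
  have hwle : ∀ z, w z ≤ D.chain.G t₀ u τ * gauss (ν * (τ - t₀)) z *
      ‖D.chain.f (Fin.last n) z τ‖ₑ := fun z => D.chain.lintegral_chain_le hr hν t₀ u τ z
  have hgauss : ∀ (σ : ℝ) (z : Space d), gauss σ z ≠ ∞ := by
    intro σ z
    unfold gauss
    split_ifs <;> simp
  have hwtop : ∀ z, w z ≠ ∞ := fun z => ne_top_of_le_ne_top
    (ENNReal.mul_ne_top (ENNReal.mul_ne_top (D.chain.G_ne_top _ _ _) (hgauss _ _))
      enorm_ne_top) (hwle z)
  have hwr : ∀ z, ‖(w z).toReal‖ₑ = w z := fun z => by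
    rw [Real.enorm_of_nonneg ENNReal.toReal_nonneg, ENNReal.ofReal_toReal (hwtop z)]
  have hmain := lintegral_heatK2_form_le (A := fun z => (w z).toReal) (g := D.g θ)
    (S := ν * (τ - t₀))
    (φ := fun z => ‖D.chain.f (Fin.last n) z τ‖ₑ) (Γ := D.chain.G t₀ u τ) (r := r) hr
    ((D.chain.measurable_f (Fin.last n)).comp measurable_prodMk_right).enorm
    (D.measurable_g.comp measurable_prodMk_left)
    (fun z => (hwr z).trans_le (hwle z)) (D.chain.G_ne_top _ _ _) hσ D.i D.j
  refine lt_of_eq_of_lt ?_ (hmain.trans_lt ?_)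
  · refine lintegral_congr fun p => ?_
    rw [lintegral_mul_const'' _ (Measurable.aemeasurable ?_), enorm_mul, enorm_mul, enorm_mul, hwr,
      hw]
    · ring
    · exact (measurable_chainProd D.chain.measurable_f D.chain.measurable_h t₀ measurable_const
        (measurable_snoc.comp (measurable_id.prodMk measurable_const))).enorm
  · rw [eLpNorm_enorm]
    refine ENNReal.mul_lt_top (ENNReal.mul_lt_top (D.chain.G_ne_top _ _ _).lt_top
      (ENNReal.mul_lt_top ENNReal.ofReal_lt_top (pw_ne_top _ _).lt_top)) (ENNReal.mul_lt_top ?_ ?_)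
    · exact ENNReal.mul_lt_top (ENNReal.mul_lt_top ENNReal.ofReal_lt_top (pw_ne_top _ _).lt_top)
        (D.chain.norm_ne_top _ _).lt_top
    · exact ENNReal.mul_lt_top (ENNReal.mul_lt_top ENNReal.ofReal_lt_top (pw_ne_top _ _).lt_top)
        (D.norm_ne_top _ _).lt_top

lemma integrable_chainProd (D : BlockData d n r ν) (hr : 1 ≤ r) (hν : 0 < ν) (t₀ : ℝ)
    (s : Fin (n + 2) → ℝ) : Integrable (chainProd D.f D.h t₀ s) := by
  obtain ⟨⟨u, τ, θ⟩, rfl⟩ := (snocTwoEquiv ℝ n).surjective s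
  rw [snocTwoEquiv_apply]
  exact ⟨(D.measurable_chainProd_space _ _).aestronglyMeasurable,
    D.lintegral_chainProd_lt_top hr hν t₀ u τ θ⟩

/-- The space integral of a block. -/
def J (D : BlockData d n r ν) (t₀ : ℝ) (s : Fin (n + 2) → ℝ) : ℝ :=
  ∫ z, chainProd D.f D.h t₀ s z

lemma measurable_J (D : BlockData d n r ν) (t₀ : ℝ) : Measurable (D.J t₀) := by
  have : Measurable fun p : (Fin (n + 2) → ℝ) × (Fin (n + 2) → Space d) =>
      chainProd D.f D.h t₀ p.1 p.2 :=
    measurable_chainProd D.measurable_f D.measurable_h t₀ measurable_fst measurable_snd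
  exact this.stronglyMeasurable.integral_prod_right'.measurable

lemma J_eq (D : BlockData d n r ν) (hr : 1 ≤ r) (hν : 0 < ν) (t₀ : ℝ) (u : Fin n → ℝ)
    {τ θ : ℝ} (hθ : τ < θ) :
    D.J t₀ (snocTwo u (τ, θ)) = ∫ p : Space d × Space d,
      D.chain.A t₀ u τ p.1 * heatK2 D.i D.j (ν * (θ - τ)) (p.2 - p.1) * D.g θ p.2 := by
  have hint := D.integrable_chainProd hr hν t₀ (snocTwo u (τ, θ))
  have hmp := measurePreserving_snocTwoEquiv (X := Space d) (n := n)
  have hemb := (snocTwoEquiv (Space d) n).measurableEmbedding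
  have hint' : Integrable (fun a : (Fin n → Space d) × (Space d × Space d) =>
      chainProd D.f D.h t₀ (snocTwo u (τ, θ)) (snocTwoEquiv (Space d) n a)) (volume.prod volume) :=
    (hmp.integrable_comp_emb hemb).2 hint
  rw [J, ← hmp.integral_comp hemb, Measure.volume_eq_prod, integral_prod_symm _ hint']
  refine integral_congr_ae (ae_of_all _ fun p => ?_)
  simp only [snocTwoEquiv_apply, D.chainProd_snocTwo, D.h_last _ _ (sub_pos.2 hθ)]
  rw [integral_mul_const, ChainData.A]
  ring

lemma J_eq_zero (D : BlockData d n r ν) (t₀ : ℝ) (u : Fin n → ℝ)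
    {τ θ : ℝ} (hθ : θ ≤ τ) : D.J t₀ (snocTwo u (τ, θ)) = 0 := by
  have hmp := measurePreserving_snocTwoEquiv (X := Space d) (n := n)
  have hemb := (snocTwoEquiv (Space d) n).measurableEmbedding
  rw [J, ← hmp.integral_comp hemb]
  simp [snocTwoEquiv_apply, D.chainProd_snocTwo, D.h_last_nonpos _ _ (sub_nonpos.2 hθ)]

end BlockData

lemma pw_mul_pw_neg {S : ℝ} (hS : 0 < S) (e : ℝ) : pw e S * pw (-e) S = 1 := by
  rw [pw_mul_pw, add_neg_cancel, pw_of_pos hS, Real.rpow_zero, ENNReal.ofReal_one]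

lemma timeChain_mul_pow {n : ℕ} {ν : ℝ} (hν : 0 < ν) (κ : ℝ) (F : Fin n → ℝ → ℝ≥0∞) (a : ℝ)
    (s : Fin n → ℝ) : ENNReal.ofReal (ν ^ (-κ)) ^ n * timeChain κ F a s =
      ∏ i, F i (s i) * pw (-κ) (ν * (s i - withStart a s i.castSucc)) := by
  have : ENNReal.ofReal (ν ^ (-κ)) ^ n = ∏ _i : Fin n, ENNReal.ofReal (ν ^ (-κ)) := by simp
  rw [this, timeChain, ← Finset.prod_mul_distrib]
  refine Finset.prod_congr rfl fun i _ => ?_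
  rw [pw_const_mul hν]
  ring

lemma sqConst_nonneg (d : ℕ) {r : ℝ≥0∞} (hr : 2 ≤ r) : 0 ≤ sqConst d r := by
  have : 0 ≤ 1 - 2 * (r⁻¹).toReal := sub_nonneg.2 (two_mul_inv_toReal_le_one hr)
  unfold sqConst gaussConst
  positivity

/-! ### The fixed-time bound of a block and the energy estimates for its two factors. -/

namespace BlockData

variable {d n : ℕ} {r : ℝ≥0∞} {ν : ℝ}

/-- The square root of the dissipation of the weighted chain. -/
def X (D : BlockData d n r ν) (t₀ : ℝ) (u : Fin n → ℝ) (τ s : ℝ) : ℝ≥0∞ :=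
  posInd (τ - t₀) *
    dissip (fun z => D.chain.A t₀ u τ z / weight (ν * (τ - t₀)) z) (ν * s) ^ (1 / 2 : ℝ)

/-- The square root of the dissipation of the weighted last function. -/
def Y (D : BlockData d n r ν) (t₀ θ s : ℝ) : ℝ≥0∞ :=
  posInd (θ - t₀) *
    dissip (fun z => weight (ν * (θ - t₀)) z * D.g θ z) (ν * s) ^ (1 / 2 : ℝ)

lemma timeChain_snocTwo (D : BlockData d n r ν) (hν : 0 < ν) (κ t₀ : ℝ) (u : Fin n → ℝ)
    (τ θ : ℝ) : ENNReal.ofReal (ν ^ (-κ)) ^ (n + 2) * timeChain κ D.F t₀ (snocTwo u (τ, θ)) =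
      D.chain.B κ t₀ u τ * (D.chain.F (Fin.last n) τ *
        (D.F (Fin.last (n + 1)) θ * pw (-κ) (ν * (θ - τ)))) := by
  rw [timeChain_mul_pow hν, snocTwo]
  have h1 := prod_snoc (fun (i : Fin (n + 2)) (_ _ : ℝ) (s s' : ℝ) =>
    D.F i s * pw (-κ) (ν * (s - s'))) 0 t₀ (fun _ => 0) 0
    (Fin.snoc (α := fun _ => ℝ) u τ : Fin (n + 1) → ℝ) θ
  have h2 := prod_snoc (fun (i : Fin (n + 1)) (_ _ : ℝ) (s s' : ℝ) =>
    D.F i.castSucc s * pw (-κ) (ν * (s - s'))) 0 t₀ (fun _ => 0) 0 u τ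
  rw [h1, h2, withStart_snoc_last]
  simp only [ChainData.B]
  have : ∀ i, D.chain.F i = D.F i.castSucc := fun _ => rfl
  simp only [this]
  ring

/-- The two ways of handling the second derivative meet here. In the region `σ > S`, and for the
error from the weights when `σ ≤ S`, the result is a time chain in which every gap has exponent
`-κ`. Only the dissipation term is left over, supported where `σ ≤ S`. The positive powers of `S` in
`G` are exactly those needed to cancel the negative ones in the error term. -/
lemma enorm_J_le (D : BlockData d n r ν) (hr : 1 ≤ r) (hν : 0 < ν) (t₀ : ℝ) (u : Fin n → ℝ)
    (τ θ : ℝ) :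
    ‖D.J t₀ (snocTwo u (τ, θ))‖ₑ ≤
      ENNReal.ofReal (23 * 2 ^ ((d : ℝ) / 2)) * ENNReal.ofReal (bridgeConst d r) ^ (n + 2) *
        (ENNReal.ofReal (ν ^ (-(1 / 2 + (d : ℝ) / 2 * (r⁻¹).toReal))) ^ (n + 2) *
          timeChain (1 / 2 + (d : ℝ) / 2 * (r⁻¹).toReal) D.F t₀ (snocTwo u (τ, θ))) +
      (if θ - τ ≤ τ - t₀ then posInd (θ - τ) * (D.X t₀ u τ (θ - τ) * D.Y t₀ θ (θ - τ)) else 0) := by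
  rcases le_or_gt θ τ with hθ | hθ
  · simp [D.J_eq_zero t₀ u hθ]
  rcases le_or_gt τ t₀ with hτ | hτ
  · have h0 : ∀ z, D.chain.A t₀ u τ z = 0 := by
      intro z
      have := D.chain.enorm_A_le hr hν t₀ u τ z
      rwa [gauss_of_nonpos (mul_nonpos_of_nonneg_of_nonpos hν.le (sub_nonpos.2 hτ)), mul_zero,
        zero_mul, nonpos_iff_eq_zero, enorm_eq_zero] at this
    simp [D.J_eq hr hν t₀ u hθ, h0]
  set e := (d : ℝ) / 2 * (r⁻¹).toReal with he
  set S := ν * (τ - t₀) with hS'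
  set σ := ν * (θ - τ) with hσ'
  have hS : 0 < S := mul_pos hν (sub_pos.2 hτ)
  have hσ : 0 < σ := mul_pos hν (sub_pos.2 hθ)
  rw [D.timeChain_snocTwo hν, D.J_eq hr hν t₀ u hθ]
  set c := ENNReal.ofReal (bridgeConst d r) with hc
  set φ : Space d → ℝ≥0∞ := fun z => ‖D.chain.f (Fin.last n) z τ‖ₑ with hφ
  have hφm : Measurable φ :=
    ((D.chain.measurable_f (Fin.last n)).comp measurable_prodMk_right).enorm
  have hφr : eLpNorm φ r volume = D.chain.F (Fin.last n) τ := eLpNorm_enorm _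
  have hgm : Measurable (D.g θ) := D.measurable_g.comp measurable_prodMk_left
  have hgr : eLpNorm (D.g θ) r volume = D.F (Fin.last (n + 1)) θ := rfl
  have hA := D.chain.enorm_A_le hr hν t₀ u τ
  have hΓ := D.chain.G_ne_top t₀ u τ
  have hG : D.chain.G t₀ u τ = c ^ n * (pw (1 / 2) S * D.chain.B (1 / 2 + e) t₀ u τ * pw e S) := rfl
  rcases le_or_gt σ S with hσS | hσS
  · have hif : θ - τ ≤ τ - t₀ := le_of_mul_le_mul_left hσS hν
    rw [if_pos hif]
    have h := enorm_integral_heatK2_form_le (A := D.chain.A t₀ u τ) (r := r) hr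
      (D.chain.measurable_A t₀ measurable_const measurable_const measurable_id)
      hφm hgm hA hΓ (by rw [hφr]; exact D.chain.norm_ne_top _ _)
      (D.norm_ne_top _ _) hσ hσS D.i D.j
    refine h.trans (add_le_add (le_of_eq ?_) (le_of_eq ?_))
    · rw [hφr, hgr, hG, neg_add, ← pw_mul_pw]
      calc _ = ENNReal.ofReal (23 * 2 ^ ((d : ℝ) / 2)) * c ^ (n + 2) *
            (D.chain.B (1 / 2 + e) t₀ u τ * (D.chain.F (Fin.last n) τ *
            (D.F (Fin.last (n + 1)) θ * (pw (-(1 / 2)) σ * pw (-e) σ)))) *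
            ((pw (1 / 2) S * pw (-(1 / 2)) S) * (pw e S * pw (-e) S)) := by ring
        _ = _ := by rw [pw_mul_pw_neg hS, pw_mul_pw_neg hS, mul_one, mul_one]
    · have e1 : S + σ = ν * (θ - t₀) := by rw [hS', hσ']; ring
      have p1 : posInd (θ - τ) = 1 := if_pos (by linarith)
      have p2 : posInd (τ - t₀) = 1 := if_pos (by linarith)
      have p3 : posInd (θ - t₀) = 1 := if_pos (by linarith)
      rw [X, Y, p1, p2, p3, one_mul, one_mul, one_mul, e1]
  · refine ((enorm_integral_le_lintegral_enorm _).trans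
      (lintegral_heatK2_form_le (r := r) hr hφm hgm hA hΓ hσ D.i D.j)).trans
      (le_trans ?_ (self_le_add_right _ _))
    rw [hφr, hgr, hG, neg_add, ← pw_mul_pw]
    have h3 : ENNReal.ofReal 3 ≤ ENNReal.ofReal (23 * 2 ^ ((d : ℝ) / 2)) := by
      refine ENNReal.ofReal_le_ofReal ?_
      have : (1 : ℝ) ≤ 2 ^ ((d : ℝ) / 2) := Real.one_le_rpow (by norm_num) (by positivity)
      linarith
    -- Here `S < σ`, so the half power gained from the first kernel reduces the order of the last
    -- one to 1.
    have hpw : pw (1 / 2) S * pw (-1) σ ≤ pw (-(1 / 2)) σ := by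
      have : pw (1 / 2) S ≤ pw (1 / 2) σ := by
        rw [pw_of_pos hS, pw_of_pos hσ]
        exact ENNReal.ofReal_le_ofReal (Real.rpow_le_rpow hS.le hσS.le (by norm_num))
      refine (mul_le_mul' this le_rfl).trans_eq ?_
      rw [pw_mul_pw]
      norm_num
    calc _ = ENNReal.ofReal 3 * c ^ (n + 2) *
          (D.chain.B (1 / 2 + e) t₀ u τ * (D.chain.F (Fin.last n) τ *
          (D.F (Fin.last (n + 1)) θ * ((pw (1 / 2) S * pw (-1) σ) * pw (-e) σ)))) *
          (pw e S * pw (-e) S) := by ring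
      _ ≤ _ := by
        rw [pw_mul_pw_neg hS, mul_one]
        gcongr

lemma integrable_weighted_A (D : BlockData d n r ν) (hr : 1 ≤ r) (hν : 0 < ν) {t₀ τ : ℝ}
    (hτ : t₀ < τ) (u : Fin n → ℝ) :
    Integrable fun z => D.chain.A t₀ u τ z / weight (ν * (τ - t₀)) z :=
  integrable_div_weight (A := D.chain.A t₀ u τ) hr
    (D.chain.measurable_A t₀ measurable_const measurable_const measurable_id)
    ((D.chain.measurable_f (Fin.last n)).comp measurable_prodMk_right).enorm
    (D.chain.enorm_A_le hr hν t₀ u τ) (D.chain.G_ne_top t₀ u τ)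
    (by rw [eLpNorm_enorm]; exact D.chain.norm_ne_top _ _) (mul_pos hν (sub_pos.2 hτ))

/-- The energy estimate for `A/w_S`. The time change `σ = νs` contributes `ν⁻¹`, and the powers of
the elapsed time in `G` combine with those of the weighted `L²` norm to the exponent `1/2 - d/4`. -/
lemma lintegral_X_sq_le (D : BlockData d n r ν) (hr : 2 ≤ r) (hν : 0 < ν) (t₀ : ℝ)
    (u : Fin n → ℝ) (τ : ℝ) :
    ∫⁻ s in Ioi 0, D.X t₀ u τ s ^ 2 ≤
      (ENNReal.ofReal (√(2 * ν⁻¹ * sqConst d r)) * (ENNReal.ofReal (bridgeConst d r) ^ n *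
        (pw (1 / 2 - (d : ℝ) / 4) (ν * (τ - t₀)) * D.chain.F (Fin.last n) τ) *
        D.chain.B (1 / 2 + (d : ℝ) / 2 * (r⁻¹).toReal) t₀ u τ)) ^ 2 := by
  have hr1 : 1 ≤ r := one_le_two.trans hr
  rcases le_or_gt τ t₀ with hτ | hτ
  · have : posInd (τ - t₀) = 0 := if_neg (by linarith)
    simp [X, this]
  have hS : 0 < ν * (τ - t₀) := mul_pos hν (sub_pos.2 hτ)
  have p2 : posInd (τ - t₀) = 1 := if_pos (by linarith)
  have hsq : ∀ x : ℝ≥0∞, (x ^ (1 / 2 : ℝ)) ^ 2 = x := fun x => by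
    rw [← ENNReal.rpow_mul_natCast]; norm_num
  simp only [X, p2, one_mul, hsq]
  have hAm : Measurable (D.chain.A t₀ u τ) :=
    D.chain.measurable_A t₀ measurable_const measurable_const measurable_id
  have hφm : Measurable fun z => ‖D.chain.f (Fin.last n) z τ‖ₑ :=
    ((D.chain.measurable_f (Fin.last n)).comp measurable_prodMk_right).enorm
  refine (setLIntegral_dissip_mul_le
    (hAm.div (measurable_weight measurable_const measurable_id))
    (D.integrable_weighted_A hr1 hν hτ u) hν).trans ?_
  refine (mul_le_mul_right (lintegral_sq_div_weight_le (A := D.chain.A t₀ u τ) hr hφm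
    (D.chain.enorm_A_le hr1 hν t₀ u τ) hS) _).trans_eq ?_
  rw [eLpNorm_enorm, mul_pow (ENNReal.ofReal √_), ← ENNReal.ofReal_pow (Real.sqrt_nonneg _),
    Real.sq_sqrt (mul_nonneg (by positivity) (sqConst_nonneg d hr)),
    ENNReal.ofReal_mul (p := 2 * ν⁻¹) (by positivity), ← mul_assoc]
  congr 2
  have hG : D.chain.G t₀ u τ = ENNReal.ofReal (bridgeConst d r) ^ n *
    (pw (1 / 2) (ν * (τ - t₀)) * D.chain.B (1 / 2 + (d : ℝ) / 2 * (r⁻¹).toReal) t₀ u τ *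
      pw ((d : ℝ) / 2 * (r⁻¹).toReal) (ν * (τ - t₀))) := rfl
  have hp : pw (1 / 2 - (d : ℝ) / 4) (ν * (τ - t₀)) = pw (1 / 2) (ν * (τ - t₀)) *
      pw ((d : ℝ) / 2 * (r⁻¹).toReal) (ν * (τ - t₀)) *
      pw (-((d : ℝ) / 4) - (d : ℝ) / 2 * (r⁻¹).toReal) (ν * (τ - t₀)) := by
    rw [pw_mul_pw, pw_mul_pw]
    congr 1
    ring
  rw [hG, hp, ChainData.F]
  ring

lemma lintegral_Y_sq_le (D : BlockData d n r ν) (hr : 2 ≤ r) (hν : 0 < ν) (t₀ θ : ℝ) :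
    ∫⁻ s in Ioi 0, D.Y t₀ θ s ^ 2 ≤
      (ENNReal.ofReal (√(2 * ν⁻¹ * sqConst d r)) *
        (pw ((d : ℝ) / 4 - (d : ℝ) / 2 * (r⁻¹).toReal) (ν * (θ - t₀)) *
          D.F (Fin.last (n + 1)) θ)) ^ 2 := by
  have hr1 : 1 ≤ r := one_le_two.trans hr
  rcases le_or_gt θ t₀ with hθ | hθ
  · have : posInd (θ - t₀) = 0 := if_neg (by linarith)
    simp [Y, this]
  have hS : 0 < ν * (θ - t₀) := mul_pos hν (sub_pos.2 hθ)
  have p2 : posInd (θ - t₀) = 1 := if_pos (by linarith)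
  have hsq : ∀ x : ℝ≥0∞, (x ^ (1 / 2 : ℝ)) ^ 2 = x := fun x => by
    rw [← ENNReal.rpow_mul_natCast]; norm_num
  simp only [Y, p2, one_mul, hsq]
  have hgm : Measurable (D.g θ) := D.measurable_g.comp measurable_prodMk_left
  refine (setLIntegral_dissip_mul_le
    ((measurable_weight measurable_const measurable_id).mul hgm)
    (integrable_weight_mul hr1 hgm (D.norm_ne_top _ _) hS) hν).trans ?_
  refine (mul_le_mul_right (lintegral_sq_weight_mul_le hr hgm hS) _).trans_eq ?_
  rw [mul_pow (ENNReal.ofReal √_), ← ENNReal.ofReal_pow (Real.sqrt_nonneg _),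
    Real.sq_sqrt (mul_nonneg (by positivity) (sqConst_nonneg d hr)),
    ENNReal.ofReal_mul (p := 2 * ν⁻¹) (by positivity), ← mul_assoc]
  rfl

lemma measurable_X (D : BlockData d n r ν) (t₀ : ℝ) {Ω : Type*} [MeasurableSpace Ω]
    {u : Ω → Fin n → ℝ} {τ s : Ω → ℝ} (hu : Measurable u) (hτ : Measurable τ)
    (hs : Measurable s) : Measurable fun ω => D.X t₀ (u ω) (τ ω) (s ω) := by
  have hA : Measurable (Function.uncurry fun (ω : Ω) z =>
      D.chain.A t₀ (u ω) (τ ω) z / weight (ν * (τ ω - t₀)) z) := by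
    refine Measurable.div ?_ ?_
    · exact D.chain.measurable_A t₀ (hu.comp measurable_fst) (hτ.comp measurable_fst) measurable_snd
    · exact measurable_weight (((hτ.comp measurable_fst).sub_const t₀).const_mul ν) measurable_snd
  exact (Measurable.posInd (hτ.sub_const t₀)).mul
    ((measurable_dissip hA (hs.const_mul ν)).pow_const _)

lemma measurable_Y (D : BlockData d n r ν) (t₀ : ℝ) {Ω : Type*} [MeasurableSpace Ω]
    {θ s : Ω → ℝ} (hθ : Measurable θ) (hs : Measurable s) :
    Measurable fun ω => D.Y t₀ (θ ω) (s ω) := by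
  have hg : Measurable (Function.uncurry fun (ω : Ω) z =>
      weight (ν * (θ ω - t₀)) z * D.g (θ ω) z) := by
    refine Measurable.mul ?_ ?_
    · exact measurable_weight (((hθ.comp measurable_fst).sub_const t₀).const_mul ν) measurable_snd
    · exact D.measurable_g.comp ((hθ.comp measurable_fst).prodMk measurable_snd)
  exact (Measurable.posInd (hθ.sub_const t₀)).mul
    ((measurable_dissip hg (hs.const_mul ν)).pow_const _)

end BlockData

lemma lintegral_snocTwo {X : Type*} [MeasureSpace X] [SigmaFinite (volume : Measure X)] {n : ℕ}
    {G : (Fin (n + 2) → X) → ℝ≥0∞} (hG : Measurable G) :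
    ∫⁻ s, G s = ∫⁻ p : X × X, ∫⁻ u : Fin n → X, G (snocTwo u p) := by
  have hm : Measurable fun a : (Fin n → X) × (X × X) => G (snocTwoEquiv X n a) :=
    hG.comp (snocTwoEquiv X n).measurable
  rw [← (measurePreserving_snocTwoEquiv (X := X) (n := n)).lintegral_comp hG,
    Measure.volume_eq_prod, lintegral_prod_symm _ hm.aemeasurable]
  simp only [snocTwoEquiv_apply]

namespace BlockData

variable {d n : ℕ} {r : ℝ≥0∞} {ν : ℝ}

lemma measurable_B (D : BlockData d n r ν) (hr : r ≠ 0) (κ t₀ : ℝ) (τ : ℝ) :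
    Measurable fun u => D.chain.B κ t₀ u τ := by
  unfold ChainData.B
  refine Measurable.mul (Finset.measurable_prod _ fun i _ => ?_) ?_
  · have h1 := (D.chain.measurable_F hr i.castSucc).comp (measurable_pi_apply (X := fun _ => ℝ) i)
    have h2 : Measurable fun u : Fin n → ℝ => u i := measurable_pi_apply i
    exact h1.mul (by fun_prop)
  · fun_prop

/-- The bound of the time integrals of the main term. -/
lemma lintegral_B_le (D : BlockData d n r ν) (hr : r ≠ 0) (hν : 0 < ν) {q : ℝ≥0∞} {κ δ C : ℝ}
    (hδ : 0 < δ) (hκ1 : κ ≤ 1) (hC : 0 < C)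
    (step : ∀ F : ℝ → ℝ≥0∞, Measurable F → ∀ A, -κ ≤ A → ∀ a b,
      ∫⁻ s, F s * (pw (-κ) (s - a) * pw A (b - s)) ≤
        ENNReal.ofReal (C * (A + 2) ^ (-δ)) * pw (A + δ) (b - a) * eLpNorm F q volume)
    (t₀ τ : ℝ) :
    ∫⁻ u, D.chain.B κ t₀ u τ ≤ ENNReal.ofReal (ν ^ (-κ)) ^ (n + 1) *
      (ENNReal.ofReal (∏ j ∈ Finset.range n, C * (-κ + j * δ + 2) ^ (-δ)) *
        pw (-κ + n * δ) (τ - t₀) *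
        ∏ i : Fin n, eLpNorm (D.F i.castSucc.castSucc) q volume) := by
  -- The gap between the last integrated time and `τ` plays the role of the terminal weight, so the
  -- exponent starts at `A = -κ`.
  have h := lintegral_timeChain_le hδ hκ1 hC step n (fun i => D.F i.castSucc.castSucc)
    (fun i => D.measurable_F hr _) le_rfl t₀ τ
  refine le_trans (le_of_eq ?_) (mul_le_mul_right h _)
  rw [← lintegral_const_mul' _ _ (ENNReal.pow_ne_top ENNReal.ofReal_ne_top)]
  refine lintegral_congr fun u => ?_
  rw [pow_succ, mul_mul_mul_comm, timeChain_mul_pow hν, ← pw_const_mul hν]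
  rfl

/-- The dissipation term integrated over all times. The inner chain contributes the power `nδ - κ`
of `τ - t₀`. The elapsed times at `τ` and `θ` then carry `β = nδ - d/(2r) - d/4` and `β' = d/4 -
d/(2r)`. Their sum is `(n+2)δ - μ`, which gives the final exponent `α + (n+2)δ`. -/
lemma lintegral_main_le (D : BlockData d n r ν) (hr : 2 ≤ r) (hν : 0 < ν) {q : ℝ≥0∞} (hq : 2 < q)
    {κ δ μ C : ℝ} (hκ : κ = 1 / 2 + (d : ℝ) / 2 * (r⁻¹).toReal)
    (hμ : μ = 1 - 2 * (q⁻¹).toReal) (hκδ : κ + δ = 1 - (q⁻¹).toReal)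
    (hδ : 0 < δ) (hκ1 : κ ≤ 1) (hC : 0 < C)
    (step : ∀ F : ℝ → ℝ≥0∞, Measurable F → ∀ A, -κ ≤ A → ∀ a b,
      ∫⁻ s, F s * (pw (-κ) (s - a) * pw A (b - s)) ≤
        ENNReal.ofReal (C * (A + 2) ^ (-δ)) * pw (A + δ) (b - a) * eLpNorm F q volume)
    {α : ℝ} (hα : 0 ≤ α) (t₀ t : ℝ) :
    ∫⁻ p : ℝ × ℝ, ∫⁻ u, (if p.2 - p.1 ≤ p.1 - t₀ then
        posInd (p.2 - p.1) * (D.X t₀ u p.1 (p.2 - p.1) * D.Y t₀ p.2 (p.2 - p.1)) else 0) *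
        pw α (t - p.2) ≤
      ENNReal.ofReal (2 * sqConst d r * bridgeConst d r ^ n * ν ^ (-((n + 2 : ℕ) * κ)) *
        ((∏ j ∈ Finset.range n, C * (-κ + j * δ + 2) ^ (-δ)) *
        (2 ^ (|(d : ℝ) / 2 - n * δ| / 2) * ((3 * μ / ((n + 2 : ℕ) * δ)) ^ μ *
          2 ^ ((n + 2 : ℕ) * δ) *
          (((n + 2 : ℕ) * δ) / ((n + 2 : ℕ) * δ + α)) ^ ((n + 2 : ℕ) * δ))))) *
        pw (α + (n + 2 : ℕ) * δ) (t - t₀) * ∏ i, eLpNorm (D.F i) q volume := by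
  have hr0 : r ≠ 0 := fun h => by simp [h] at hr
  have hXm : Measurable fun a : (ℝ × ℝ) × (Fin n → ℝ) => D.X t₀ a.2 a.1.1 a.1.2 :=
    D.measurable_X t₀ measurable_snd (measurable_fst.comp measurable_fst)
      (measurable_snd.comp measurable_fst)
  set Xb : ℝ → ℝ → ℝ≥0∞ := fun τ s => ∫⁻ u, D.X t₀ u τ s with hXb
  have hXbm : Measurable (Function.uncurry Xb) := hXm.lintegral_prod_right'
  have hYm : Measurable (Function.uncurry (D.Y t₀)) :=
    D.measurable_Y t₀ measurable_fst measurable_snd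
  have hpull : ∀ p : ℝ × ℝ, ∫⁻ u, (if p.2 - p.1 ≤ p.1 - t₀ then
        posInd (p.2 - p.1) * (D.X t₀ u p.1 (p.2 - p.1) * D.Y t₀ p.2 (p.2 - p.1)) else 0) *
        pw α (t - p.2) =
      (if p.2 - p.1 ≤ p.1 - t₀ then
        posInd (p.2 - p.1) * (Xb p.1 (p.2 - p.1) * D.Y t₀ p.2 (p.2 - p.1)) else 0) *
        pw α (t - p.2) := by
    intro p
    have hXu : Measurable fun u => D.X t₀ u p.1 (p.2 - p.1) :=
      D.measurable_X t₀ measurable_id measurable_const measurable_const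
    split_ifs
    · rw [lintegral_mul_const _ ((hXu.mul_const _).const_mul _),
        lintegral_const_mul _ (hXu.mul_const _), lintegral_mul_const _ hXu]
    · simp
  simp only [hpull]
  have hXb2 : Measurable fun p : ℝ × ℝ => Xb p.1 (p.2 - p.1) :=
    hXbm.comp (measurable_fst.prodMk (measurable_snd.sub measurable_fst))
  have hY2 : Measurable fun p : ℝ × ℝ => D.Y t₀ p.2 (p.2 - p.1) :=
    hYm.comp (measurable_snd.prodMk (measurable_snd.sub measurable_fst))
  have hmeas : Measurable fun p : ℝ × ℝ => (if p.2 - p.1 ≤ p.1 - t₀ then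
        posInd (p.2 - p.1) * (Xb p.1 (p.2 - p.1) * D.Y t₀ p.2 (p.2 - p.1)) else 0) *
        pw α (t - p.2) := by
    refine Measurable.mul (Measurable.ite ?_ ?_ measurable_const) (by fun_prop)
    · exact measurableSet_le (by fun_prop) (by fun_prop)
    · exact Measurable.mul (by fun_prop) (hXb2.mul hY2)
  rw [Measure.volume_eq_prod, lintegral_prod _ hmeas.aemeasurable]
  set c := ENNReal.ofReal (bridgeConst d r) with hc
  set k := ENNReal.ofReal (√(2 * ν⁻¹ * sqConst d r)) with hk
  set P := ∏ j ∈ Finset.range n, C * (-κ + j * δ + 2) ^ (-δ) with hP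
  set Φ := ∏ i : Fin n, eLpNorm (D.F i.castSucc.castSucc) q volume with hΦ
  have hXN : ∀ τ, ∫⁻ s in Ioi 0, Xb τ s ^ 2 ≤ (∫⁻ u, k * (c ^ n *
      (pw (1 / 2 - (d : ℝ) / 4) (ν * (τ - t₀)) * D.chain.F (Fin.last n) τ) *
      D.chain.B κ t₀ u τ)) ^ 2 := by
    intro τ
    -- Minkowski's inequality takes the integral over the earlier times `u` out of the `L²` norm in
    -- the last gap.
    refine lintegral_sq_lintegral_le (X := fun u s => D.X t₀ u τ s)
      (D.measurable_X t₀ measurable_fst measurable_const measurable_snd)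
      (((D.measurable_B hr0 κ t₀ τ).const_mul _).const_mul _) fun u => ?_
    have := D.lintegral_X_sq_le hr hν t₀ u τ
    rwa [← hκ] at this
  have hYM := fun θ => D.lintegral_Y_sq_le hr hν t₀ θ
  have hNF : ∀ τ, (∫⁻ u, k * (c ^ n *
      (pw (1 / 2 - (d : ℝ) / 4) (ν * (τ - t₀)) * D.chain.F (Fin.last n) τ) *
      D.chain.B κ t₀ u τ)) ≤
      (k * c ^ n * ENNReal.ofReal (ν ^ (1 / 2 - (d : ℝ) / 4)) *
        ENNReal.ofReal (ν ^ (-κ)) ^ (n + 1) * ENNReal.ofReal P * Φ) *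
        D.F (Fin.last n).castSucc τ *
        pw (n * δ - (d : ℝ) / 2 * (r⁻¹).toReal - (d : ℝ) / 4) (τ - t₀) := by
    intro τ
    have hB := D.measurable_B hr0 κ t₀ τ
    rw [lintegral_const_mul _ (hB.const_mul _), lintegral_const_mul _ hB]
    refine (mul_le_mul_right (mul_le_mul_right
      (D.lintegral_B_le hr0 hν hδ hκ1 hC step t₀ τ) _) _).trans_eq ?_
    rw [pw_const_mul hν, show (n : ℝ) * δ - (d : ℝ) / 2 * (r⁻¹).toReal - (d : ℝ) / 4 =
      (1 / 2 - (d : ℝ) / 4) + (-κ + n * δ) by rw [hκ]; ring,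
      ← pw_mul_pw (1 / 2 - (d : ℝ) / 4) (-κ + n * δ), ← hP, ← hΦ]
    have : D.chain.F (Fin.last n) τ = D.F (Fin.last n).castSucc τ := rfl
    rw [this]
    ring
  have hMF : ∀ θ, k * (pw ((d : ℝ) / 4 - (d : ℝ) / 2 * (r⁻¹).toReal) (ν * (θ - t₀)) *
      D.F (Fin.last (n + 1)) θ) ≤
      (k * ENNReal.ofReal (ν ^ ((d : ℝ) / 4 - (d : ℝ) / 2 * (r⁻¹).toReal))) *
        D.F (Fin.last (n + 1)) θ * pw ((d : ℝ) / 4 - (d : ℝ) / 2 * (r⁻¹).toReal) (θ - t₀) := by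
    intro θ
    rw [pw_const_mul hν]
    exact le_of_eq (by ring)
  have h := lintegral_bilinear_pw_le hq (X := Xb) (Y := D.Y t₀) hXbm hYm
    (D.measurable_F hr0 (Fin.last n).castSucc) (D.measurable_F hr0 (Fin.last (n + 1)))
    hXN hYM (c := (n + 2 : ℕ) * δ) hμ (by positivity) hα t₀ t hNF hMF
    (by push_cast; rw [hμ]; linarith)
  refine h.trans_eq ?_
  have hP0 : 0 ≤ P := by
    refine Finset.prod_nonneg fun j _ => mul_nonneg hC.le (Real.rpow_nonneg ?_ _)
    have : 0 ≤ j * δ := by positivity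
    linarith
  have hμ0 : 0 ≤ μ := by
    have : (q⁻¹).toReal ≤ (2⁻¹ : ℝ≥0∞).toReal :=
      ENNReal.toReal_mono (by simp) (ENNReal.inv_le_inv.2 hq.le)
    simp only [ENNReal.toReal_inv, ENNReal.toReal_ofNat] at this hμ
    linarith
  have hsq := sqConst_nonneg d hr
  have hbr : 0 ≤ bridgeConst d r := bridgeConst_nonneg (one_le_two.trans hr)
  have hkk : k * k = ENNReal.ofReal (2 * sqConst d r * ν ^ (-1 : ℝ)) := by
    rw [hk, ← ENNReal.ofReal_mul (Real.sqrt_nonneg _), Real.mul_self_sqrt (by positivity),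
      Real.rpow_neg_one]
    congr 1
    ring
  have hprod : ∏ i, eLpNorm (D.F i) q volume = Φ *
      (eLpNorm (D.F (Fin.last n).castSucc) q volume *
        eLpNorm (D.F (Fin.last (n + 1))) q volume) := by
    rw [Fin.prod_univ_castSucc, Fin.prod_univ_castSucc, mul_assoc]
  rw [hprod, show (d : ℝ) / 4 - (d : ℝ) / 2 * (r⁻¹).toReal -
      (n * δ - (d : ℝ) / 2 * (r⁻¹).toReal - (d : ℝ) / 4) = (d : ℝ) / 2 - n * δ by ring,
    add_comm α]
  set Q := (3 * μ / ((n + 2 : ℕ) * δ)) ^ μ * 2 ^ ((n + 2 : ℕ) * δ) *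
          (((n + 2 : ℕ) * δ) / ((n + 2 : ℕ) * δ + α)) ^ ((n + 2 : ℕ) * δ) with hQ
  have hQ0 : 0 ≤ Q := by positivity
  set W := pw ((n + 2 : ℕ) * δ + α) (t - t₀)
  -- The factor `ν⁻¹` is the product of the two square roots from the energy estimates; the other
  -- powers come from the scaled time gaps.
  have hν' : ν ^ (-((n + 2 : ℕ) * κ)) = ν ^ (-1 : ℝ) * ν ^ (1 / 2 - (d : ℝ) / 4) *
      (ν ^ (-κ)) ^ (n + 1) * ν ^ ((d : ℝ) / 4 - (d : ℝ) / 2 * (r⁻¹).toReal) := by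
    rw [← Real.rpow_mul_natCast hν.le, ← Real.rpow_add hν, ← Real.rpow_add hν, ← Real.rpow_add hν]
    congr 1
    push_cast
    rw [hκ]
    ring
  rw [hν']
  calc _ = (k * k) * c ^ n * (ENNReal.ofReal (ν ^ (1 / 2 - (d : ℝ) / 4)) *
        ENNReal.ofReal (ν ^ (-κ)) ^ (n + 1) *
        ENNReal.ofReal (ν ^ ((d : ℝ) / 4 - (d : ℝ) / 2 * (r⁻¹).toReal))) * ENNReal.ofReal P *
        (ENNReal.ofReal (2 ^ (|(d : ℝ) / 2 - n * δ| / 2)) * ENNReal.ofReal Q) * W *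
        (Φ * (eLpNorm (D.F (Fin.last n).castSucc) q volume *
        eLpNorm (D.F (Fin.last (n + 1))) q volume)) := by ring
    _ = _ := by
      congr 2
      rw [hkk, hc, ← ENNReal.ofReal_pow hbr, ← ENNReal.ofReal_pow (by positivity),
        ← ENNReal.ofReal_mul (by positivity), ← ENNReal.ofReal_mul (by positivity),
        ← ENNReal.ofReal_mul (by positivity), ← ENNReal.ofReal_mul (by positivity),
        ← ENNReal.ofReal_mul (by positivity), ← ENNReal.ofReal_mul (by positivity),
        ← ENNReal.ofReal_mul (by positivity)]
      congr 1
      ring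

end BlockData

lemma const_combine {a b c E H : ℝ} (ha : 0 ≤ a) (hb : 0 ≤ b) (hc : 0 ≤ c) (hE : 0 ≤ E)
    (hH : 0 ≤ H) (n : ℕ) :
    E * c ^ (n + 2) * a ^ (n + 2) + H * c ^ n * b ^ (n + 2) ≤
      ((1 + E) * c * a + (1 + H) * (1 + c) * b) ^ (n + 2) := by
  have h1 : E * c ^ (n + 2) * a ^ (n + 2) ≤ ((1 + E) * c * a) ^ (n + 2) := by
    rw [mul_pow, mul_pow]
    gcongr
    calc E ≤ 1 + E := by linarith
      _ ≤ (1 + E) ^ (n + 2) := le_self_pow₀ (by linarith) (by omega)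
  have h2 : H * c ^ n * b ^ (n + 2) ≤ ((1 + H) * (1 + c) * b) ^ (n + 2) := by
    rw [mul_pow, mul_pow]
    gcongr
    · calc H ≤ 1 + H := by linarith
        _ ≤ (1 + H) ^ (n + 2) := le_self_pow₀ (by linarith) (by omega)
    · calc c ^ n ≤ (1 + c) ^ n := by gcongr; linarith
        _ ≤ (1 + c) ^ (n + 2) := pow_le_pow_right₀ (by linarith) (by omega)
  refine (add_le_add h1 h2).trans (pow_add_pow_le (by positivity) (by positivity) (by omega))

lemma measurable_snocTwo_left {X : Type*} [MeasurableSpace X] {n : ℕ} (p : X × X) :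
    Measurable fun u : Fin n → X => snocTwo u p :=
  measurable_snocTwo.comp (measurable_id.prodMk measurable_const)

/-- The order-1 chain of length `n + 2` and the dissipation term have the same powers of `ν` and of
`t - t₀`. Only the two geometric constants remain to be added, by `const_combine`. -/
lemma BlockData.lintegral_J_le {d n : ℕ} {r : ℝ≥0∞} {ν : ℝ} (D : BlockData d n r ν) (hr : 2 ≤ r)
    (hν : 0 < ν) {q : ℝ≥0∞} (hq : 2 < q) {κ δ μ C K : ℝ}
    (hκ : κ = 1 / 2 + (d : ℝ) / 2 * (r⁻¹).toReal)
    (hμ : μ = 1 - 2 * (q⁻¹).toReal) (hκδ : κ + δ = 1 - (q⁻¹).toReal)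
    (hδ : 0 < δ) (hδ2 : δ ≤ 2) (hκ1 : κ ≤ 1) (hC : 0 < C)
    (step : ∀ F : ℝ → ℝ≥0∞, Measurable F → ∀ A, -κ ≤ A → ∀ a b,
      ∫⁻ s, F s * (pw (-κ) (s - a) * pw A (b - s)) ≤
        ENNReal.ofReal (C * (A + 2) ^ (-δ)) * pw (A + δ) (b - a) * eLpNorm F q volume)
    (hK0 : 0 < K) (hK : ∀ (n : ℕ) (α : ℝ), 0 ≤ α →
      (∏ j ∈ Finset.range n, C * (-κ + j * δ + 2) ^ (-δ)) *
        (2 ^ (|(d : ℝ) / 2 - n * δ| / 2) * ((3 * μ / ((n + 2 : ℕ) * δ)) ^ μ *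
          2 ^ ((n + 2 : ℕ) * δ) *
          (((n + 2 : ℕ) * δ) / ((n + 2 : ℕ) * δ + α)) ^ ((n + 2 : ℕ) * δ))) ≤
        K ^ (n + 2) * gammaFactor (n + 2) δ α)
    {α : ℝ} (hα : 0 ≤ α) (t₀ t : ℝ) :
    ∫⁻ s, ‖D.J t₀ s‖ₑ * pw α (t - withStart t₀ s (Fin.last (n + 2))) ≤
      ENNReal.ofReal (((1 + 23 * 2 ^ ((d : ℝ) / 2)) * bridgeConst d r * (C * Real.exp δ) +
          (1 + 2 * sqConst d r) * (1 + bridgeConst d r) * K) ^ (n + 2) *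
        ν ^ (-((n + 2 : ℕ) * κ)) * gammaFactor (n + 2) δ α) *
        pw (α + (n + 2 : ℕ) * δ) (t - t₀) * ∏ i, eLpNorm (D.F i) q volume := by
  have hr1 : 1 ≤ r := one_le_two.trans hr
  have hr0 : r ≠ 0 := fun h => by simp [h] at hr
  have hsq := sqConst_nonneg d hr
  have hbr : 0 ≤ bridgeConst d r := bridgeConst_nonneg hr1
  have hκ0 : 0 ≤ κ := by rw [hκ]; positivity
  have hg := gammaFactor_nonneg (k := n + 2) hδ.le hα
  set w : (Fin (n + 2) → ℝ) → ℝ≥0∞ := fun s => pw α (t - withStart t₀ s (Fin.last (n + 2))) with hw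
  have hwm : Measurable w := by
    have : Measurable fun s : Fin (n + 2) → ℝ => withStart t₀ s (Fin.last (n + 2)) :=
      measurable_withStart measurable_const measurable_id _
    fun_prop
  have hTm : Measurable fun s => timeChain κ D.F t₀ s :=
    measurable_timeChain (fun i => D.measurable_F hr0 i) measurable_const measurable_id
  set c1 := ENNReal.ofReal (23 * 2 ^ ((d : ℝ) / 2)) *
    ENNReal.ofReal (bridgeConst d r) ^ (n + 2) * ENNReal.ofReal (ν ^ (-κ)) ^ (n + 2) with hc1
  have hc1' : c1 = ENNReal.ofReal (23 * 2 ^ ((d : ℝ) / 2) * bridgeConst d r ^ (n + 2) *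
      ν ^ (-((n + 2 : ℕ) * κ))) := by
    rw [hc1, ← ENNReal.ofReal_pow hbr, ← ENNReal.ofReal_pow (by positivity),
      ← ENNReal.ofReal_mul (by positivity), ← ENNReal.ofReal_mul (by positivity),
      ← Real.rpow_mul_natCast hν.le]
    congr 3
    ring
  have hTmm : Measurable fun a : (Fin n → ℝ) × (ℝ × ℝ) =>
      c1 * (timeChain κ D.F t₀ (snocTwo a.1 a.2) * w (snocTwo a.1 a.2)) :=
    ((hTm.comp measurable_snocTwo).mul (hwm.comp measurable_snocTwo)).const_mul c1
  have hsplit : ∫⁻ s, ‖D.J t₀ s‖ₑ * w s ≤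
      c1 * (∫⁻ s, timeChain κ D.F t₀ s * w s) +
      ∫⁻ p : ℝ × ℝ, ∫⁻ u, (if p.2 - p.1 ≤ p.1 - t₀ then
        posInd (p.2 - p.1) * (D.X t₀ u p.1 (p.2 - p.1) * D.Y t₀ p.2 (p.2 - p.1)) else 0) *
        pw α (t - p.2) := by
    have hTw : Measurable fun s => timeChain κ D.F t₀ s * w s := hTm.mul hwm
    have hJw : Measurable fun s => ‖D.J t₀ s‖ₑ * w s := (D.measurable_J t₀).enorm.mul hwm
    rw [← lintegral_const_mul _ hTw, lintegral_snocTwo hJw,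
      lintegral_snocTwo (hTw.const_mul c1), ← lintegral_add_left
      (Measurable.lintegral_prod_left' hTmm)]
    refine lintegral_mono fun p => ?_
    simp only
    have hTu : Measurable fun u : Fin n → ℝ =>
        c1 * (timeChain κ D.F t₀ (snocTwo u p) * w (snocTwo u p)) :=
      (hTw.comp (measurable_snocTwo_left p)).const_mul c1
    refine le_trans (lintegral_mono fun u => ?_) (lintegral_add_left hTu _).le
    have h := D.enorm_J_le hr1 hν t₀ u p.1 p.2
    rw [← hκ] at h
    have hwu : w (snocTwo u p) = pw α (t - p.2) := by
      rw [hw, snocTwo]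
      simp only [withStart_snoc_last]
    refine (mul_le_mul_left h _).trans_eq ?_
    rw [add_mul, ← hwu, hc1, mul_assoc, mul_assoc, mul_assoc, mul_assoc, mul_assoc]
  refine hsplit.trans ?_
  have hT := lintegral_timeChain_le hδ hκ1 hC step (n + 2) D.F (D.measurable_F hr0)
    (by linarith : -κ ≤ α) t₀ t
  have hM := D.lintegral_main_le hr hν hq hκ hμ hκδ hδ hκ1 hC step hα t₀ t
  refine (add_le_add (mul_le_mul_right hT c1) hM).trans ?_
  rw [hc1', ← mul_assoc, ← mul_assoc, ← ENNReal.ofReal_mul (by positivity), ← add_mul, ← add_mul]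
  gcongr
  set N := ν ^ (-((n + 2 : ℕ) * κ)) with hN
  have hN0 : 0 ≤ N := by positivity
  refine (add_le_add
    (ENNReal.ofReal_le_ofReal (mul_le_mul_of_nonneg_left
      (prod_step_le hδ hδ2 hC.le hα (n + 2)) (by positivity)))
    (ENNReal.ofReal_le_ofReal (mul_le_mul_of_nonneg_left (hK n α hα) (by positivity)))).trans ?_
  rw [← ENNReal.ofReal_add (by positivity) (by positivity)]
  refine ENNReal.ofReal_le_ofReal ?_
  have h := const_combine (a := C * Real.exp δ) (b := K) (c := bridgeConst d r)
    (E := 23 * 2 ^ ((d : ℝ) / 2)) (H := 2 * sqConst d r) (by positivity) hK0.le hbr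
    (by positivity) (by positivity) n
  refine le_trans (le_of_eq ?_) (mul_le_mul_of_nonneg_right (mul_le_mul_of_nonneg_right h hN0) hg)
  ring

/-! ### Measurable representatives -/

lemma ae_lt_top_of_eLpNorm_lt_top {X : Type*} [MeasurableSpace X] {μ : Measure X} {q : ℝ≥0∞}
    (hq : q ≠ 0) {G : X → ℝ≥0∞} (hG : AEMeasurable G μ) (h : eLpNorm G q μ < ∞) :
    ∀ᵐ x ∂μ, G x < ∞ := by
  rcases eq_or_ne q ∞ with rfl | hqt
  · rw [eLpNorm_exponent_top] at h
    filter_upwards [ae_le_eLpNormEssSup (f := G) (μ := μ)] with x hx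
    exact lt_of_le_of_lt hx h
  · rw [eLpNorm_lt_top_iff_lintegral_rpow_enorm_lt_top hq hqt] at h
    simp only [enorm_eq_self] at h
    filter_upwards [ae_lt_top' (hG.pow_const _) h.ne] with x hx
    by_contra hc
    rw [not_lt, top_le_iff] at hc
    rw [hc, ENNReal.top_rpow_of_pos (ENNReal.toReal_pos hq hqt)] at hx
    exact lt_irrefl _ hx

/-- A Borel representative is set to zero outside `[0,T]` and at the null set of times with infinite
spatial norm. Spatial norms are then finite at every time, and the time norm over all of `ℝ` equals
the mixed norm. -/
lemma MemMixed.exists_measurable {d : ℕ} {r q : ℝ≥0∞} (hr : r ≠ 0) (hq : q ≠ 0) {T : ℝ}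
    {f : Space d → ℝ → ℝ} (hf : MemMixed r q T f) :
    ∃ g : Space d → ℝ → ℝ, Measurable (Function.uncurry g) ∧
      (∀ t, eLpNorm (fun x => g x t) r volume ≠ ∞) ∧
      (∀ᵐ t, t ∈ Icc 0 T → ∀ᵐ x, f x t = g x t) ∧
      eLpNorm (fun t => eLpNorm (fun x => g x t) r volume) q volume = mixedNorm r q T f := by
  obtain ⟨hfm, hfn⟩ := hf
  obtain ⟨m, hmm, hfme⟩ := hfm
  have hswap : ∀ᵐ t ∂(volume.restrict (Icc 0 T)), ∀ᵐ x, f x t = m (x, t) := by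
    have h1 : ∀ᵐ p ∂((volume : Measure (Space d)).prod (volume.restrict (Icc 0 T))),
        Function.uncurry f p = m p := by
      rw [Measure.volume_eq_prod, ← Measure.prod_restrict, Measure.restrict_univ] at hfme
      exact hfme
    have h2 : ∀ᵐ p ∂((volume.restrict (Icc 0 T)).prod (volume : Measure (Space d))),
        Function.uncurry f p.swap = m p.swap :=
      (Measure.measurePreserving_swap (μ := volume.restrict (Icc 0 T))
        (ν := (volume : Measure (Space d)))).quasiMeasurePreserving.ae h1
    exact Measure.ae_ae_of_ae_prod h2
  set N : ℝ → ℝ≥0∞ := fun t => eLpNorm (fun x => m (x, t)) r volume with hN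
  have hNm : Measurable N := measurable_eLpNorm_section (f := fun x t => m (x, t)) hmm hr
  have hNf : (fun t => eLpNorm (fun x => f x t) r volume) =ᵐ[volume.restrict (Icc 0 T)] N := by
    filter_upwards [hswap] with t ht
    exact eLpNorm_congr_ae ht
  have hNtop : ∀ᵐ t ∂(volume.restrict (Icc 0 T)), N t < ∞ := by
    refine ae_lt_top_of_eLpNorm_lt_top hq hNm.aemeasurable ?_
    rwa [← eLpNorm_congr_ae hNf]
  set U : Set ℝ := Icc 0 T ∩ {t | N t < ∞} with hU
  have hUm : MeasurableSet U := measurableSet_Icc.inter (measurableSet_lt hNm measurable_const)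
  classical
  set g : Space d → ℝ → ℝ := fun x t => if t ∈ U then m (x, t) else 0 with hg
  have hgN : ∀ t, eLpNorm (fun x => g x t) r volume = if t ∈ U then N t else 0 := by
    intro t
    by_cases ht : t ∈ U
    · simp only [hg, if_pos ht, hN]
    · simp [hg, if_neg ht]
  refine ⟨g, ?_, fun t => ?_, ?_, ?_⟩
  · exact Measurable.ite (measurable_snd hUm) hmm measurable_const
  · rw [hgN]
    split_ifs with ht
    · exact ht.2.ne
    · exact ENNReal.zero_ne_top
  · rw [← ae_restrict_iff' measurableSet_Icc]
    filter_upwards [hswap, hNtop, ae_restrict_mem measurableSet_Icc] with t h1 h2 h3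
    filter_upwards [h1] with x hx
    simp only [hg]
    rw [if_pos ⟨h3, h2⟩, hx]
  · rw [mixedNorm, eLpNorm_congr_ae hNf, ← eLpNorm_restrict_eq_of_support_subset (s := Icc 0 T)]
    · refine eLpNorm_congr_ae ?_
      filter_upwards [hNtop, ae_restrict_mem measurableSet_Icc] with t h2 h3
      rw [hgN, if_pos ⟨h3, h2⟩]
    · intro t ht
      by_contra hc
      refine ht ?_
      exact (hgN t).trans (if_neg fun h => hc h.1)

/-- A function of space and time, cut off at nonpositive times. -/
def cut {d : ℕ} (h : Space d → ℝ → ℝ) (x : Space d) (s : ℝ) : ℝ := if 0 < s then h x s else 0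

lemma cut_of_pos {d : ℕ} (h : Space d → ℝ → ℝ) (x : Space d) {s : ℝ} (hs : 0 < s) :
    cut h x s = h x s := if_pos hs

lemma cut_of_nonpos {d : ℕ} (h : Space d → ℝ → ℝ) (x : Space d) {s : ℝ} (hs : s ≤ 0) :
    cut h x s = 0 := if_neg hs.not_gt

lemma measurable_cut {d : ℕ} {h : Space d → ℝ → ℝ} {k : ℝ → Space d → ℝ} {ν : ℝ}
    (hk : Measurable fun p : Space d × ℝ => k (ν * p.2) p.1)
    (hhk : ∀ s, 0 < s → (fun x => h x s) = k (ν * s)) :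
    Measurable (Function.uncurry (cut h)) := by
  have : Function.uncurry (cut h) = fun p : Space d × ℝ =>
      if 0 < p.2 then k (ν * p.2) p.1 else 0 := by
    funext p
    simp only [Function.uncurry, cut]
    split_ifs with hp
    · exact congrFun (hhk _ hp) _
    · rfl
  rw [this]
  exact Measurable.ite (measurableSet_lt measurable_const measurable_snd) hk measurable_const

/-- `gauss` vanishes at nonpositive variance, so such a bound at all times requires the kernel to be
cut off at nonpositive times. -/
lemma IsOfType.zero_cut {d : ℕ} {ν : ℝ} (hν : 0 < ν) {h : Space d → ℝ → ℝ}
    (hh : IsOfType ν 0 h) : Measurable (Function.uncurry (cut h)) ∧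
      ∀ x s, ‖cut h x s‖ₑ ≤ gauss (ν * s) x := by
  refine ⟨measurable_cut (k := heatK) (by fun_prop) (hh.zero_eq hν), fun x s => ?_⟩
  rcases le_or_gt s 0 with hs | hs
  · simp [cut_of_nonpos h x hs]
  · rw [cut_of_pos h x hs, congrFun (hh.zero_eq hν s hs) x]
    exact enorm_heatK_le (mul_pos hν hs) x

lemma IsOfType.one_cut {d : ℕ} {ν : ℝ} (hν : 0 < ν) {h : Space d → ℝ → ℝ}
    (hh : IsOfType ν 1 h) : Measurable (Function.uncurry (cut h)) ∧
      ∀ x s, ‖cut h x s‖ₑ ≤ pw (-(1 / 2)) (ν * s) * gauss (ν * s) x := by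
  obtain ⟨i, hi⟩ := hh.one_eq hν
  refine ⟨measurable_cut (k := heatK1 i) (by fun_prop) hi, fun x s => ?_⟩
  rcases le_or_gt s 0 with hs | hs
  · simp [cut_of_nonpos h x hs]
  · rw [cut_of_pos h x hs, congrFun (hi s hs) x]
    exact enorm_heatK1_le (mul_pos hν hs) i x

/-! ### The simplex -/

lemma measurableSet_timeSimplex (k : ℕ) (t₀ t : ℝ) : MeasurableSet (timeSimplex k t₀ t) := by
  have : timeSimplex k t₀ t =
      (⋂ i, {s | t₀ ≤ s i}) ∩ ({s | Monotone s} ∩ ⋂ i, {s | s i ≤ t}) := by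
    ext s
    simp [timeSimplex]
  rw [this]
  refine ((isClosed_iInter fun i => ?_).inter
    (isClosed_monotone.inter (isClosed_iInter fun i => ?_))).measurableSet
  · exact isClosed_le continuous_const (continuous_apply i)
  · exact isClosed_le (continuous_apply i) continuous_const

/-- Each hyperplane `s i = s j` with `i ≠ j` is null. -/
lemma ae_injective (k : ℕ) : ∀ᵐ s : Fin k → ℝ, Function.Injective s := by
  have h : ∀ i j : Fin k, ∀ᵐ s : Fin k → ℝ, s i = s j → i = j := by
    intro i j
    by_cases hij : i = j
    · exact ae_of_all _ fun _ _ => hij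
    · have h0 := Measure.addHaar_submodule (volume : Measure (Fin k → ℝ))
        (LinearMap.ker (LinearMap.proj (R := ℝ) (φ := fun _ : Fin k => ℝ) i - LinearMap.proj j)) (by
          intro htop
          have : Pi.single i (1 : ℝ) ∈ LinearMap.ker
              (LinearMap.proj (R := ℝ) (φ := fun _ : Fin k => ℝ) i - LinearMap.proj j) := by
            rw [htop]; trivial
          simp [Ne.symm hij] at this)
      rw [ae_iff]
      refine measure_mono_null (fun s hs => ?_) h0
      simp only [mem_ofPred_eq, Classical.not_imp] at hs
      simp [hs.1]
  filter_upwards [ae_all_iff.2 fun i => ae_all_iff.2 (h i)] with s hs i j hij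
  exact hs i j hij

/-- The boundary of the simplex is null. Almost everywhere the gaps are positive, where cutting off
the kernels and truncating the powers has no effect. -/
lemma ae_timeSimplex {k : ℕ} (hk : 1 ≤ k) (t₀ t : ℝ) :
    ∀ᵐ s ∂(volume.restrict (timeSimplex k t₀ t)), s ∈ timeSimplex k t₀ t ∧
      (∀ i : Fin k, 0 < s i - withStart t₀ s i.castSucc) ∧ withStart t₀ s (Fin.last k) < t := by
  obtain ⟨k, rfl⟩ := Nat.exists_eq_add_of_le' hk
  have h1 : ∀ i, ∀ᵐ s : Fin (k + 1) → ℝ, s i ≠ t₀ := fun i =>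
    Measure.ae_eval_ne (fun _ : Fin (k + 1) => (volume : Measure ℝ)) i t₀
  have h2 : ∀ i, ∀ᵐ s : Fin (k + 1) → ℝ, s i ≠ t := fun i =>
    Measure.ae_eval_ne (fun _ : Fin (k + 1) => (volume : Measure ℝ)) i t
  filter_upwards [ae_restrict_of_ae (ae_all_iff.2 h1), ae_restrict_of_ae (ae_all_iff.2 h2),
    ae_restrict_of_ae (ae_injective (k + 1)),
    ae_restrict_mem (measurableSet_timeSimplex (k + 1) t₀ t)] with s h1 h2 h3 h4
  refine ⟨h4, fun i => ?_, ?_⟩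
  · refine Fin.cases ?_ (fun j => ?_) i
    · simp only [Fin.castSucc_zero, withStart, Fin.cons_zero]
      exact sub_pos.2 (lt_of_le_of_ne (h4.1 0) (h1 0).symm)
    · simp only [← Fin.succ_castSucc, withStart, Fin.cons_succ]
      exact sub_pos.2 ((h4.2.1.strictMono_of_injective h3) Fin.castSucc_lt_succ)
  · rw [← Fin.succ_last]
    simp only [withStart, Fin.cons_succ]
    exact lt_of_le_of_ne (h4.2.2 _) (h2 _)

lemma ae_blockIntegrand_eq {d k : ℕ} (hk : 1 ≤ k) {f g h : Fin k → Space d → ℝ → ℝ} {T t₀ t : ℝ}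
    (ht₀ : 0 ≤ t₀) (htT : t ≤ T) (hfg : ∀ i, ∀ᵐ t, t ∈ Icc 0 T → ∀ᵐ x, f i x t = g i x t)
    (α : ℝ) : ∀ᵐ s ∂(volume.restrict (timeSimplex k t₀ t)), ∀ᵐ z,
      blockIntegrand f h α t₀ t s z = chainProd g (fun i => cut (h i)) t₀ s z *
        (t - withStart t₀ s (Fin.last k)) ^ α := by
  have h1 : ∀ i, ∀ᵐ s : Fin k → ℝ, s i ∈ Icc 0 T → ∀ᵐ x, f i x (s i) = g i x (s i) := fun i =>
    (Measure.quasiMeasurePreserving_eval (fun _ : Fin k => (volume : Measure ℝ)) i).ae (hfg i)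
  filter_upwards [ae_timeSimplex hk t₀ t, ae_restrict_of_ae (ae_all_iff.2 h1)] with s hs h1
  obtain ⟨hs, hgap, -⟩ := hs
  have h2 : ∀ i, ∀ᵐ z : Fin k → Space d, f i (z i) (s i) = g i (z i) (s i) := fun i =>
    (Measure.quasiMeasurePreserving_eval (fun _ : Fin k => (volume : Measure (Space d))) i).ae
      (h1 i ⟨ht₀.trans (hs.1 i), (hs.2.2 i).trans htT⟩)
  filter_upwards [ae_all_iff.2 h2] with z hz
  simp only [blockIntegrand, chainProd, hz, cut_of_pos _ _ (hgap _)]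

/-- For measurable representatives and cut kernels, space integrability and a single bound on a
nonnegative integral over all times give the three assertions of the theorem. -/
lemma blockIntegral_bound {d k : ℕ} (hk : 1 ≤ k) {f g h : Fin k → Space d → ℝ → ℝ}
    {T t₀ t α : ℝ} (ht₀ : 0 ≤ t₀) (htT : t ≤ T)
    (hfg : ∀ i, ∀ᵐ t, t ∈ Icc 0 T → ∀ᵐ x, f i x t = g i x t)
    (hg : ∀ i, Measurable (Function.uncurry (g i)))
    (hh : ∀ i, Measurable (Function.uncurry (cut (h i))))
    (hint : ∀ s, Integrable (chainProd g (fun i => cut (h i)) t₀ s)) {M : ℝ} (hM : 0 ≤ M)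
    (hle : ∫⁻ s, ‖∫ z, chainProd g (fun i => cut (h i)) t₀ s z‖ₑ *
      pw α (t - withStart t₀ s (Fin.last k)) ≤ ENNReal.ofReal M) :
    (∀ᵐ s ∂(volume.restrict (timeSimplex k t₀ t)),
      Integrable (fun z => blockIntegrand f h α t₀ t s z)) ∧
    IntegrableOn (fun s => ∫ z, blockIntegrand f h α t₀ t s z) (timeSimplex k t₀ t) ∧
    |blockIntegral f h α t₀ t| ≤ M := by
  have hae := ae_blockIntegrand_eq (h := h) hk ht₀ htT hfg α
  set J : (Fin k → ℝ) → ℝ := fun s => ∫ z, chainProd g (fun i => cut (h i)) t₀ s z with hJ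
  have hJm : Measurable J := by
    have : Measurable fun p : (Fin k → ℝ) × (Fin k → Space d) =>
        chainProd g (fun i => cut (h i)) t₀ p.1 p.2 :=
      measurable_chainProd hg hh t₀ measurable_fst measurable_snd
    exact this.stronglyMeasurable.integral_prod_right'.measurable
  set G : (Fin k → ℝ) → ℝ := fun s => J s * (t - withStart t₀ s (Fin.last k)) ^ α with hG
  have hGm : Measurable G := by
    have : Measurable fun s : Fin k → ℝ => withStart t₀ s (Fin.last k) :=
      measurable_withStart measurable_const measurable_id _
    exact hJm.mul ((this.const_sub t).pow_const α)
  have hIG : (fun s => ∫ z, blockIntegrand f h α t₀ t s z)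
      =ᵐ[volume.restrict (timeSimplex k t₀ t)] G := by
    filter_upwards [hae] with s hs
    rw [integral_congr_ae hs, integral_mul_const]
  have hGle : ∫⁻ s in timeSimplex k t₀ t, ‖G s‖ₑ ≤ ENNReal.ofReal M := by
    refine le_trans ?_ ((setLIntegral_le_lintegral (timeSimplex k t₀ t) _).trans hle)
    refine lintegral_mono_ae ?_
    filter_upwards [ae_timeSimplex hk t₀ t] with s hs
    have hpos : 0 < t - withStart t₀ s (Fin.last k) := sub_pos.2 hs.2.2
    rw [hG, enorm_mul, pw_of_pos hpos, Real.enorm_of_nonneg (Real.rpow_nonneg hpos.le α)]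
  have hGint : Integrable G (volume.restrict (timeSimplex k t₀ t)) :=
    ⟨hGm.aestronglyMeasurable, hGle.trans_lt ENNReal.ofReal_lt_top⟩
  refine ⟨?_, hGint.congr hIG.symm, ?_⟩
  · filter_upwards [hae] with s hs
    exact ((hint s).mul_const _).congr (hs.mono fun _ h => h.symm)
  · rw [blockIntegral, integral_congr_ae hIG]
    have := (enorm_integral_le_lintegral_enorm
      (μ := volume.restrict (timeSimplex k t₀ t)) G).trans hGle
    rwa [Real.enorm_eq_ofReal_abs, ENNReal.ofReal_le_ofReal_iff hM] at this

/-! ### Blocks of length one. -/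

section Single

variable {d : ℕ} {r : ℝ≥0∞} {ν : ℝ} {g h : Fin 1 → Space d → ℝ → ℝ}

lemma lintegral_chainProd_one_le (hr : 1 ≤ r) (hg : ∀ i, Measurable (Function.uncurry (g i)))
    (hh : Measurable (Function.uncurry (h 0)))
    (hle : ∀ x s, ‖h 0 x s‖ₑ ≤ pw (-(1 / 2)) (ν * s) * gauss (ν * s) x)
    (t₀ : ℝ) (s : Fin 1 → ℝ) :
    ∫⁻ z, ‖chainProd g h t₀ s z‖ₑ ≤ ENNReal.ofReal (bridgeConst d r) *
      (eLpNorm (fun x => g 0 x (s 0)) r volume *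
        pw (-(1 / 2 + (d : ℝ) / 2 * (r⁻¹).toReal)) (ν * (s 0 - t₀))) := by
  have hch : ∀ z, chainProd g h t₀ s z = g 0 (z 0) (s 0) * h 0 (z 0) (s 0 - t₀) := by
    intro z
    simp [chainProd, withStart]
  have hgm : Measurable fun x => g 0 x (s 0) := (hg 0).comp measurable_prodMk_right
  have hhm : Measurable fun x => h 0 x (s 0 - t₀) := hh.comp measurable_prodMk_right
  have hmp := (volume_preserving_funUnique (Fin 1) (Space d)).lintegral_comp
    (f := fun x => ‖g 0 x (s 0) * h 0 x (s 0 - t₀)‖ₑ) (hgm.mul hhm).enorm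
  have heq : ∫⁻ z, ‖chainProd g h t₀ s z‖ₑ = ∫⁻ x, ‖g 0 x (s 0) * h 0 x (s 0 - t₀)‖ₑ := by
    rw [← hmp]
    refine lintegral_congr fun z => ?_
    rw [hch]
    rfl
  rw [heq]
  have hpt : ∀ x, ‖g 0 x (s 0) * h 0 x (s 0 - t₀)‖ₑ ≤ pw (-(1 / 2)) (ν * (s 0 - t₀)) *
      (‖g 0 x (s 0)‖ₑ * gauss (ν * (s 0 - t₀)) (x - 0)) := by
    intro x
    rw [enorm_mul, sub_zero, mul_left_comm]
    gcongr
    exact hle _ _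
  have hb := lintegral_mul_gauss_le hr hgm.enorm (ν * (s 0 - t₀)) 0
  rw [eLpNorm_enorm, ← bridgeConst] at hb
  refine (lintegral_mono hpt).trans ?_
  rw [lintegral_const_mul' _ _ (pw_ne_top _ _)]
  refine (mul_le_mul_right hb _).trans_eq ?_
  rw [neg_add, ← pw_mul_pw]
  ring

/-- A single kernel of order 1 has the integrable exponent `-κ`, so no cancellation is needed. -/
lemma lintegral_single_le (hr : 1 ≤ r) (hν : 0 < ν) (hg : ∀ i, Measurable (Function.uncurry (g i)))
    (hh : Measurable (Function.uncurry (h 0)))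
    (hle : ∀ x s, ‖h 0 x s‖ₑ ≤ pw (-(1 / 2)) (ν * s) * gauss (ν * s) x)
    {q : ℝ≥0∞} {κ δ C : ℝ} (hκ : κ = 1 / 2 + (d : ℝ) / 2 * (r⁻¹).toReal)
    (hδ : 0 < δ) (hδ2 : δ ≤ 2) (hκ1 : κ ≤ 1) (hC : 0 < C)
    (step : ∀ F : ℝ → ℝ≥0∞, Measurable F → ∀ A, -κ ≤ A → ∀ a b,
      ∫⁻ s, F s * (pw (-κ) (s - a) * pw A (b - s)) ≤
        ENNReal.ofReal (C * (A + 2) ^ (-δ)) * pw (A + δ) (b - a) * eLpNorm F q volume)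
    {α : ℝ} (hα : 0 ≤ α) (t₀ t : ℝ) :
    ∫⁻ s, ‖∫ z, chainProd g h t₀ s z‖ₑ * pw α (t - withStart t₀ s (Fin.last 1)) ≤
      ENNReal.ofReal ((bridgeConst d r * (C * Real.exp δ)) ^ 1 * ν ^ (-((1 : ℕ) * κ)) *
        gammaFactor 1 δ α) * pw (α + (1 : ℕ) * δ) (t - t₀) *
        ∏ i, eLpNorm (fun t => eLpNorm (fun x => g i x t) r volume) q volume := by
  have hbr : 0 ≤ bridgeConst d r := bridgeConst_nonneg hr
  have hκ0 : 0 ≤ κ := by rw [hκ]; positivity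
  have hr0 : r ≠ 0 := (zero_lt_one.trans_le hr).ne'
  set G : Fin 1 → ℝ → ℝ≥0∞ := fun i t => eLpNorm (fun x => g i x t) r volume with hG
  have hGm : ∀ i, Measurable (G i) := fun i => measurable_eLpNorm_section (hg i) hr0
  have hpt : ∀ s : Fin 1 → ℝ, ‖∫ z, chainProd g h t₀ s z‖ₑ *
      pw α (t - withStart t₀ s (Fin.last 1)) ≤
      ENNReal.ofReal (bridgeConst d r * ν ^ (-κ)) * (timeChain κ G t₀ s *
        pw α (t - withStart t₀ s (Fin.last 1))) := by
    intro s
    rw [← mul_assoc]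
    gcongr
    refine (enorm_integral_le_lintegral_enorm _).trans
      ((lintegral_chainProd_one_le hr hg hh hle t₀ s).trans_eq ?_)
    rw [← hκ, pw_const_mul hν, ENNReal.ofReal_mul hbr, timeChain]
    simp only [Fin.prod_univ_one, withStart, Fin.castSucc_zero, Fin.cons_zero, hG]
    ring
  refine (lintegral_mono hpt).trans ?_
  rw [lintegral_const_mul' _ _ ENNReal.ofReal_ne_top]
  have hT := lintegral_timeChain_le hδ hκ1 hC step 1 G hGm (by linarith : -κ ≤ α) t₀ t
  refine (mul_le_mul_right hT _).trans ?_
  rw [← mul_assoc, ← mul_assoc, ← ENNReal.ofReal_mul (by positivity)]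
  refine mul_le_mul_left (mul_le_mul_left (ENNReal.ofReal_le_ofReal ?_) _) _
  refine (mul_le_mul_of_nonneg_left (prod_step_le hδ hδ2 hC.le hα 1) (by positivity)).trans_eq ?_
  simp only [pow_one, Nat.cast_one, one_mul]
  ring

end Single

/-- At `v = 0` the truncated power is 0 and the real power is nonnegative, so the inequality
survives there too. -/
lemma le_ofReal_of_le_mul_pw {k : ℕ} {X : ℝ≥0∞} {a b v : ℝ} {N : Fin k → ℝ≥0∞} (ha : 0 ≤ a)
    (hv : 0 ≤ v) (hN : ∀ i, N i ≠ ∞) (h : X ≤ ENNReal.ofReal a * pw b v * ∏ i, N i) :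
    X ≤ ENNReal.ofReal (a * v ^ b * ∏ i, (N i).toReal) := by
  refine h.trans ?_
  rw [ENNReal.ofReal_mul (by positivity), ENNReal.ofReal_mul ha,
    ENNReal.ofReal_prod_of_nonneg fun _ _ => ENNReal.toReal_nonneg]
  simp only [ENNReal.ofReal_toReal (hN _)]
  gcongr
  unfold pw
  split_ifs
  · exact le_rfl
  · exact zero_le

end BlockIntegral

end

/-! ### The theorem. -/

open BlockIntegral in
theorem theorem3p1 (d : ℕ) (hd : 1 ≤ d) (r q : ℝ≥0∞) (hdr : (d : ℝ≥0∞) < r) (hr : 2 ≤ r)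
    (hq : 2 < q) (hδ : 0 < BlockIntegral.deltaOne d r q) :
    ∃ C : ℝ, 0 < C ∧
      ∀ (ν : ℝ), 0 < ν →
      ∀ (T t₀ t α : ℝ), 0 ≤ t₀ → t₀ ≤ t → t ≤ T → 0 ≤ α →
      ∀ (k : ℕ), 1 ≤ k →
      ∀ (h : Fin k → BlockIntegral.Space d → ℝ → ℝ),
        (∀ i, BlockIntegral.IsOfType ν (BlockIntegral.blockType k i) (h i)) →
      ∀ (f : Fin k → BlockIntegral.Space d → ℝ → ℝ),
        (∀ i, BlockIntegral.MemMixed r q T (f i)) →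
        (∀ᵐ s ∂(volume.restrict (BlockIntegral.timeSimplex k t₀ t)),
          Integrable (fun z => BlockIntegral.blockIntegrand f h α t₀ t s z)) ∧
        IntegrableOn (fun s => ∫ z, BlockIntegral.blockIntegrand f h α t₀ t s z)
          (BlockIntegral.timeSimplex k t₀ t) ∧
        |BlockIntegral.blockIntegral f h α t₀ t| ≤
          C ^ k * ν ^ (-((k : ℝ) * ((d : ℝ) / 2 * (r⁻¹).toReal + 1 / 2))) *
            BlockIntegral.gammaFactor k (BlockIntegral.deltaOne d r q) α *
            (t - t₀) ^ (α + k * BlockIntegral.deltaOne d r q) *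
            ∏ i, (BlockIntegral.mixedNorm r q T (f i)).toReal := by
  have hr1 : 1 ≤ r := one_le_two.trans hr
  have hr0 : r ≠ 0 := (zero_lt_one.trans_le hr1).ne'
  have hq0 : q ≠ 0 := (zero_lt_two.trans hq).ne'
  have hq1 : 1 < q := ENNReal.one_lt_two.trans hq
  set δ := deltaOne d r q with hδ_def
  have he0 : 0 ≤ (d : ℝ) / 2 * (r⁻¹).toReal := by positivity
  have hq' : 0 ≤ (q⁻¹).toReal := ENNReal.toReal_nonneg
  have hδe : δ = 1 / 2 - (d : ℝ) / 2 * (r⁻¹).toReal - (q⁻¹).toReal := rfl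
  obtain ⟨κ, hκ⟩ : ∃ κ : ℝ, κ = 1 / 2 + (d : ℝ) / 2 * (r⁻¹).toReal := ⟨_, rfl⟩
  obtain ⟨μ, hμ⟩ : ∃ μ : ℝ, μ = 1 - 2 * (q⁻¹).toReal := ⟨_, rfl⟩
  have hκδ : κ + δ = 1 - (q⁻¹).toReal := by rw [hκ, hδe]; ring
  have hδ1 : δ ≤ 1 := by linarith
  have hδ2 : δ ≤ 2 := by linarith
  have hκ0 : 0 ≤ κ := by linarith
  have hκ1 : κ ≤ 1 := by linarith
  have hμ0 : 0 < μ := by linarith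
  have hμ1 : μ ≤ 1 := by linarith
  obtain ⟨C, hC, step⟩ := lintegral_step_le hq1 hδ hδ2 hκ0 hκδ
  obtain ⟨K, hK0, hK⟩ := exists_main_const d hδ hδ1 hκ1 hμ0 hμ1 hC.le
  have hsq := sqConst_nonneg d hr
  have hbr : 0 ≤ bridgeConst d r := bridgeConst_nonneg hr1
  -- The first summand is the base for the order-1 chain, the second the base for the dissipation
  -- term. For `k = 1` the first alone is more than enough.
  refine ⟨(1 + 23 * 2 ^ ((d : ℝ) / 2)) * bridgeConst d r * (C * Real.exp δ) +
    (1 + 2 * sqConst d r) * (1 + bridgeConst d r) * K, by positivity, ?_⟩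
  intro ν hν T t₀ t α ht₀ ht htT hα k hk h hh f hf
  choose g hgm hgtop hfg hgn using fun i => (hf i).exists_measurable hr0 hq0
  have hgam := gammaFactor_nonneg (k := k) hδ.le hα
  have hexp : -((k : ℝ) * ((d : ℝ) / 2 * (r⁻¹).toReal + 1 / 2)) = -(k * κ) := by rw [hκ]; ring
  rw [hexp]
  have hMnn : 0 ≤ ((1 + 23 * 2 ^ ((d : ℝ) / 2)) * bridgeConst d r * (C * Real.exp δ) +
      (1 + 2 * sqConst d r) * (1 + bridgeConst d r) * K) ^ k * ν ^ (-(k * κ)) *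
      gammaFactor k δ α := by positivity
  have htt : 0 ≤ t - t₀ := sub_nonneg.2 ht
  have hRHS : 0 ≤ ((1 + 23 * 2 ^ ((d : ℝ) / 2)) * bridgeConst d r * (C * Real.exp δ) +
      (1 + 2 * sqConst d r) * (1 + bridgeConst d r) * K) ^ k * ν ^ (-(k * κ)) *
      gammaFactor k δ α * (t - t₀) ^ (α + k * δ) * ∏ i, (mixedNorm r q T (f i)).toReal :=
    mul_nonneg (mul_nonneg hMnn (Real.rpow_nonneg htt _))
      (Finset.prod_nonneg fun _ _ => ENNReal.toReal_nonneg)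
  have hfin : ∀ {X : ℝ≥0∞}, X ≤ ENNReal.ofReal (((1 + 23 * 2 ^ ((d : ℝ) / 2)) *
      bridgeConst d r * (C * Real.exp δ) + (1 + 2 * sqConst d r) * (1 + bridgeConst d r) * K) ^ k *
      ν ^ (-(k * κ)) * gammaFactor k δ α) * pw (α + k * δ) (t - t₀) *
      ∏ i, eLpNorm (fun t => eLpNorm (fun x => g i x t) r volume) q volume →
      X ≤ ENNReal.ofReal (((1 + 23 * 2 ^ ((d : ℝ) / 2)) *
      bridgeConst d r * (C * Real.exp δ) + (1 + 2 * sqConst d r) * (1 + bridgeConst d r) * K) ^ k *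
      ν ^ (-(k * κ)) * gammaFactor k δ α * (t - t₀) ^ (α + k * δ) *
      ∏ i, (mixedNorm r q T (f i)).toReal) := by
    intro X hX
    simp only [hgn] at hX
    exact le_ofReal_of_le_mul_pw hMnn htt (fun i => (hf i).2.ne) hX
  match k, hk with
  | 1, hk =>
    obtain ⟨hcm, hcle⟩ := (show IsOfType ν 1 (h 0) from hh 0).one_cut hν
    refine blockIntegral_bound hk ht₀ htT hfg hgm (fun i => ?_) (fun s => ⟨?_, ?_⟩) hRHS
      (hfin ((lintegral_single_le (h := fun i => cut (h i)) hr1 hν hgm hcm hcle hκ hδ hδ2 hκ1 hC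
        step hα t₀ t).trans ?_))
    · rwa [Subsingleton.elim i 0]
    · refine (measurable_chainProd hgm (fun i => ?_) t₀ measurable_const
        measurable_id).aestronglyMeasurable
      rwa [Subsingleton.elim i 0]
    · refine (lintegral_chainProd_one_le (h := fun i => cut (h i)) hr1 hgm hcm hcle
        t₀ s).trans_lt ?_
      exact ENNReal.mul_lt_top ENNReal.ofReal_lt_top
        (ENNReal.mul_lt_top (hgtop _ _).lt_top (pw_ne_top _ _).lt_top)
    · gcongr
      have h1 : 0 ≤ (23 * 2 ^ ((d : ℝ) / 2)) * bridgeConst d r * (C * Real.exp δ) := by positivity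
      have h2 : 0 ≤ (1 + 2 * sqConst d r) * (1 + bridgeConst d r) * K := by positivity
      linarith
  | n + 2, hk =>
    have hlast : IsOfType ν 2 (h (Fin.last (n + 1))) := by
      have := hh (Fin.last (n + 1))
      simpa [blockType] using this
    have hzero : IsOfType ν 0 (h 0) := by
      have := hh 0
      simpa [blockType] using this
    have hone : ∀ i : Fin (n + 1), (i : ℕ) ≠ 0 → IsOfType ν 1 (h i.castSucc) := by
      intro i hi
      have := hh i.castSucc
      have h2 : (i : ℕ) ≠ n + 1 := i.2.ne
      simpa [blockType, hi, h2] using this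
    obtain ⟨i, j, hij⟩ := hlast.two_eq hν
    have hcm : ∀ l, Measurable (Function.uncurry (cut (h l))) := by
      intro l
      refine Fin.lastCases ?_ (fun l => ?_) l
      · exact measurable_cut (k := heatK2 i j) (by fun_prop) hij
      · by_cases hl : (l : ℕ) = 0
        · have : l = 0 := Fin.ext hl
          rw [this]
          exact (hzero.zero_cut hν).1
        · exact ((hone l hl).one_cut hν).1
    set D : BlockData d n r ν :=
      { f := g
        h := fun l => cut (h l)
        measurable_f := hgm
        measurable_h := hcm
        norm_ne_top := hgtop
        enorm_h_le := by
          intro l x s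
          by_cases hl : (l : ℕ) = 0
          · have : l = 0 := Fin.ext hl
            rw [if_pos hl, one_mul, this]
            exact (hzero.zero_cut hν).2 x s
          · rw [if_neg hl]
            exact ((hone l hl).one_cut hν).2 x s
        i := i
        j := j
        h_last := fun x s hs => by rw [cut_of_pos _ _ hs]; exact congrFun (hij s hs) x
        h_last_nonpos := fun x s hs => cut_of_nonpos _ _ hs } with hD
    exact blockIntegral_bound hk ht₀ htT hfg hgm hcm (D.integrable_chainProd hr1 hν t₀) hRHS
      (hfin (D.lintegral_J_le hr hν hq hκ hμ hκδ hδ hδ2 hκ1 hC step hK0 hK hα t₀ t))
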